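/- **Setting.** Fourier transforms are normalised by $\hat f(\xi)=\int_{\mathbb R}e^{-ix\xi}f(x)\,dx$, and $|\nabla|$ is the Fourier multiplier $\widehat{|\nabla|f}(\xi)=|\xi|\hat f(\xi)$ (it annihilates constants). Let $L^2_+(\mathbb R)$ be the Hardy space of all $f\in L^2(\mathbb R)$ with $\hat f$ supported in $\xi\ge 0$, and let $\Pi_+$ be the orthogonal projector of $L^2(\mathbb R)$ onto it. Let $G$ be the (unbounded) adjoint of multiplication by $x$ on $L^2_+(\mathbb R)$, i.e. $\widehat{Gf}(\xi)=i\,\partial_\xi\hat f(\xi)\,\mathbf 1_{\xi>0}$ with domain $D(G)=\{f\in L^2_+(\mathbb R):\hat f|_{(0,\infty)}\in H^1(0,\infty)\}$, and for $f\in D(G)$ let $I_+(f)=\hat f(0^+)$. $\Pi_+$, $G$, $I_+$ act entrywise on $2\times2$ matrix-valued functions. For a bounded matrix-valued function $U$, the Toeplitz operator is $T_U f=\Pi_+(fU)$, with the matrix product $fU$ in this order. **Theorem.** Let $I\subseteq\mathbb R$ be an interval containing $0$, let $N\ge0$, and let $$M(t,x)=M_0+V(t,x),\qquad V(t,x)=\sum_{j=1}^N\frac{A_j(t)}{x-x_j(t)}+\sum_{j=1}^N\frac{A_j^*(t)}{x-\bar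 x_j(t)},\qquad t\in I,\ x\in\mathbb R,$$ where $M_0\in\mathbb C^{2\times2}$, the functions $A_j:I\to\mathbb C^{2\times 2}\setminus\{0\}$ and $x_j:I\to\mathbb C$ are differentiable, $\operatorname{Im}x_j(t)>0$, and for each $t$ the poles $x_1(t),\dots,x_N(t)$ are distinct. Assume that $M$ is the matrix form of a map into the unit sphere, i.e. $M(t,x)=m(t,x)\cdot\boldsymbol\sigma$ with $m(t,x)\in\mathbb S^2\subset\mathbb R^3$ and $\boldsymbol\sigma$ the Pauli matrices, and that $M$ solves the half-wave maps equation $$\partial_tM(t,x)=-\tfrac i2\,[M(t,x),|\nabla|M(t,x)],\qquad t\in I,\ x\in\mathbb R .$$ Put $V_0=V(0,\cdot)$ and $U_0=M(0,\cdot)=M_0+V_0$. Then for all $t\in I$ and all $x\in\mathbb R$ the operator $G-tT_{U_0}-x\,\mathrm{Id}$ is injective on matrix-valued functions with entries in $D(G)$, its range contains $\Pi_+V_0$, and $$\Pi_+V(t,x)=\frac1{2i\pi}\,I_+\!\left[(G-tT_{U_0}-x\,\mathrm{Id})^{-1}\,\Pi_+V_0\right],$$ where $\Pi_+V(t,\cdot)$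 denotes the continuous representative. -/

import Mathlib

open MeasureTheory Set Filter Topology FourierTransform
open scoped ENNReal Matrix

/-- `L²(ℝ)`, with complex values. -/
abbrev L2 : Type := Lp ℂ 2 (volume : Measure ℝ)

/-- `L^∞(ℝ)`, with complex values. -/
abbrev LInf : Type := Lp ℂ ∞ (volume : Measure ℝ)

/-- Complex `2 × 2` matrices. -/
abbrev Mat2 : Type := Matrix (Fin 2) (Fin 2) ℂ

/-- The Fourier transform of an `L²` function, normalised as
`f̂(ξ) = ∫ exp (-i x ξ) f(x) dx`. (Mathlib's `𝓕` is normalised with `exp (-2 π i x ξ)`.) -/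
noncomputable def hat (f : L2) (ξ : ℝ) : ℂ := (𝓕 f : L2) (ξ / (2 * Real.pi))

theorem quasi_div_two_pi :
    Measure.QuasiMeasurePreserving (fun ξ : ℝ => ξ / (2 * Real.pi)) volume volume := by
  refine ⟨by fun_prop, ?_⟩
  have h : (2 * Real.pi)⁻¹ ≠ 0 := by positivity
  have := Real.map_volume_mul_right h
  simp only [div_eq_mul_inv]
  rw [this]
  exact Measure.smul_absolutelyContinuous

theorem quasi_mul_two_pi :
    Measure.QuasiMeasurePreserving (fun ξ : ℝ => ξ * (2 * Real.pi)) volume volume := by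
  refine ⟨by fun_prop, ?_⟩
  have h : (2 * Real.pi) ≠ 0 := by positivity
  rw [Real.map_volume_mul_right h]
  exact Measure.smul_absolutelyContinuous

theorem hat_add (f g : L2) : ∀ᵐ ξ, hat (f + g) ξ = hat f ξ + hat g ξ := by
  have h : ((𝓕 (f + g) : L2) : ℝ → ℂ) =ᵐ[volume] fun ξ => (𝓕 f : L2) ξ + (𝓕 g : L2) ξ := by
    rw [FourierTransform.fourier_add]
    exact Lp.coeFn_add _ _
  exact quasi_div_two_pi.ae h

theorem hat_smul (c : ℂ) (f : L2) : ∀ᵐ ξ, hat (c • f) ξ = c * hat f ξ := by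
  have h : ((𝓕 (c • f) : L2) : ℝ → ℂ) =ᵐ[volume] fun ξ => c * (𝓕 f : L2) ξ := by
    rw [FourierTransform.fourier_smul]
    exact Lp.coeFn_smul _ _
  exact quasi_div_two_pi.ae h

theorem hat_zero : ∀ᵐ ξ, hat 0 ξ = 0 := by
  have h := hat_smul 0 0
  simpa using h

theorem intervalIntegrable_of_locallyIntegrable {f : ℝ → ℂ} (hf : LocallyIntegrable f volume)
    (a b : ℝ) : IntervalIntegrable f volume a b :=
  intervalIntegrable_iff.2 <|
    (hf.integrableOn_isCompact isCompact_uIcc).mono_set uIoc_subset_uIcc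

theorem memLp_hat (f : L2) : MemLp (hat f) 2 volume := by
  have h2 : MemLp ((𝓕 f : L2) : ℝ → ℂ) 2 volume := Lp.memLp _
  have hm : AEStronglyMeasurable (hat f) volume :=
    h2.1.comp_quasiMeasurePreserving quasi_div_two_pi
  rw [memLp_two_iff_integrable_sq_norm hm]
  rw [memLp_two_iff_integrable_sq_norm h2.1] at h2
  exact h2.comp_div (by positivity)

/-- The Hardy space `L²₊(ℝ)`: the functions in `L²(ℝ)` whose Fourier transform is supported in
`ξ ≥ 0`. -/
noncomputable def hardyPlus : Submodule ℂ L2 where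
  carrier := {f | ∀ᵐ ξ, ξ < 0 → hat f ξ = 0}
  add_mem' := by
    intro f g hf hg
    filter_upwards [hf, hg, hat_add f g] with ξ h1 h2 h3 h
    rw [h3, h1 h, h2 h, add_zero]
  zero_mem' := by
    filter_upwards [hat_zero] with ξ h _
    exact h
  smul_mem' := by
    intro c f hf
    filter_upwards [hf, hat_smul c f] with ξ h1 h2 h
    rw [h2, h1 h, mul_zero]

theorem isClosed_hardyPlus : IsClosed (hardyPlus : Set L2) := by
  have key : (hardyPlus : Set L2) =
      {f | LpToLpRestrictCLM ℝ ℂ ℂ volume 2 (Iio (0 : ℝ)) (𝓕 f : L2) = 0} := by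
    ext f
    have h0 : LpToLpRestrictCLM ℝ ℂ ℂ volume 2 (Iio (0 : ℝ)) (𝓕 f : L2) = 0 ↔
        ∀ᵐ ξ : ℝ, ξ < 0 → (𝓕 f : L2) ξ = 0 := by
      rw [Lp.eq_zero_iff_ae_eq_zero]
      refine Iff.trans ?_ (ae_restrict_iff' measurableSet_Iio)
      have h1 := LpToLpRestrictCLM_coeFn ℂ (Iio (0 : ℝ)) (𝓕 f : L2)
      constructor
      · intro h
        filter_upwards [h, h1] with ξ a b
        rw [← b, a]; rfl
      · intro h
        filter_upwards [h, h1] with ξ a b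
        rw [b, a]; rfl
    change (∀ᵐ ξ : ℝ, ξ < 0 → (𝓕 f : L2) (ξ / (2 * Real.pi)) = 0) ↔ _
    rw [mem_ofPred_eq, h0]
    have hp : 0 < 2 * Real.pi := by positivity
    constructor
    · intro h
      filter_upwards [quasi_mul_two_pi.ae h] with ξ a hξ
      have := a (mul_neg_of_neg_of_pos hξ hp)
      rwa [mul_div_cancel_right₀ _ hp.ne'] at this
    · intro h
      filter_upwards [quasi_div_two_pi.ae h] with ξ a hξ
      exact a (div_neg_of_neg_of_pos hξ hp)
  rw [key]
  have hc : Continuous fun f : L2 => (𝓕 f : L2) := FourierTransform.continuous_fourier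
  exact isClosed_eq ((LpToLpRestrictCLM ℝ ℂ ℂ volume 2 (Iio (0 : ℝ))).continuous.comp hc)
    continuous_const

instance : CompleteSpace hardyPlus := isClosed_hardyPlus.completeSpace_coe

/-- `Π₊`: the orthogonal projector of `L²(ℝ)` onto `L²₊(ℝ)`. -/
noncomputable def piPlus : L2 →L[ℂ] hardyPlus := hardyPlus.orthogonalProjectionOnto

/-- The Toeplitz operator `T_g f = Π₊ (f g)` on `L²₊(ℝ)`, for a scalar symbol `g ∈ L^∞(ℝ)`. -/
noncomputable def toeplitz (g : LInf) (f : hardyPlus) : hardyPlus :=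
  piPlus (g • (f : L2) : L2)

/-- The Toeplitz operator `T_U f = Π₊ (f U)` for a matrix-valued symbol `U` and matrix-valued `f`;
`f U` is the matrix product in this order, and `Π₊` acts entrywise. -/
noncomputable def toeplitzMat (U : Matrix (Fin 2) (Fin 2) LInf)
    (f : Matrix (Fin 2) (Fin 2) hardyPlus) : Matrix (Fin 2) (Fin 2) hardyPlus :=
  Matrix.of fun a b => ∑ k, toeplitz (U k b) (f a k)

/-- The graph of `G` on `L²₊(ℝ)`: `(f, g)` belongs to it when, on `(0, ∞)`, `f̂` has a locally
absolutely continuous representative `φ` with `i φ' = ĝ`. -/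
noncomputable def hardyGGraph : Submodule ℂ (hardyPlus × hardyPlus) where
  carrier := {p | ∃ φ : ℝ → ℂ, (∀ᵐ ξ, 0 < ξ → φ ξ = hat p.1 ξ) ∧
    ∀ a b : ℝ, 0 < a → 0 < b → φ b - φ a = ∫ ξ in a..b, -Complex.I * hat p.2 ξ}
  add_mem' := by
    rintro ⟨f, g⟩ ⟨f', g'⟩ ⟨φ, h1, h2⟩ ⟨ψ, h3, h4⟩
    refine ⟨fun ξ => φ ξ + ψ ξ, ?_, ?_⟩
    · filter_upwards [h1, h3, hat_add (f : L2) (f' : L2)] with ξ a b c h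
      simp only [a h, b h]
      exact c.symm
    · intro a b ha hb
      have hi : ∀ q : L2, IntervalIntegrable (fun ξ => -Complex.I * hat q ξ) volume a b :=
        fun q => (intervalIntegrable_of_locallyIntegrable
          ((memLp_hat q).locallyIntegrable (by norm_num)) a b).const_mul _
      have : (∫ ξ in a..b, -Complex.I * hat ((g : L2) + (g' : L2)) ξ) =
          ∫ ξ in a..b, (-Complex.I * hat g ξ + -Complex.I * hat g' ξ) := by
        refine intervalIntegral.integral_congr_ae ?_
        filter_upwards [hat_add (g : L2) (g' : L2)] with ξ c _
        rw [c, mul_add]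
      change _ = ∫ ξ in a..b, -Complex.I * hat ((g : L2) + (g' : L2)) ξ
      rw [this, intervalIntegral.integral_add (hi _) (hi _)]
      have e1 := h2 a b ha hb
      have e2 := h4 a b ha hb
      simp only at e1 e2
      rw [← e1, ← e2]
      ring
  zero_mem' := by
    refine ⟨fun _ => 0, ?_, ?_⟩
    · filter_upwards [hat_zero] with ξ a _
      exact a.symm
    · intro a b _ _
      have : (∫ ξ in a..b, -Complex.I * hat 0 ξ) = ∫ ξ in a..b, (0 : ℂ) := by
        refine intervalIntegral.integral_congr_ae ?_
        filter_upwards [hat_zero] with ξ c _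
        rw [c, mul_zero]
      change _ = ∫ ξ in a..b, -Complex.I * hat 0 ξ
      rw [this]
      simp
  smul_mem' := by
    rintro c ⟨f, g⟩ ⟨φ, h1, h2⟩
    refine ⟨fun ξ => c * φ ξ, ?_, ?_⟩
    · filter_upwards [h1, hat_smul c (f : L2)] with ξ a b h
      simp only [a h]
      exact b.symm
    · intro a b ha hb
      have : (∫ ξ in a..b, -Complex.I * hat (c • (g : L2)) ξ) =
          ∫ ξ in a..b, c * (-Complex.I * hat g ξ) := by
        refine intervalIntegral.integral_congr_ae ?_
        filter_upwards [hat_smul c (g : L2)] with ξ e _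
        rw [e]; ring
      change _ = ∫ ξ in a..b, -Complex.I * hat (c • (g : L2)) ξ
      rw [this, intervalIntegral.integral_const_mul]
      have e1 := h2 a b ha hb
      simp only at e1
      rw [← e1]
      ring

/-- The operator `G`, the adjoint of the multiplication by `x` on `L²₊(ℝ)`, as an unbounded
operator: `(G f)^(ξ) = i ∂_ξ f̂(ξ)` for `ξ > 0`, on the domain of those `f ∈ L²₊(ℝ)` for which `f̂`
restricted to `(0, ∞)` lies in `H¹(0, ∞)`. -/
noncomputable def hardyG : hardyPlus →ₗ.[ℂ] hardyPlus := hardyGGraph.toLinearPMap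

/-- The graph is single-valued, so `hardyG` is the operator with graph `hardyGGraph`. -/
theorem hardyGGraph_single_valued (p : hardyPlus × hardyPlus) (hp : p ∈ hardyGGraph)
    (h0 : p.1 = 0) : p.2 = 0 := by
  obtain ⟨f, g⟩ := p
  obtain ⟨φ, h1, h2⟩ := hp
  simp only at h0 h1 h2 ⊢
  subst h0
  have hφ : ∀ᵐ ξ : ℝ, 0 < ξ → φ ξ = 0 := by
    filter_upwards [h1, hat_zero] with ξ a b h
    rw [a h]; exact b
  have hloc : LocallyIntegrable (fun ξ => -Complex.I * hat g ξ) volume :=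
    ((memLp_hat (g : L2)).const_mul _).locallyIntegrable (by norm_num)
  have hii : ∀ a b, IntervalIntegrable (fun ξ => -Complex.I * hat g ξ) volume a b :=
    fun a b => intervalIntegrable_of_locallyIntegrable hloc a b
  have hcont : Continuous fun b => ∫ ξ in (1 : ℝ)..b, -Complex.I * hat g ξ :=
    intervalIntegral.continuous_primitive hii 1
  have hφc : ContinuousOn φ (Ioi 0) := by
    have : ContinuousOn (fun b => φ 1 + ∫ ξ in (1 : ℝ)..b, -Complex.I * hat g ξ) (Ioi 0) :=
      (continuous_const.add hcont).continuousOn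
    refine this.congr fun b hb => ?_
    simp only [← h2 1 b one_pos hb]; ring
  have hz : EqOn φ (fun _ => 0) (Ioi 0) := by
    refine Measure.eqOn_open_of_ae_eq (μ := volume) ?_ isOpen_Ioi hφc continuousOn_const
    exact (ae_restrict_iff' measurableSet_Ioi).2 hφ
  have hint : ∀ b : ℝ, 0 < b → ∫ ξ in (1 : ℝ)..b, -Complex.I * hat g ξ = 0 := by
    intro b hb
    rw [← h2 1 b one_pos hb, hz hb, hz (mem_Ioi.2 one_pos), sub_zero]
  have hg : ∀ᵐ ξ, hat g ξ = 0 := by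
    have hn : ∀ᵐ ξ : ℝ, ξ ≠ 0 := by simp [ae_iff]
    filter_upwards [LocallyIntegrable.ae_hasDerivAt_integral hloc, g.2, hn] with ξ hd hneg hne
    rcases lt_or_gt_of_ne hne with h | h
    · exact hneg h
    · have e : (fun b => ∫ ξ in (1 : ℝ)..b, -Complex.I * hat g ξ) =ᶠ[𝓝 ξ] fun _ => 0 := by
        filter_upwards [Ioi_mem_nhds h] with b hb using hint b hb
      have := (hd 1).unique ((hasDerivAt_const ξ (0 : ℂ)).congr_of_eventuallyEq e)
      simpa using this
  have hF : (𝓕 (g : L2) : L2) = 0 := by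
    rw [Lp.eq_zero_iff_ae_eq_zero]
    filter_upwards [quasi_mul_two_pi.ae hg] with ξ a
    have hp : 2 * Real.pi ≠ 0 := by positivity
    simpa [hat, mul_div_cancel_right₀ _ hp] using a
  have h3 : (g : L2) = 0 := by
    have := Lp.norm_fourier_eq (g : L2)
    rw [hF, norm_zero] at this
    exact norm_eq_zero.1 this.symm
  exact Subtype.ext h3

theorem hardyG_graph : hardyG.graph = hardyGGraph :=
  Submodule.toLinearPMap_graph_eq _ hardyGGraph_single_valued

/-- `I₊(f) = f̂(0⁺) = c`: the limit of `f̂(ξ)` as `ξ → 0⁺`, up to null sets of `ξ`. -/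
def HasIPlus (f : hardyPlus) (c : ℂ) : Prop :=
  Tendsto (hat f) (𝓝[>] (0 : ℝ) ⊓ ae volume) (𝓝 c)

/-- The operator `G - t T_U - x Id` on matrix-valued functions with entries in the domain of `G`;
`G` and `Id` act entrywise. -/
noncomputable def gerardOp (U : Matrix (Fin 2) (Fin 2) LInf) (t x : ℝ)
    (f : Matrix (Fin 2) (Fin 2) hardyG.domain) : Matrix (Fin 2) (Fin 2) hardyPlus :=
  f.map (fun h => hardyG h) - (t : ℂ) • toeplitzMat U (f.map fun h => (h : hardyPlus))
    - (x : ℂ) • f.map fun h => (h : hardyPlus)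

/-- `g = |∇| f` for `f ∈ c + L²(ℝ)` with `c` a constant: `ĝ(ξ) = |ξ| (f - c)^(ξ)`, and `g` is the
continuous representative. (The constant is unique, and `|∇|` annihilates constants.) -/
def IsAbsNabla (f g : ℝ → ℂ) : Prop :=
  Continuous g ∧ ∃ (c : ℂ) (u w : L2), (∀ᵐ y, u y = f y - c) ∧ (∀ᵐ y, w y = g y) ∧
    ∀ᵐ ξ : ℝ, hat w ξ = (|ξ| : ℝ) * hat u ξ

/-- The half-wave maps equation in matrix form, `∂_t M = -(i/2) [M, |∇| M]`, at all times of `I` and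
all points of the line. -/
def SolvesHWM (I : Set ℝ) (M : ℝ → ℝ → Mat2) : Prop :=
  ∃ D : ℝ → ℝ → Mat2,
    (∀ t ∈ I, ∀ a b, IsAbsNabla (fun y => M t y a b) (fun y => D t y a b)) ∧
    ∀ t ∈ I, ∀ y a b, HasDerivWithinAt (fun s => M s y a b)
      ((-(Complex.I / 2) • (M t y * D t y - D t y * M t y)) a b) I t

/-- `m · σ` for a real vector `m`, with `σ` the Pauli matrices. -/
noncomputable def pauli (m : EuclideanSpace ℝ (Fin 3)) : Mat2 :=
  !![(m 2 : ℂ), (m 0 : ℂ) - Complex.I * (m 1 : ℂ);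
     (m 0 : ℂ) + Complex.I * (m 1 : ℂ), -(m 2 : ℂ)]

/-- `∑ j, A_j / (y - x_j) + ∑ j, A_j^* / (y - conj x_j)`. -/
noncomputable def ratV {N : ℕ} (A : Fin N → Mat2) (x : Fin N → ℂ) (y : ℝ) : Mat2 :=
  ∑ j, ((y : ℂ) - x j)⁻¹ • A j + ∑ j, ((y : ℂ) - star (x j))⁻¹ • (A j)ᴴ

/-- `M(t, y) = M₀ + V(t, y)`, with `V` the rational function with residues `A_j(t)` and poles
`x_j(t)`, is on the time set `I` a rational solution with simple poles of the half-wave maps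
equation, in matrix form (`M = m · σ` for a map `m` into the unit sphere). -/
structure IsRationalSolution {N : ℕ} (I : Set ℝ) (M₀ : Mat2)
    (A : ℝ → Fin N → Mat2) (x : ℝ → Fin N → ℂ) : Prop where
  differentiableOn_residue : ∀ j a b, DifferentiableOn ℝ (fun t => A t j a b) I
  differentiableOn_pole : ∀ j, DifferentiableOn ℝ (fun t => x t j) I
  im_pos : ∀ t ∈ I, ∀ j, 0 < (x t j).im
  pole_injective : ∀ t ∈ I, Function.Injective (x t)
  residue_ne_zero : ∀ t ∈ I, ∀ j, A t j ≠ 0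
  sphere : ∀ t ∈ I, ∀ y : ℝ, ∃ m : EuclideanSpace ℝ (Fin 3), ‖m‖ = 1 ∧
    M₀ + ratV (A t) (x t) y = pauli m
  equation : SolvesHWM I fun t y => M₀ + ratV (A t) (x t) y

theorem continuous_pole {z : ℂ} (hz : z.im ≠ 0) : Continuous fun y : ℝ => ((y : ℂ) - z)⁻¹ := by
  refine Continuous.inv₀ (by fun_prop) fun y h => hz ?_
  have := congrArg Complex.im h
  simpa using this

theorem norm_pole_le {z : ℂ} (hz : z.im ≠ 0) (y : ℝ) : ‖((y : ℂ) - z)⁻¹‖ ≤ |z.im|⁻¹ := by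
  rw [norm_inv]
  refine inv_anti₀ (abs_pos.2 hz) ?_
  have := Complex.abs_im_le_norm ((y : ℂ) - z)
  simpa using this

theorem memLp_top_pole {z : ℂ} (hz : z.im ≠ 0) :
    MemLp (fun y : ℝ => ((y : ℂ) - z)⁻¹) ∞ volume :=
  memLp_top_of_bound (continuous_pole hz).aestronglyMeasurable _ (ae_of_all _ (norm_pole_le hz))

theorem memLp_two_pole {z : ℂ} (hz : z.im ≠ 0) :
    MemLp (fun y : ℝ => ((y : ℂ) - z)⁻¹) 2 volume := by
  rw [memLp_two_iff_integrable_sq_norm (continuous_pole hz).aestronglyMeasurable]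
  have h : Integrable (fun y : ℝ => (z.im ^ 2)⁻¹ * (1 + ((y - z.re) / z.im) ^ 2)⁻¹) :=
    ((integrable_inv_one_add_sq.comp_div hz).comp_sub_right z.re).const_mul _
  refine h.congr (ae_of_all _ fun y => ?_)
  have e : ‖((y : ℂ) - z)‖ ^ 2 = (y - z.re) ^ 2 + z.im ^ 2 := by
    rw [Complex.sq_norm, Complex.normSq_apply]
    simp
    ring
  simp only
  rw [norm_inv, inv_pow, e, ← mul_inv]
  congr 1
  field_simp
  ring

theorem memLp_ratV {N : ℕ} (A : Fin N → Mat2) (x : Fin N → ℂ) (hx : ∀ j, 0 < (x j).im)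
    (a b : Fin 2) : MemLp (fun y => ratV A x y a b) 2 volume := by
  simp only [ratV, Matrix.add_apply, Matrix.sum_apply, Matrix.smul_apply, smul_eq_mul]
  refine MemLp.add ?_ ?_ <;> refine memLp_finsetSum _ fun j _ => ?_
  · exact (memLp_two_pole (hx j).ne').mul_const _
  · refine (memLp_two_pole ?_).mul_const _
    simpa using (hx j).ne'

theorem memLp_top_ratV {N : ℕ} (M₀ : Mat2) (A : Fin N → Mat2) (x : Fin N → ℂ)
    (hx : ∀ j, 0 < (x j).im) (a b : Fin 2) :
    MemLp (fun y => (M₀ + ratV A x y) a b) ∞ volume := by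
  simp only [ratV, Matrix.add_apply, Matrix.sum_apply, Matrix.smul_apply, smul_eq_mul]
  refine MemLp.add (memLp_top_const _) ?_
  refine MemLp.add ?_ ?_ <;> refine memLp_finsetSum _ fun j _ => ?_
  · exact (memLp_top_pole (hx j).ne').mul_const _
  · refine (memLp_top_pole ?_).mul_const _
    simpa using (hx j).ne'

/-- `Π₊ V`, entrywise, for the rational function `V` with residues `A_j` and poles `x_j`. -/
noncomputable def piPlusV {N : ℕ} (A : Fin N → Mat2) (x : Fin N → ℂ)
    (hx : ∀ j, 0 < (x j).im) : Matrix (Fin 2) (Fin 2) hardyPlus :=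
  Matrix.of fun a b => piPlus ((memLp_ratV A x hx a b).toLp)

/-- The matrix-valued bounded function `M₀ + V`, for the rational function `V` with residues `A_j`
and poles `x_j`, as a Toeplitz symbol. -/
noncomputable def symbolM {N : ℕ} (M₀ : Mat2) (A : Fin N → Mat2) (x : Fin N → ℂ)
    (hx : ∀ j, 0 < (x j).im) : Matrix (Fin 2) (Fin 2) LInf :=
  Matrix.of fun a b => (memLp_top_ratV M₀ A x hx a b).toLp

/-!
# The explicit formula for rational half-wave maps

The poles in the lower half-plane reduce the formula to linear algebra in dimension `N`. Let
`U = M₀ + V`, and let `B_j` be the regular part of `U` at `x_j`. The identity `U² = 1`, expanded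
at `x_j`, gives `A_j² = 0` and `A_j B_j + B_j A_j = 0`, so that `A_j = u_j v_j` with a column
`u_j` and a row `v_j` satisfying `v_j u_j = 0` and `B_j u_j = ℓ_j u_j`
(`exists_isSpinFactorization`). The functions `∑ j, κ_j u_j^* / (y - conj x_j)`, with columns
`κ_j`, are in the domain of `G`, and `G - t T_U - y` preserves the space of these functions: on
`κ` it acts as the complex conjugate of the matrix `pencil = diag (x_j) - t L - y`, where `L` has
diagonal `ℓ_j` and off-diagonal entries `v_j u_k / (x_j - x_k)` (`gerardOp_spin`). Since `Π₊ V`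
has coefficients `κ_j = v_j^*`, the equation for the resolvent is solved as soon as the pencil is
invertible (`exists_gerardOp_eq`), and `I₊` of the solution is `-2πi` times the adjoint of
`u (pencil)⁻¹ v`.

It remains to see that `u (pencil)⁻¹ v`, taken at time `0` with the parameter `t`, equals
`∑ j, A_j(t) / (x_j(t) - y)`, which is the same expression at time `t` with the parameter `0`. The
half-wave maps equation extends from the real line to all complex arguments, and its Laurent
coefficients at `x_j` are a spin Calogero–Moser system with `x_j' = -ℓ_j`. In suitable
normalizations of `u_j`, `v_j`, the matrix `Y(s) = diag (x_j(s)) - (t - s) L(s) - y + v E u`, for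
a constant `E`, satisfies a Lax equation `Y' = [B, Y]` with an `N × N` matrix `B`
(`IsSpinFlow.matDeriv_pencil`), so `det Y` is constant in time
(`IsRationalSolution.det_pencil_eq`). The normalizations are only available near a given time, but
the determinant does not depend on them (`IsSpinFactorization.det_pencil_eq`). For `E = 0` this
gives the invertibility of the pencil, because at time `t` it is `diag (x_j(t) - y)`; for `E` of
rank one it gives the entries of `u (pencil)⁻¹ v` (`IsRationalSolution.exists_resolvent`).

Injectivity rests on the boundary form `2πi (⟨f', G f⟩ - ⟨G f', f⟩) = conj I₊(f') I₊(f)` of `G`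
(`HasTrace.boundary_form`): an element of the kernel has `I₊ = 0` and is orthogonal to the range
of `G - t T_U - y`, and by `U² = 1` this range is dense (`gerardOp_injective`).
-/

/-! ### The Fourier transform of square-integrable functions -/

/-- On integrable functions, the Fourier inversion of `L²` is given by the integral. -/
theorem fourierInv_toLp_ae_eq {g : ℝ → ℂ} (h1 : Integrable g) (h2 : MemLp g 2) :
    ((𝓕⁻ (h2.toLp g) : L2) : ℝ → ℂ) =ᵐ[volume] (𝓕⁻ g : ℝ → ℂ) := by
  have hc : Continuous (𝓕⁻ g : ℝ → ℂ) :=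
    VectorFourier.fourierIntegral_continuous Real.continuous_fourierChar
      (by simp only [LinearMap.neg_apply]; exact continuous_inner.neg) h1
  refine ae_eq_of_integral_contDiff_smul_eq
    ((Lp.memLp (𝓕⁻ (h2.toLp g) : L2)).locallyIntegrable (by norm_num)) hc.locallyIntegrable ?_
  intro φ hφ hs
  have hs' : HasCompactSupport (fun x => (φ x : ℂ)) := hs.comp_left (g := fun r : ℝ => (r : ℂ)) rfl
  have hφ' : ContDiff ℝ (↑(⊤ : ℕ∞)) (fun x => (φ x : ℂ)) := Complex.ofRealCLM.contDiff.comp hφ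
  let ψ : SchwartzMap ℝ ℂ := hs'.toSchwartzMap hφ'
  have e1 := DFunLike.congr_fun (Lp.fourierInv_toTemperedDistribution_eq (h2.toLp g)) ψ
  rw [TemperedDistribution.fourierInv_apply, Lp.toTemperedDistribution_apply,
    Lp.toTemperedDistribution_apply] at e1
  have e2 := VectorFourier.integral_fourierIntegral_smul_eq_flip (μ := volume) (ν := volume)
    (L := -innerₗ ℝ) (f := (ψ : ℝ → ℂ)) (g := g)
    Real.continuous_fourierChar (by simp only [LinearMap.neg_apply]; exact continuous_inner.neg)
    ψ.integrable h1
  have e3 : (-innerₗ ℝ : ℝ →ₗ[ℝ] ℝ →ₗ[ℝ] ℝ).flip = -innerₗ ℝ := by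
    ext; simp
  rw [e3] at e2
  calc ∫ x, φ x • (𝓕⁻ (h2.toLp g) : L2) x = ∫ x, ψ x • (𝓕⁻ (h2.toLp g) : L2) x := by
        refine integral_congr_ae (ae_of_all _ fun x => ?_)
        change _ = (φ x : ℂ) • _
        simp
    _ = ∫ x, (𝓕⁻ ψ : SchwartzMap ℝ ℂ) x • (h2.toLp g) x := e1.symm
    _ = ∫ x, (𝓕⁻ ψ : SchwartzMap ℝ ℂ) x • g x := by
        refine integral_congr_ae ?_
        filter_upwards [h2.coeFn_toLp] with x hx
        rw [hx]
    _ = ∫ x, ψ x • (𝓕⁻ g : ℝ → ℂ) x := by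
        rw [SchwartzMap.fourierInv_coe]; exact e2
    _ = ∫ x, φ x • (𝓕⁻ g : ℝ → ℂ) x := by
        refine integral_congr_ae (ae_of_all _ fun x => ?_)
        change (φ x : ℂ) • _ = _
        simp

theorem fourier_ae_of_hat_ae {f : L2} {e : ℝ → ℂ} (h : hat f =ᵐ[volume] e) :
    ((𝓕 f : L2) : ℝ → ℂ) =ᵐ[volume] fun v => e (v * (2 * Real.pi)) := by
  filter_upwards [quasi_mul_two_pi.ae h] with v hv
  have hp : 2 * Real.pi ≠ 0 := by positivity
  simpa [hat, mul_div_cancel_right₀ _ hp] using hv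

theorem hat_injective {f g : L2} (h : hat f =ᵐ[volume] hat g) : f = g := by
  have h1 : (𝓕 f : L2) = 𝓕 g := by
    apply Lp.ext
    refine (fourier_ae_of_hat_ae h).trans (fourier_ae_of_hat_ae (EventuallyEq.refl _ _)).symm
  have := congrArg (fun u : L2 => (𝓕⁻ u : L2)) h1
  simpa using this

theorem exists_hat_ae_eq {e : ℝ → ℂ} (he : MemLp e 2) : ∃ f : L2, hat f =ᵐ[volume] e := by
  have hp : (2 * Real.pi) ≠ 0 := by positivity
  have hm : AEStronglyMeasurable (fun v => e (v * (2 * Real.pi))) volume :=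
    he.1.comp_quasiMeasurePreserving quasi_mul_two_pi
  have h2 : MemLp (fun v => e (v * (2 * Real.pi))) 2 := by
    rw [memLp_two_iff_integrable_sq_norm hm]
    rw [memLp_two_iff_integrable_sq_norm he.1] at he
    exact he.comp_mul_right' hp
  refine ⟨𝓕⁻ (h2.toLp _), ?_⟩
  have h3 : (𝓕 (𝓕⁻ (h2.toLp _) : L2) : L2) = h2.toLp _ := fourier_fourierInv_eq _
  filter_upwards [quasi_div_two_pi.ae h2.coeFn_toLp] with ξ hξ
  rw [hat, h3, hξ, div_mul_cancel₀ _ hp]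

theorem ae_eq_integral_of_hat_ae {f : L2} {e : ℝ → ℂ} (h1 : Integrable e)
    (h : hat f =ᵐ[volume] e) :
    f =ᵐ[volume] fun y : ℝ =>
      (2 * Real.pi : ℂ)⁻¹ * ∫ ξ : ℝ, Complex.exp (Complex.I * y * ξ) * e ξ := by
  have hp : (2 * Real.pi) ≠ 0 := by positivity
  have h1' : Integrable (fun v => e (v * (2 * Real.pi))) := h1.comp_mul_right' hp
  have h2' : MemLp (fun v => e (v * (2 * Real.pi))) 2 :=
    (Lp.memLp (𝓕 f : L2)).ae_eq (fourier_ae_of_hat_ae h)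
  have h3 : f = 𝓕⁻ (h2'.toLp _) := by
    have : (𝓕 f : L2) = h2'.toLp _ :=
      Lp.ext ((fourier_ae_of_hat_ae h).trans h2'.coeFn_toLp.symm)
    rw [← this]; exact (fourierInv_fourier_eq f).symm
  have h4 := fourierInv_toLp_ae_eq h1' h2'
  rw [← h3] at h4
  refine h4.trans (ae_of_all _ fun y => ?_)
  have h5 := Measure.integral_comp_mul_right
    (fun ξ : ℝ => Complex.exp (Complex.I * y * ξ) * e ξ) (2 * Real.pi)
  have h6 : ((2 * Real.pi : ℂ)⁻¹) = ((|(2 * Real.pi)⁻¹| : ℝ) : ℂ) := by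
    rw [abs_of_pos (by positivity)]; push_cast; ring
  simp only
  rw [h6, ← Complex.real_smul, ← h5, Real.fourierInv_eq']
  refine integral_congr_ae (ae_of_all _ fun v => ?_)
  simp only [smul_eq_mul]
  congr 2
  simp
  ring

theorem hat_ae_of_ae_eq_integral {f : L2} {e : ℝ → ℂ} (h1 : Integrable e) (h2 : MemLp e 2)
    (h : f =ᵐ[volume] fun y : ℝ =>
      (2 * Real.pi : ℂ)⁻¹ * ∫ ξ : ℝ, Complex.exp (Complex.I * y * ξ) * e ξ) :
    hat f =ᵐ[volume] e := by
  obtain ⟨g, hg⟩ := exists_hat_ae_eq h2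
  have : f = g := Lp.ext (h.trans (ae_eq_integral_of_hat_ae h1 hg).symm)
  rwa [this]

/-- Plancherel's formula. -/
theorem inner_eq_integral_hat (f g : L2) :
    (2 * Real.pi : ℂ) * inner ℂ f g = ∫ ξ : ℝ, star (hat f ξ) * hat g ξ := by
  rw [← Lp.inner_fourier_eq f g, L2.inner_def]
  have := Measure.integral_comp_div
    (fun v : ℝ => inner ℂ ((𝓕 f : L2) v) ((𝓕 g : L2) v)) (2 * Real.pi)
  rw [abs_of_pos (by positivity), Complex.real_smul] at this
  push_cast at this
  rw [← this]
  refine integral_congr_ae (ae_of_all _ fun v => ?_)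
  simp [hat, mul_comm]

theorem integrable_star_hat_mul (f g : L2) : Integrable fun ξ => star (hat f ξ) * hat g ξ :=
  (memLp_hat f).star.integrable_mul (memLp_hat g)

/-! ### The Fourier transforms of poles -/

/-- The function `ξ ^ n * exp (a * ξ)` on the half-line `ξ > 0`, extended by zero. -/
noncomputable def halfExp (a : ℂ) (n : ℕ) : ℝ → ℂ :=
  (Ioi (0 : ℝ)).indicator fun ξ : ℝ => (ξ : ℂ) ^ n * Complex.exp (a * ξ)

theorem exists_norm_pow_mul_exp_le (n : ℕ) {a : ℂ} (ha : a.re < 0) :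
    ∃ C : ℝ, 0 ≤ C ∧
      ∀ ξ : ℝ, 0 < ξ → ‖(ξ : ℂ) ^ n * Complex.exp (a * ξ)‖ ≤ C * Real.exp (a.re / 2 * ξ) := by
  set ρ := -a.re / 2 with hρ
  have hρ0 : 0 < ρ := by rw [hρ]; linarith
  refine ⟨n.factorial / ρ ^ n, by positivity, fun ξ hξ => ?_⟩
  have h := Real.pow_div_factorial_le_exp (ρ * ξ) (by positivity) n
  have hn : (0 : ℝ) < n.factorial := by positivity
  rw [div_le_iff₀ hn, mul_pow] at h
  have e1 : ‖(ξ : ℂ) ^ n * Complex.exp (a * ξ)‖ = ξ ^ n * Real.exp (a.re * ξ) := by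
    rw [norm_mul, norm_pow, Complex.norm_real, Complex.norm_exp, Real.norm_of_nonneg hξ.le]
    simp
  have e2 : Real.exp (a.re / 2 * ξ) = Real.exp (ρ * ξ) * Real.exp (a.re * ξ) := by
    rw [← Real.exp_add, hρ]; congr 1; ring
  rw [e1, e2, ← mul_assoc]
  refine mul_le_mul_of_nonneg_right ?_ (Real.exp_pos _).le
  rw [div_mul_eq_mul_div, le_div_iff₀ (by positivity)]
  linarith

theorem memLp_exp_Ioi {r : ℝ} (hr : r < 0) {p : ℝ≥0∞} (hp : p = 1 ∨ p = 2) :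
    MemLp (fun ξ : ℝ => Real.exp (r * ξ)) p (volume.restrict (Ioi 0)) := by
  have h : ∀ r : ℝ, r < 0 → IntegrableOn (fun ξ : ℝ => Real.exp (r * ξ)) (Ioi 0) := fun r hr => by
    have := exp_neg_integrableOn_Ioi 0 (neg_pos.2 hr)
    simpa using this
  rcases hp with rfl | rfl
  · exact memLp_one_iff_integrable.2 (h r hr)
  · rw [memLp_two_iff_integrable_sq (by fun_prop)]
    refine (h (2 * r) (by linarith)).congr (ae_of_all _ fun ξ => ?_)
    simp only
    rw [← Real.exp_nat_mul]
    congr 1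
    push_cast; ring

theorem memLp_halfExp {a : ℂ} (ha : a.re < 0) (n : ℕ) {p : ℝ≥0∞} (hp : p = 1 ∨ p = 2) :
    MemLp (halfExp a n) p := by
  unfold halfExp
  rw [memLp_indicator_iff_restrict measurableSet_Ioi]
  obtain ⟨C, _, hC⟩ := exists_norm_pow_mul_exp_le n ha
  refine MemLp.of_le_mul (c := C) (memLp_exp_Ioi (r := a.re / 2) (by linarith) hp)
    (Continuous.aestronglyMeasurable (by fun_prop)) ?_
  refine (ae_restrict_iff' measurableSet_Ioi).2 (ae_of_all _ fun ξ hξ => ?_)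
  rw [Real.norm_of_nonneg (Real.exp_pos _).le]
  exact hC ξ hξ

theorem tendsto_pow_mul_exp {a : ℂ} (ha : a.re < 0) (n : ℕ) :
    Tendsto (fun ξ : ℝ => (ξ : ℂ) ^ n * Complex.exp (a * ξ)) atTop (𝓝 0) := by
  obtain ⟨C, _, hC⟩ := exists_norm_pow_mul_exp_le n ha
  have h : Tendsto (fun ξ : ℝ => C * Real.exp (a.re / 2 * ξ)) atTop (𝓝 (C * 0)) := by
    refine Tendsto.const_mul C (Real.tendsto_exp_atBot.comp ?_)
    exact tendsto_id.const_mul_atTop_of_neg (by linarith)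
  rw [mul_zero] at h
  refine squeeze_zero_norm' ?_ h
  filter_upwards [eventually_gt_atTop (0 : ℝ)] with ξ hξ using hC ξ hξ

theorem integral_halfExp_zero {a : ℂ} (ha : a.re < 0) : ∫ ξ, halfExp a 0 ξ = -a⁻¹ := by
  unfold halfExp
  rw [integral_indicator measurableSet_Ioi]
  have := integral_exp_mul_complex_Ioi ha 0
  simpa [neg_div] using this

theorem integral_halfExp_one {a : ℂ} (ha : a.re < 0) : ∫ ξ, halfExp a 1 ξ = (a⁻¹) ^ 2 := by
  have ha0 : a ≠ 0 := fun h => by simp [h] at ha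
  unfold halfExp
  rw [integral_indicator measurableSet_Ioi]
  have hd : ∀ ξ ∈ Ici (0 : ℝ), HasDerivAt
      (fun ξ : ℝ => a⁻¹ * ((ξ : ℂ) ^ 1 * Complex.exp (a * ξ)) -
        (a⁻¹) ^ 2 * ((ξ : ℂ) ^ 0 * Complex.exp (a * ξ)))
      ((ξ : ℂ) ^ 1 * Complex.exp (a * ξ)) ξ := by
    intro ξ _
    have h1 : HasDerivAt (fun ξ : ℝ => (ξ : ℂ)) 1 ξ := Complex.ofRealCLM.hasDerivAt
    have h2 : HasDerivAt (fun ξ : ℝ => Complex.exp (a * ξ)) (Complex.exp (a * ξ) * (a * 1)) ξ :=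
      (h1.const_mul a).cexp
    simp only [pow_one, pow_zero, one_mul]
    convert! ((h1.mul h2).const_mul a⁻¹).sub (h2.const_mul ((a⁻¹) ^ 2)) using 1
    field_simp
    ring
  have hi : IntegrableOn (fun ξ : ℝ => (ξ : ℂ) ^ 1 * Complex.exp (a * ξ)) (Ioi 0) := by
    have := memLp_halfExp ha 1 (Or.inl rfl)
    rw [memLp_one_iff_integrable] at this
    exact (integrable_indicator_iff measurableSet_Ioi).1 this
  have ht := ((tendsto_pow_mul_exp ha 1).const_mul a⁻¹).sub
    ((tendsto_pow_mul_exp ha 0).const_mul ((a⁻¹) ^ 2))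
  rw [integral_Ioi_of_hasDerivAt_of_tendsto' hd hi ht]
  simp

theorem exp_mul_halfExp (a b : ℂ) (n : ℕ) (ξ : ℝ) :
    Complex.exp (b * ξ) * halfExp a n ξ = halfExp (b + a) n ξ := by
  by_cases h : ξ ∈ Ioi (0 : ℝ)
  · simp only [halfExp, indicator_of_mem h, add_mul, Complex.exp_add]; ring
  · simp [halfExp, indicator_of_notMem h]

/-- If `f` has Fourier transform `e`, then `conj f` has Fourier transform `ξ ↦ conj (e (-ξ))`. -/
theorem hat_star_ae {f g : L2} {e : ℝ → ℂ} (h1 : Integrable e) (h2 : MemLp e 2)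
    (h : hat f =ᵐ[volume] e) (hg : ∀ᵐ y, g y = star (f y)) :
    hat g =ᵐ[volume] fun ξ => star (e (-ξ)) := by
  have h1' : Integrable fun ξ => star (e (-ξ)) := by
    have := Complex.conjCLE.toContinuousLinearMap.integrable_comp h1.comp_neg
    exact this
  have h2' : MemLp (fun ξ => star (e (-ξ))) 2 :=
    (h2.comp_measurePreserving (Measure.measurePreserving_neg volume)).star
  refine hat_ae_of_ae_eq_integral h1' h2' ?_
  filter_upwards [hg, ae_eq_integral_of_hat_ae h1 h] with y hy hy'
  rw [hy, hy']
  have e1 : ∫ ξ : ℝ, Complex.exp (Complex.I * y * ξ) * star (e (-ξ)) =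
      ∫ ξ : ℝ, Complex.exp (Complex.I * y * (-ξ : ℝ)) * star (e ξ) := by
    rw [← integral_neg_eq_self]; simp
  rw [e1, star_mul', star_inv₀]
  congr 1
  · simp
  · change (starRingEnd ℂ) _ = _
    rw [← integral_conj]
    refine integral_congr_ae (ae_of_all _ fun ξ => ?_)
    simp only [map_mul, ← Complex.exp_conj]
    simp

open Classical in
/-- The function `y ↦ 1 / (y - z)` as an element of `L²(ℝ)`, for a non-real `z` (and `0` for a real
`z`). -/
noncomputable def pole (z : ℂ) : L2 :=
  if h : z.im ≠ 0 then (memLp_two_pole h).toLp else 0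

theorem pole_ae {z : ℂ} (hz : z.im ≠ 0) : ∀ᵐ y : ℝ, pole z y = ((y : ℂ) - z)⁻¹ := by
  rw [pole, dif_pos hz]
  exact (memLp_two_pole hz).coeFn_toLp

theorem memLp_two_pole_sq {z : ℂ} (hz : z.im ≠ 0) :
    MemLp (fun y : ℝ => (((y : ℂ) - z)⁻¹) ^ 2) 2 volume := by
  simp only [sq]
  exact (memLp_two_pole hz).mul (p := ∞) (memLp_top_pole hz)

theorem sub_ne_zero_of_im_ne {z : ℂ} (hz : z.im ≠ 0) (y : ℝ) : (y : ℂ) - z ≠ 0 := fun h => hz <| by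
  simpa using congrArg Complex.im h

theorem hat_pole_of_im_neg {z : ℂ} (hz : z.im < 0) :
    hat (pole z) =ᵐ[volume] fun ξ => -(2 * Real.pi * Complex.I) * halfExp (-Complex.I * z) 0 ξ := by
  have ha : (-Complex.I * z).re < 0 := by simpa using hz
  refine hat_ae_of_ae_eq_integral
    ((memLp_one_iff_integrable.1 (memLp_halfExp ha 0 (Or.inl rfl))).const_mul _)
    ((memLp_halfExp ha 0 (Or.inr rfl)).const_mul _) ?_
  filter_upwards [pole_ae hz.ne] with y hy
  have e : ∀ ξ : ℝ, Complex.exp (Complex.I * y * ξ) *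
      (-(2 * Real.pi * Complex.I) * halfExp (-Complex.I * z) 0 ξ) =
      -(2 * Real.pi * Complex.I) * halfExp (Complex.I * y + -Complex.I * z) 0 ξ := fun ξ => by
    rw [← exp_mul_halfExp]; ring
  simp only [e]
  rw [integral_const_mul, integral_halfExp_zero (by simpa using hz), hy]
  have h1 := sub_ne_zero_of_im_ne hz.ne y
  have h2 : (Complex.I * y + -Complex.I * z) = Complex.I * (y - z) := by ring
  have h3 : (Real.pi : ℂ) ≠ 0 := by exact_mod_cast Real.pi_ne_zero
  rw [h2]
  field_simp

theorem hat_pole_sq_of_im_neg {z : ℂ} (hz : z.im < 0) {f : L2}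
    (hf : ∀ᵐ y : ℝ, f y = (((y : ℂ) - z)⁻¹) ^ 2) :
    hat f =ᵐ[volume] fun ξ => -(2 * Real.pi) * halfExp (-Complex.I * z) 1 ξ := by
  have ha : (-Complex.I * z).re < 0 := by simpa using hz
  refine hat_ae_of_ae_eq_integral
    ((memLp_one_iff_integrable.1 (memLp_halfExp ha 1 (Or.inl rfl))).const_mul _)
    ((memLp_halfExp ha 1 (Or.inr rfl)).const_mul _) ?_
  filter_upwards [hf] with y hy
  have e : ∀ ξ : ℝ, Complex.exp (Complex.I * y * ξ) *
      (-(2 * Real.pi) * halfExp (-Complex.I * z) 1 ξ) =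
      -(2 * Real.pi) * halfExp (Complex.I * y + -Complex.I * z) 1 ξ := fun ξ => by
    rw [← exp_mul_halfExp]; ring
  simp only [e]
  rw [integral_const_mul, integral_halfExp_one (by simpa using hz), hy]
  have h1 := sub_ne_zero_of_im_ne hz.ne y
  have h2 : (Complex.I * y + -Complex.I * z) = Complex.I * (y - z) := by ring
  have h3 : (Real.pi : ℂ) ≠ 0 := by exact_mod_cast Real.pi_ne_zero
  rw [h2, mul_inv Complex.I, mul_pow, Complex.inv_I, neg_sq, Complex.I_sq]
  field_simp

theorem hat_pole_of_im_pos {z : ℂ} (hz : 0 < z.im) :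
    hat (pole z) =ᵐ[volume] fun ξ =>
      star (-(2 * Real.pi * Complex.I) * halfExp (-Complex.I * star z) 0 (-ξ)) := by
  have hz' : (star z).im < 0 := by simpa using hz
  have ha : (-Complex.I * star z).re < 0 := by simpa using hz
  refine hat_star_ae (f := pole (star z))
    ((memLp_one_iff_integrable.1 (memLp_halfExp ha 0 (Or.inl rfl))).const_mul _)
    ((memLp_halfExp ha 0 (Or.inr rfl)).const_mul _) (hat_pole_of_im_neg hz') ?_
  filter_upwards [pole_ae hz.ne', pole_ae hz'.ne] with y h1 h2
  rw [h1, h2]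
  simp

theorem hat_pole_sq_of_im_pos {z : ℂ} (hz : 0 < z.im) {f : L2}
    (hf : ∀ᵐ y : ℝ, f y = (((y : ℂ) - z)⁻¹) ^ 2) :
    hat f =ᵐ[volume] fun ξ =>
      star (-(2 * Real.pi) * halfExp (-Complex.I * star z) 1 (-ξ)) := by
  have hz' : (star z).im < 0 := by simpa using hz
  have ha : (-Complex.I * star z).re < 0 := by simpa using hz
  have hg := (memLp_two_pole_sq hz'.ne).coeFn_toLp
  refine hat_star_ae (f := (memLp_two_pole_sq hz'.ne).toLp)
    ((memLp_one_iff_integrable.1 (memLp_halfExp ha 1 (Or.inl rfl))).const_mul _)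
    ((memLp_halfExp ha 1 (Or.inr rfl)).const_mul _) (hat_pole_sq_of_im_neg hz' hg) ?_
  filter_upwards [hf, hg] with y h1 h2
  rw [h1, h2]
  simp

theorem halfExp_succ (a : ℂ) (n : ℕ) (ξ : ℝ) : halfExp a (n + 1) ξ = ξ * halfExp a n ξ := by
  by_cases h : ξ ∈ Ioi (0 : ℝ)
  · simp only [halfExp, indicator_of_mem h, pow_succ]; ring
  · simp [halfExp, indicator_of_notMem h]

/-- `1 / (y - z)²` is minus the derivative of `1 / (y - z)`, and `d/dy` has the multiplier `i ξ`. -/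
theorem hat_pole_sq {z : ℂ} (hz : z.im ≠ 0) {f : L2}
    (hf : ∀ᵐ y : ℝ, f y = (((y : ℂ) - z)⁻¹) ^ 2) :
    ∀ᵐ ξ : ℝ, hat f ξ = -Complex.I * ξ * hat (pole z) ξ := by
  rcases lt_or_gt_of_ne hz with h | h
  · filter_upwards [hat_pole_sq_of_im_neg h hf, hat_pole_of_im_neg h] with ξ h1 h2
    rw [h1, h2, halfExp_succ]
    linear_combination -(2 * Real.pi * ξ * halfExp (-Complex.I * z) 0 ξ) * Complex.I_sq
  · filter_upwards [hat_pole_sq_of_im_pos h hf, hat_pole_of_im_pos h] with ξ h1 h2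
    rw [h1, h2, halfExp_succ]
    simp
    linear_combination (2 * Real.pi * ξ *
      (starRingEnd ℂ) (halfExp (-(Complex.I * (starRingEnd ℂ) z)) 0 (-ξ))) * Complex.I_sq

theorem hat_pole_eq_zero_of_pos {z : ℂ} (hz : 0 < z.im) :
    ∀ᵐ ξ : ℝ, 0 < ξ → hat (pole z) ξ = 0 := by
  filter_upwards [hat_pole_of_im_pos hz] with ξ h h0
  rw [h]
  simp [halfExp, h0.le]

theorem hat_pole_eq_zero_of_neg {z : ℂ} (hz : z.im < 0) :
    ∀ᵐ ξ : ℝ, ξ < 0 → hat (pole z) ξ = 0 := by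
  filter_upwards [hat_pole_of_im_neg hz] with ξ h h0
  rw [h]
  simp [halfExp, h0.le]

/-! ### The boundary form of `G` -/

theorem absolutelyContinuousOnInterval_primitive {γ : ℝ → ℂ} (hγ : LocallyIntegrable γ volume)
    (c : ℂ) (a b : ℝ) (h0 : (0 : ℝ) ∈ uIcc a b) :
    AbsolutelyContinuousOnInterval (fun x => c + ∫ ξ in (0 : ℝ)..x, γ ξ) a b := by
  have hi : ∀ a b, IntervalIntegrable γ volume a b := intervalIntegrable_of_locallyIntegrable hγ
  have hconst : ∀ d : ℂ, AbsolutelyContinuousOnInterval (fun _ : ℝ => d) a b := fun d =>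
    (contDiffOn_const (𝕜 := ℝ) (n := 1)).absolutelyContinuousOnInterval
  have hre : IntervalIntegrable (fun ξ => (γ ξ).re) volume a b :=
    ⟨(hi a b).1.re, (hi a b).2.re⟩
  have him : IntervalIntegrable (fun ξ => (γ ξ).im) volume a b :=
    ⟨(hi a b).1.im, (hi a b).2.im⟩
  have h1 := (hre.absolutelyContinuousOnInterval_intervalIntegral h0).smul (hconst 1)
  have h2 := (him.absolutelyContinuousOnInterval_intervalIntegral h0).smul (hconst Complex.I)
  convert! (hconst c).add (h1.add h2) using 1
  funext x
  have hre' : IntervalIntegrable (fun ξ => (γ ξ).re) volume 0 x :=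
    ⟨(hi 0 x).1.re, (hi 0 x).2.re⟩
  have him' : IntervalIntegrable (fun ξ => (γ ξ).im) volume 0 x :=
    ⟨(hi 0 x).1.im, (hi 0 x).2.im⟩
  simp only [Pi.add_apply, Pi.smul_apply', Complex.real_smul, mul_one]
  rw [← intervalIntegral.integral_ofReal, ← intervalIntegral.integral_ofReal,
    ← intervalIntegral.integral_mul_const, ← intervalIntegral.integral_add]
  · simp only [Complex.re_add_im]
  · exact ⟨hre'.1.ofReal, hre'.2.ofReal⟩
  · exact IntervalIntegrable.mul_const ⟨him'.1.ofReal, him'.2.ofReal⟩ _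

/-- The product rule for two complex-valued indefinite integrals. -/
theorem primitive_mul_primitive {γ δ : ℝ → ℂ} (hγ : LocallyIntegrable γ volume)
    (hδ : LocallyIntegrable δ volume) (c d : ℂ) (R : ℝ) :
    (c + ∫ ξ in (0 : ℝ)..R, γ ξ) * (d + ∫ ξ in (0 : ℝ)..R, δ ξ) = c * d +
      ∫ x in (0 : ℝ)..R, (γ x * (d + ∫ ξ in (0 : ℝ)..x, δ ξ) +
        (c + ∫ ξ in (0 : ℝ)..x, γ ξ) * δ x) := by
  have hcont : ∀ {γ : ℝ → ℂ}, LocallyIntegrable γ volume → ∀ c : ℂ,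
      Continuous fun x => c + ∫ ξ in (0 : ℝ)..x, γ ξ := fun h c =>
    continuous_const.add
      (intervalIntegral.continuous_primitive (intervalIntegrable_of_locallyIntegrable h) 0)
  have hint : LocallyIntegrable (fun x => γ x * (d + ∫ ξ in (0 : ℝ)..x, δ ξ) +
      (c + ∫ ξ in (0 : ℝ)..x, γ ξ) * δ x) volume := by
    refine LocallyIntegrable.add ?_ ?_
    · have := hγ.continuous_smul (hcont hδ d)
      simpa [mul_comm] using! this
    · exact hδ.continuous_smul (hcont hγ c)
  have hac := ((absolutelyContinuousOnInterval_primitive hγ c 0 R left_mem_uIcc).smul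
    (absolutelyContinuousOnInterval_primitive hδ d 0 R left_mem_uIcc)).sub
    (absolutelyContinuousOnInterval_primitive hint 0 0 R left_mem_uIcc)
  obtain ⟨C, hC⟩ := hac.const_of_ae_hasDerivAt_zero (by
    filter_upwards [LocallyIntegrable.ae_hasDerivAt_integral hγ,
      LocallyIntegrable.ae_hasDerivAt_integral hδ,
      LocallyIntegrable.ae_hasDerivAt_integral hint] with x h1 h2 h3 _
    have := (((h1 0).const_add c).mul ((h2 0).const_add d)).sub ((h3 0).const_add 0)
    simp only [sub_self] at this
    exact this)
  have e1 := hC R right_mem_uIcc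
  have e2 := hC 0 left_mem_uIcc
  simp only [Pi.sub_apply, smul_eq_mul, Pi.mul_apply, zero_add, intervalIntegral.integral_same,
    add_zero, sub_zero] at e1 e2
  rw [← e2] at e1
  linear_combination e1

theorem locallyIntegrable_hat (g : L2) : LocallyIntegrable (hat g) volume :=
  (memLp_hat g).locallyIntegrable (by norm_num)

/-- On `(0, ∞)`, `f̂` is an indefinite integral of `-i ĝ` with the value `c` at the origin. For
`(f, g)` in the graph of `G`, the number `c` is `I₊(f)`. -/
def HasTrace (f g : L2) (c : ℂ) : Prop :=
  ∀ᵐ ξ : ℝ, 0 < ξ → hat f ξ = c + ∫ η in (0 : ℝ)..ξ, -Complex.I * hat g η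

theorem exists_hasTrace {p : hardyPlus × hardyPlus} (hp : p ∈ hardyGGraph) :
    ∃ c, HasTrace p.1 p.2 c := by
  obtain ⟨φ, h1, h2⟩ := hp
  have hi : ∀ a b, IntervalIntegrable (fun η => -Complex.I * hat p.2 η) volume a b := fun a b =>
    (intervalIntegrable_of_locallyIntegrable (locallyIntegrable_hat _) a b).const_mul _
  refine ⟨φ 1 - ∫ η in (0 : ℝ)..1, -Complex.I * hat p.2 η, ?_⟩
  filter_upwards [h1] with ξ h hξ
  rw [← h hξ, ← intervalIntegral.integral_add_adjacent_intervals (hi 0 1) (hi 1 ξ),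
    ← h2 1 ξ one_pos hξ]
  ring

theorem setIntegral_Ioi_star_hat_mul (f g : hardyPlus) :
    ∫ ξ in Ioi (0 : ℝ), star (hat f ξ) * hat g ξ = (2 * Real.pi : ℂ) *
      inner ℂ (f : L2) (g : L2) := by
  rw [inner_eq_integral_hat]
  have h0 : ∀ᵐ ξ : ℝ, ξ ≠ 0 := by simp [ae_iff]
  refine setIntegral_eq_integral_of_ae_compl_eq_zero ?_
  filter_upwards [g.2, h0] with ξ h hne hξ
  rw [h (lt_of_le_of_ne (not_lt.1 hξ) hne), mul_zero]

/-- The boundary form of `G`: the failure of `G` to be symmetric is carried by the values of the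
Fourier transforms at `0⁺`. -/
theorem HasTrace.boundary_form {f g f' g' : hardyPlus} {c c' : ℂ} (h : HasTrace f g c)
    (h' : HasTrace f' g' c') :
    (2 * Real.pi * Complex.I) * (inner ℂ (f' : L2) (g : L2) - inner ℂ (g' : L2) (f : L2)) =
      star c' * c := by
  have hγ : LocallyIntegrable (fun η => -Complex.I * hat g η) volume :=
    ((memLp_hat _).const_mul _).locallyIntegrable (by norm_num)
  have hδ : LocallyIntegrable (fun η => star (-Complex.I * hat g' η)) volume :=
    (MemLp.star ((memLp_hat _).const_mul _)).locallyIntegrable (by norm_num)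
  set Φ : ℝ → ℂ := fun x => c + ∫ η in (0 : ℝ)..x, -Complex.I * hat g η with hΦ
  set Ψ : ℝ → ℂ := fun x => star c' + ∫ η in (0 : ℝ)..x, star (-Complex.I * hat g' η) with hΨ
  have hΨ' : ∀ᵐ ξ : ℝ, 0 < ξ → Ψ ξ = star (hat f' ξ) := by
    filter_upwards [h'] with ξ a hξ
    rw [a hξ, star_add, hΨ]
    simp only
    congr 1
    rw [intervalIntegral, intervalIntegral, star_sub]
    change _ = (starRingEnd ℂ) _ - (starRingEnd ℂ) _
    rw [← integral_conj, ← integral_conj]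
    rfl
  have hΦ' : ∀ᵐ ξ : ℝ, 0 < ξ → Φ ξ = hat f ξ := by
    filter_upwards [h] with ξ a hξ
    rw [a hξ]
  -- `k` is the derivative of the product `Φ Ψ` on the half-line.
  set k : ℝ → ℂ := fun ξ => -Complex.I * (star (hat f' ξ) * hat g ξ) +
    Complex.I * (star (hat g' ξ) * hat f ξ) with hk
  have hki : Integrable k :=
    ((integrable_star_hat_mul f' g).const_mul _).add ((integrable_star_hat_mul g' f).const_mul _)
  have hprod : ∀ R : ℝ, 0 < R → Φ R * Ψ R = c * star c' + ∫ x in (0 : ℝ)..R, k x := by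
    intro R hR
    rw [hΦ, hΨ]
    simp only
    rw [primitive_mul_primitive hγ hδ c (star c') R]
    congr 1
    refine intervalIntegral.integral_congr_ae ?_
    filter_upwards [hΨ', hΦ'] with ξ a b hξ
    have hξ' : 0 < ξ := by rw [uIoc_of_le hR.le] at hξ; exact hξ.1
    have a' := a hξ'
    have b' := b hξ'
    rw [hΨ] at a'
    rw [hΦ] at b'
    simp only at a' b'
    rw [a', b', hk]
    simp
    ring
  have hlim : Tendsto (fun R => Φ R * Ψ R) atTop (𝓝 (c * star c' + ∫ x in Ioi (0 : ℝ), k x)) := by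
    have := (intervalIntegral_tendsto_integral_Ioi 0 hki.integrableOn tendsto_id).const_add
      (c * star c')
    refine Tendsto.congr' ?_ this
    filter_upwards [eventually_gt_atTop 0] with R hR using (hprod R hR).symm
  have hint : IntegrableOn (fun R => Φ R * Ψ R) (Ioi 0) := by
    refine Integrable.congr ((integrable_star_hat_mul f' f).integrableOn (s := Ioi 0)) ?_
    refine (ae_restrict_iff' measurableSet_Ioi).2 ?_
    filter_upwards [hΨ', hΦ'] with ξ a b hξ
    rw [a hξ, b hξ, mul_comm]
  -- `Φ Ψ` is integrable on the half-line, so its limit at infinity is zero.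
  have hzero : c * star c' + ∫ x in Ioi (0 : ℝ), k x = 0 := by
    refine IntegrableAtFilter.eq_zero_of_tendsto (μ := volume)
      ⟨_, Ioi_mem_atTop 0, hint⟩ (fun s hs => ?_) hlim
    obtain ⟨a, ha⟩ := mem_atTop_sets.1 hs
    refine top_le_iff.1 ?_
    rw [← Real.volume_Ici (a := a)]
    exact measure_mono ha
  have hsplit : ∫ x in Ioi (0 : ℝ), k x = -Complex.I * (2 * Real.pi * inner ℂ (f' : L2) (g : L2)) +
      Complex.I * (2 * Real.pi * inner ℂ (g' : L2) (f : L2)) := by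
    rw [hk, integral_add ((integrable_star_hat_mul f' g).const_mul _).integrableOn
      ((integrable_star_hat_mul g' f).const_mul _).integrableOn, integral_const_mul,
      integral_const_mul, setIntegral_Ioi_star_hat_mul, setIntegral_Ioi_star_hat_mul]
  rw [hsplit] at hzero
  linear_combination -hzero

/-! ### Poles in the Hardy space -/

theorem pole_mem_hardyPlus {z : ℂ} (hz : z.im < 0) : pole z ∈ hardyPlus :=
  hat_pole_eq_zero_of_neg hz

theorem inner_pole_of_im_pos {z : ℂ} (hz : 0 < z.im) (f : hardyPlus) :
    inner ℂ (f : L2) (pole z) = 0 := by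
  have h := inner_eq_integral_hat (f : L2) (pole z)
  have h0 : ∀ᵐ ξ : ℝ, ξ ≠ 0 := by simp [ae_iff]
  have h1 : ∫ ξ : ℝ, star (hat f ξ) * hat (pole z) ξ = 0 := by
    refine integral_eq_zero_of_ae ?_
    filter_upwards [f.2, hat_pole_eq_zero_of_pos hz, h0] with ξ a b c
    rcases lt_or_gt_of_ne c with d | d
    · simp [a d]
    · simp [b d]
  rw [h1] at h
  have h3 : (2 * Real.pi : ℂ) ≠ 0 := by simp
  exact (mul_eq_zero.1 h).resolve_left h3

/-- `Π₊` of the function `y ↦ 1 / (y - z)`: this function itself for `Im z < 0`, and zero for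
`Im z > 0`. -/
noncomputable def polePlus (z : ℂ) : hardyPlus := piPlus (pole z)

theorem polePlus_coe {z : ℂ} (hz : z.im < 0) : (polePlus z : L2) = pole z := by
  have := hardyPlus.orthogonalProjectionOnto_mem_subspace_eq_self ⟨pole z, pole_mem_hardyPlus hz⟩
  exact congrArg Subtype.val this

theorem polePlus_of_im_pos {z : ℂ} (hz : 0 < z.im) : polePlus z = 0 := by
  unfold polePlus piPlus
  rw [Submodule.orthogonalProjectionOnto_eq_zero_iff, Submodule.mem_orthogonal]
  intro u hu
  exact inner_pole_of_im_pos hz ⟨u, hu⟩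

theorem inner_piPlus_right (w : hardyPlus) (v : L2) :
    inner ℂ (w : L2) (piPlus v : L2) = inner ℂ (w : L2) v :=
  Submodule.inner_orthogonalProjectionOnto_eq_of_mem_left w v

theorem inner_piPlus_left (v : L2) (w : hardyPlus) :
    inner ℂ (piPlus v : L2) (w : L2) = inner ℂ v (w : L2) :=
  Submodule.inner_orthogonalProjectionOnto_eq_of_mem_right w v

theorem halfExp_of_pos (a : ℂ) {ξ : ℝ} (hξ : 0 < ξ) : halfExp a 0 ξ = Complex.exp (a * ξ) := by
  simp [halfExp, hξ]

theorem polePlus_mem_graph {z : ℂ} (hz : z.im < 0) :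
    (polePlus z, z • polePlus z) ∈ hardyGGraph := by
  refine ⟨fun ξ => -(2 * Real.pi * Complex.I) * Complex.exp (-Complex.I * z * ξ), ?_, ?_⟩
  · simp only [polePlus_coe hz]
    filter_upwards [hat_pole_of_im_neg hz] with ξ h hξ
    rw [h, halfExp_of_pos _ hξ]
  · intro a b ha hb
    simp only [Submodule.coe_smul, polePlus_coe hz]
    have hd : ∀ ξ ∈ uIcc a b, HasDerivAt
        (fun ξ : ℝ => -(2 * Real.pi * Complex.I) * Complex.exp (-Complex.I * z * ξ))
        (-Complex.I * (z * (-(2 * Real.pi * Complex.I) * Complex.exp (-Complex.I * z * ξ)))) ξ := by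
      intro ξ _
      have h1 : HasDerivAt (fun ξ : ℝ => (ξ : ℂ)) 1 ξ := Complex.ofRealCLM.hasDerivAt
      convert! ((h1.const_mul (-Complex.I * z)).cexp).const_mul (-(2 * Real.pi * Complex.I)) using 1
      ring
    rw [← intervalIntegral.integral_eq_sub_of_hasDerivAt hd
      (Continuous.intervalIntegrable (by fun_prop) _ _)]
    refine intervalIntegral.integral_congr_ae ?_
    filter_upwards [hat_pole_of_im_neg hz, hat_smul z (pole z)] with ξ h h2 hξ
    have hξ' : 0 < ξ := lt_of_lt_of_le (lt_min ha hb) hξ.1.le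
    rw [h2, h, halfExp_of_pos _ hξ']

theorem hasIPlus_polePlus {z : ℂ} (hz : z.im < 0) :
    HasIPlus (polePlus z) (-(2 * Real.pi * Complex.I)) := by
  unfold HasIPlus
  rw [polePlus_coe hz]
  have hc : Continuous fun ξ : ℝ =>
      -(2 * Real.pi * Complex.I) * Complex.exp (-Complex.I * z * ξ) := by fun_prop
  have ht := hc.tendsto 0
  simp only [Complex.ofReal_zero, mul_zero, Complex.exp_zero, mul_one] at ht
  refine Tendsto.congr' ?_ (ht.mono_left (inf_le_left.trans nhdsWithin_le_nhds))
  have h1 : ∀ᶠ ξ : ℝ in 𝓝[>] (0 : ℝ) ⊓ ae volume, 0 < ξ :=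
    Eventually.filter_mono inf_le_left self_mem_nhdsWithin
  have h2 := Eventually.filter_mono (inf_le_right : 𝓝[>] (0 : ℝ) ⊓ ae volume ≤ _)
    (hat_pole_of_im_neg hz)
  filter_upwards [h1, h2] with ξ a b
  rw [b, halfExp_of_pos _ a]

theorem HasIPlus.add {f g : hardyPlus} {c d : ℂ} (hf : HasIPlus f c) (hg : HasIPlus g d) :
    HasIPlus (f + g) (c + d) := by
  refine Tendsto.congr' ?_ (Tendsto.add hf hg)
  exact Eventually.filter_mono inf_le_right ((hat_add (f : L2) g).mono fun ξ h => h.symm)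

theorem HasIPlus.smul {f : hardyPlus} {c : ℂ} (a : ℂ) (hf : HasIPlus f c) :
    HasIPlus (a • f) (a * c) := by
  refine Tendsto.congr' ?_ (Tendsto.const_mul a hf)
  exact Eventually.filter_mono inf_le_right ((hat_smul a (f : L2)).mono fun ξ h => h.symm)

theorem hasIPlus_zero : HasIPlus 0 0 := by
  refine Tendsto.congr' ?_ tendsto_const_nhds
  exact Eventually.filter_mono inf_le_right (hat_zero.mono fun ξ h => h.symm)

theorem HasIPlus.sum {ι : Type*} (s : Finset ι) {f : ι → hardyPlus} {c : ι → ℂ}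
    (h : ∀ i ∈ s, HasIPlus (f i) (c i)) : HasIPlus (∑ i ∈ s, f i) (∑ i ∈ s, c i) := by
  classical
  induction s using Finset.induction_on with
  | empty => simpa using hasIPlus_zero
  | insert a s ha ih =>
    rw [Finset.sum_insert ha, Finset.sum_insert ha]
    exact (h a (Finset.mem_insert_self a s)).add
      (ih fun i hi => h i (Finset.mem_insert_of_mem hi))

/-- An element of the Hardy space orthogonal to the poles along a horizontal line of the lower
half-plane vanishes: up to constants, its pairings with them form the Fourier transform of
`exp (-η ξ) f̂(ξ)`. -/
theorem eq_zero_of_inner_pole {f : hardyPlus} {η : ℝ} (hη : 0 < η)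
    (h : ∀ s : ℝ, inner ℂ (pole (s - η * Complex.I)) (f : L2) = 0) : f = 0 := by
  set b : ℂ := -η with hb
  have hbre : b.re < 0 := by simp [hb, hη]
  set e : ℝ → ℂ := fun ξ => halfExp b 0 ξ * hat f ξ with he
  have hbound : ∀ ξ, ‖halfExp b 0 ξ‖ ≤ 1 := by
    intro ξ
    by_cases hξ : ξ ∈ Ioi (0 : ℝ)
    · rw [halfExp_of_pos _ hξ, Complex.norm_exp, Real.exp_le_one_iff]
      simpa [hb] using mul_nonneg hη.le (le_of_lt hξ)
    · simp [halfExp, indicator_of_notMem hξ]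
  have hhalf := memLp_halfExp hbre 0 (Or.inr rfl : (2 : ℝ≥0∞) = 1 ∨ (2 : ℝ≥0∞) = 2)
  have he1 : Integrable e := hhalf.integrable_mul (memLp_hat f)
  have he2 : MemLp e 2 := (memLp_hat f).of_le_mul (c := 1) (hhalf.1.mul (memLp_hat f).1)
    (ae_of_all _ fun ξ => by
      rw [he, norm_mul]
      exact mul_le_mul_of_nonneg_right (hbound ξ) (norm_nonneg _))
  obtain ⟨g, hg⟩ := exists_hat_ae_eq he2
  have hpi : (Real.pi : ℂ) ≠ 0 := by exact_mod_cast Real.pi_ne_zero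
  have hg0 : g = 0 := by
    apply Lp.ext
    filter_upwards [ae_eq_integral_of_hat_ae he1 hg, Lp.coeFn_zero ℂ 2 (volume : Measure ℝ)]
      with s hs h0
    rw [hs, h0]
    have hz : ((s : ℂ) - η * Complex.I).im < 0 := by simp [hη]
    have h1 := inner_eq_integral_hat (pole (s - η * Complex.I)) (f : L2)
    rw [h s, mul_zero] at h1
    have h2 : ∫ ξ : ℝ, star (hat (pole (s - η * Complex.I)) ξ) * hat f ξ =
        (2 * Real.pi * Complex.I) * ∫ ξ : ℝ, Complex.exp (Complex.I * s * ξ) * e ξ := by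
      rw [← integral_const_mul]
      refine integral_congr_ae ?_
      filter_upwards [hat_pole_of_im_neg hz] with ξ hξ
      rw [hξ, he]
      simp only
      by_cases hp : ξ ∈ Ioi (0 : ℝ)
      · have : star (Complex.exp (-Complex.I * (s - η * Complex.I) * ξ)) =
            Complex.exp (Complex.I * s * ξ) * Complex.exp (b * ξ) := by
          change (starRingEnd ℂ) _ = _
          rw [← Complex.exp_conj, ← Complex.exp_add]
          congr 1
          simp [hb]
          linear_combination ((η : ℂ) * ξ) * Complex.I_sq
        rw [halfExp_of_pos _ hp, halfExp_of_pos _ hp, star_mul', this]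
        simp
        ring
      · simp [halfExp, indicator_of_notMem hp]
    rw [h2] at h1
    have h3 : (2 * Real.pi * Complex.I : ℂ) ≠ 0 := by simp [hpi]
    rw [(mul_eq_zero.1 h1.symm).resolve_left h3]
    simp
  have hf0 : ∀ᵐ ξ, hat f ξ = hat 0 ξ := by
    have h0 : ∀ᵐ ξ : ℝ, ξ ≠ 0 := by simp [ae_iff]
    rw [hg0] at hg
    filter_upwards [hg, hat_zero, f.2, h0] with ξ a c d n
    rw [c] at a ⊢
    rcases lt_or_gt_of_ne n with k | k
    · exact d k
    · rw [he] at a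
      simp only at a
      rw [halfExp_of_pos _ k] at a
      exact (mul_eq_zero.1 a.symm).resolve_left (Complex.exp_ne_zero _)
  exact Subtype.ext (hat_injective hf0)

/-! ### Toeplitz operators with rational symbols -/

/-- The rational function with residues `A_j`, `A_j^*` and poles `x_j`, `conj x_j`, at a complex
argument. At a pole the corresponding term is dropped, because `0⁻¹ = 0`. -/
noncomputable def ratC {N : ℕ} (A : Fin N → Mat2) (x : Fin N → ℂ) (z : ℂ) : Mat2 :=
  ∑ j, (z - x j)⁻¹ • A j + ∑ j, (z - star (x j))⁻¹ • (A j)ᴴ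

theorem ratV_eq_ratC {N : ℕ} (A : Fin N → Mat2) (x : Fin N → ℂ) (y : ℝ) :
    ratV A x y = ratC A x y := rfl

theorem ae_add {f g : L2} {φ ψ : ℝ → ℂ} (hf : ∀ᵐ y, f y = φ y) (hg : ∀ᵐ y, g y = ψ y) :
    ∀ᵐ y, (f + g) y = φ y + ψ y := by
  filter_upwards [hf, hg, Lp.coeFn_add f g] with y a b c
  rw [c, Pi.add_apply, a, b]

theorem ae_smul {f : L2} {φ : ℝ → ℂ} (c : ℂ) (hf : ∀ᵐ y, f y = φ y) :
    ∀ᵐ y, (c • f) y = c * φ y := by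
  filter_upwards [hf, Lp.coeFn_smul c f] with y a b
  rw [b, Pi.smul_apply, a, smul_eq_mul]

theorem ae_sum {ι : Type*} [Fintype ι] {f : ι → L2} {φ : ι → ℝ → ℂ}
    (hf : ∀ i, ∀ᵐ y, f i y = φ i y) : ∀ᵐ y, (∑ i, f i : L2) y = ∑ i, φ i y := by
  filter_upwards [eventually_all.2 hf, Lp.coeFn_finsetSum Finset.univ f] with y a b
  rw [b, Finset.sum_apply]
  exact Finset.sum_congr rfl fun i _ => a i

/-- The function `y ↦ 1 / (y - z)²` as an element of `L²(ℝ)`, for a non-real `z` (and `0` for a real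
`z`). -/
noncomputable def poleSq (z : ℂ) : L2 :=
  open Classical in if h : z.im ≠ 0 then (memLp_two_pole_sq h).toLp else 0

theorem poleSq_ae {z : ℂ} (hz : z.im ≠ 0) : ∀ᵐ y : ℝ, poleSq z y = (((y : ℂ) - z)⁻¹) ^ 2 := by
  rw [poleSq, dif_pos hz]
  exact (memLp_two_pole_sq hz).coeFn_toLp

/-- Partial fractions, with `0⁻¹ = 0` when the two poles agree. -/
theorem inv_sub_mul_inv_sub {z p : ℂ} (y : ℂ) (hz : y - z ≠ 0) (hp : y - p ≠ 0) :
    (y - p)⁻¹ * (y - z)⁻¹ =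
      (z - p)⁻¹ * (y - z)⁻¹ - (z - p)⁻¹ * (y - p)⁻¹ + if p = z then ((y - z)⁻¹) ^ 2 else 0 := by
  split_ifs with h
  · subst h; simp [sq]
  · have : z - p ≠ 0 := sub_ne_zero.2 (Ne.symm h)
    field_simp
    ring

theorem symbolM_ae {N : ℕ} (M₀ : Mat2) (A : Fin N → Mat2) (x : Fin N → ℂ)
    (hx : ∀ j, 0 < (x j).im) (a b : Fin 2) :
    ∀ᵐ y, (symbolM M₀ A x hx a b : LInf) y = (M₀ + ratV A x y) a b :=
  (memLp_top_ratV M₀ A x hx a b).coeFn_toLp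

/-- The partial fraction expansion of `U / (y - z)`. Its last sum is the double pole occurring when
`z` is one of the `conj x_j`. -/
theorem toeplitz_symbolM_polePlus {N : ℕ} (M₀ : Mat2) (A : Fin N → Mat2) (x : Fin N → ℂ)
    (hx : ∀ j, 0 < (x j).im) (a b : Fin 2) {z : ℂ} (hz : z.im < 0) :
    toeplitz (symbolM M₀ A x hx a b) (polePlus z) =
      (M₀ + ratC A x z) a b • polePlus z
        - ∑ j, ((z - star (x j))⁻¹ * (A j)ᴴ a b) • polePlus (star (x j))
        + ∑ j, (if star (x j) = z then (A j)ᴴ a b else 0) • piPlus (poleSq z) := by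
  have hx' : ∀ j, (star (x j)).im < 0 := fun j => by simpa using hx j
  have key : ((symbolM M₀ A x hx a b) • (polePlus z : L2) : L2) =
      (M₀ + ratC A x z) a b • pole z
        + (-1 : ℂ) • ∑ j, ((z - star (x j))⁻¹ * (A j)ᴴ a b) • pole (star (x j))
        + (-1 : ℂ) • ∑ j, ((z - x j)⁻¹ * A j a b) • pole (x j)
        + ∑ j, (if star (x j) = z then (A j)ᴴ a b else 0) • poleSq z := by
    apply Lp.ext
    have h1 := ae_smul ((M₀ + ratC A x z) a b) (pole_ae hz.ne)
    have h2 := ae_smul (-1) (ae_sum fun j =>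
      ae_smul ((z - star (x j))⁻¹ * (A j)ᴴ a b) (pole_ae (hx' j).ne))
    have h3 := ae_smul (-1) (ae_sum fun j => ae_smul ((z - x j)⁻¹ * A j a b) (pole_ae (hx j).ne'))
    have h4 := ae_sum fun j =>
      ae_smul (if star (x j) = z then (A j)ᴴ a b else 0) (poleSq_ae hz.ne)
    rw [polePlus_coe hz]
    filter_upwards [ae_add (ae_add (ae_add h1 h2) h3) h4, pole_ae hz.ne,
      Lp.coeFn_lpSMul (r := 2) (symbolM M₀ A x hx a b) (pole z), symbolM_ae M₀ A x hx a b]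
      with y k1 k2 k3 k4
    rw [k1, k3, Pi.smul_apply', k4, k2]
    have hyz := sub_ne_zero_of_im_ne hz.ne y
    have e1 : ∀ j, ((y : ℂ) - star (x j))⁻¹ * ((y : ℂ) - z)⁻¹ = _ := fun j =>
      inv_sub_mul_inv_sub (y : ℂ) hyz (sub_ne_zero_of_im_ne (hx' j).ne y)
    have e2 : ∀ j, ((y : ℂ) - x j)⁻¹ * ((y : ℂ) - z)⁻¹ =
        (z - x j)⁻¹ * (y - z)⁻¹ - (z - x j)⁻¹ * (y - x j)⁻¹ := fun j => by
      rw [inv_sub_mul_inv_sub (y : ℂ) hyz (sub_ne_zero_of_im_ne (hx j).ne' y), if_neg, add_zero]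
      rintro rfl
      exact absurd (hx j) (not_lt.2 hz.le)
    simp only [ratV, ratC, Matrix.add_apply, Matrix.sum_apply, Matrix.smul_apply, smul_eq_mul,
      add_mul, Finset.sum_mul, Finset.mul_sum]
    have e3 : ∀ j, ((y : ℂ) - x j)⁻¹ * A j a b * ((y : ℂ) - z)⁻¹ =
        (z - x j)⁻¹ * A j a b * (y - z)⁻¹ +
          -1 * ((z - x j)⁻¹ * A j a b * (y - x j)⁻¹) := fun j => by
      linear_combination A j a b * e2 j
    have e4 : ∀ j, ((y : ℂ) - star (x j))⁻¹ * (A j)ᴴ a b * ((y : ℂ) - z)⁻¹ =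
        (z - star (x j))⁻¹ * (A j)ᴴ a b * (y - z)⁻¹ +
          -1 * ((z - star (x j))⁻¹ * (A j)ᴴ a b * (y - star (x j))⁻¹) +
          (if star (x j) = z then (A j)ᴴ a b else 0) * ((y : ℂ) - z)⁻¹ ^ 2 := fun j => by
      have := e1 j
      split_ifs at this ⊢ <;> linear_combination (A j)ᴴ a b * this
    simp only [e3, e4, Finset.sum_add_distrib]
    ring
  have h0 : ∀ j, piPlus (pole (x j)) = 0 := fun j => polePlus_of_im_pos (hx j)
  unfold toeplitz
  rw [key]
  simp only [map_add, map_smul, map_sum, h0, smul_zero, Finset.sum_const_zero, add_zero]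
  change _ • polePlus z + (-1 : ℂ) • ∑ j, _ • polePlus _ + _ = _
  rw [neg_one_smul, ← sub_eq_add_neg]

/-! ### Matrix-valued functions -/

theorem toeplitz_add (g : LInf) (f₁ f₂ : hardyPlus) :
    toeplitz g (f₁ + f₂) = toeplitz g f₁ + toeplitz g f₂ := by
  unfold toeplitz
  rw [Submodule.coe_add, Lp.add_smul, map_add]

theorem toeplitz_smul (g : LInf) (c : ℂ) (f : hardyPlus) :
    toeplitz g (c • f) = c • toeplitz g f := by
  unfold toeplitz
  rw [Submodule.coe_smul, ← map_smul]
  congr 1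
  exact (Lp.smul_comm c g (f : L2)).symm

theorem inner_toeplitz (g g' : LInf) (hg : ∀ᵐ y, g' y = star (g y)) (w f : hardyPlus) :
    inner ℂ (w : L2) (toeplitz g f : L2) = inner ℂ (toeplitz g' w : L2) (f : L2) := by
  unfold toeplitz
  rw [inner_piPlus_right, inner_piPlus_left, L2.inner_def, L2.inner_def]
  refine integral_congr_ae ?_
  filter_upwards [hg, Lp.coeFn_lpSMul (r := 2) g (f : L2), Lp.coeFn_lpSMul (r := 2) g' (w : L2)]
    with y a b c
  rw [b, c, Pi.smul_apply', Pi.smul_apply', a]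
  simp
  ring

/-- The inner product of matrix-valued functions with entries in the Hardy space. -/
noncomputable def matInner (w f : Matrix (Fin 2) (Fin 2) hardyPlus) : ℂ :=
  ∑ a, ∑ b, inner ℂ (w a b : L2) (f a b : L2)

theorem matInner_add_left (w₁ w₂ f : Matrix (Fin 2) (Fin 2) hardyPlus) :
    matInner (w₁ + w₂) f = matInner w₁ f + matInner w₂ f := by
  simp only [matInner, Matrix.add_apply, Submodule.coe_add, inner_add_left, Finset.sum_add_distrib]

theorem matInner_smul_left (c : ℂ) (w f : Matrix (Fin 2) (Fin 2) hardyPlus) :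
    matInner (c • w) f = star c * matInner w f := by
  simp only [matInner, Matrix.smul_apply, Submodule.coe_smul, inner_smul_left, Finset.mul_sum]
  rfl

theorem matInner_add_right (w f₁ f₂ : Matrix (Fin 2) (Fin 2) hardyPlus) :
    matInner w (f₁ + f₂) = matInner w f₁ + matInner w f₂ := by
  simp only [matInner, Matrix.add_apply, Submodule.coe_add, inner_add_right, Finset.sum_add_distrib]

theorem matInner_smul_right (c : ℂ) (w f : Matrix (Fin 2) (Fin 2) hardyPlus) :
    matInner w (c • f) = c * matInner w f := by
  simp only [matInner, Matrix.smul_apply, Submodule.coe_smul, inner_smul_right, Finset.mul_sum]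

theorem matInner_sum_left {ι : Type*} (s : Finset ι) (w : ι → Matrix (Fin 2) (Fin 2) hardyPlus)
    (f : Matrix (Fin 2) (Fin 2) hardyPlus) :
    matInner (∑ i ∈ s, w i) f = ∑ i ∈ s, matInner (w i) f := by
  classical
  induction s using Finset.induction_on with
  | empty => simp [matInner]
  | insert a s ha ih => rw [Finset.sum_insert ha, Finset.sum_insert ha, matInner_add_left, ih]

theorem matInner_toeplitzMat {U : Matrix (Fin 2) (Fin 2) LInf}
    (hU : ∀ a b, ∀ᵐ y, U a b y = star (U b a y)) (w f : Matrix (Fin 2) (Fin 2) hardyPlus) :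
    matInner w (toeplitzMat U f) = matInner (toeplitzMat U w) f := by
  simp only [matInner, toeplitzMat, Matrix.of_apply]
  refine Finset.sum_congr rfl fun a _ => ?_
  have e1 : ∀ b, inner ℂ (w a b : L2) ((∑ k, toeplitz (U k b) (f a k) : hardyPlus) : L2) =
      ∑ k, inner ℂ (toeplitz (U b k) (w a b) : L2) (f a k : L2) := fun b => by
    rw [Submodule.coe_sum, inner_sum]
    exact Finset.sum_congr rfl fun k _ => inner_toeplitz _ _ (hU b k) _ _
  have e2 : ∀ b, inner ℂ ((∑ k, toeplitz (U k b) (w a k) : hardyPlus) : L2) (f a b : L2) =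
      ∑ k, inner ℂ (toeplitz (U k b) (w a k) : L2) (f a b : L2) := fun b => by
    rw [Submodule.coe_sum, sum_inner]
  simp only [e1, e2]
  exact Finset.sum_comm

/-- The matrix-valued function `y ↦ (y - z)⁻¹ R`, projected to the Hardy space. -/
noncomputable def matPole (z : ℂ) (R : Mat2) : Matrix (Fin 2) (Fin 2) hardyPlus :=
  R.map fun r => r • polePlus z

theorem matPole_add (z : ℂ) (R S : Mat2) : matPole z (R + S) = matPole z R + matPole z S := by
  ext1 a b; simp [matPole, add_smul]

theorem matPole_smul (z c : ℂ) (R : Mat2) : matPole z (c • R) = c • matPole z R := by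
  ext1 a b; simp [matPole, mul_smul]

theorem matPole_zero (z : ℂ) : matPole z 0 = 0 := by
  ext1 a b; simp [matPole]

/-- `matPole z` as a linear map in the residue. -/
noncomputable def matPoleLin (z : ℂ) : Mat2 →ₗ[ℂ] Matrix (Fin 2) (Fin 2) hardyPlus where
  toFun := matPole z
  map_add' := matPole_add z
  map_smul' := matPole_smul z

theorem matPole_sum {ι : Type*} (s : Finset ι) (z : ℂ) (R : ι → Mat2) :
    matPole z (∑ i ∈ s, R i) = ∑ i ∈ s, matPole z (R i) :=
  map_sum (matPoleLin z) R s

/-- The matrix Toeplitz operator as a linear map. -/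
noncomputable def toeplitzMatLin (U : Matrix (Fin 2) (Fin 2) LInf) :
    Matrix (Fin 2) (Fin 2) hardyPlus →ₗ[ℂ] Matrix (Fin 2) (Fin 2) hardyPlus where
  toFun := toeplitzMat U
  map_add' f g := by
    ext1 a b
    simp [toeplitzMat, toeplitz_add, Finset.sum_add_distrib, -Fin.sum_univ_two]
  map_smul' c f := by
    ext1 a b
    simp [toeplitzMat, toeplitz_smul, Finset.smul_sum, -Fin.sum_univ_two]

/-- The hypothesis on `R` excludes a double pole. -/
theorem toeplitzMat_matPole {N : ℕ} (M₀ : Mat2) (A : Fin N → Mat2) (x : Fin N → ℂ)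
    (hx : ∀ j, 0 < (x j).im) {z : ℂ} (hz : z.im < 0) {R : Mat2}
    (hR : ∀ j, star (x j) = z → R * (A j)ᴴ = 0) :
    toeplitzMat (symbolM M₀ A x hx) (matPole z R) =
      matPole z (R * (M₀ + ratC A x z))
        - ∑ j, (z - star (x j))⁻¹ • matPole (star (x j)) (R * (A j)ᴴ) := by
  ext1 a b
  have e : ∀ k, toeplitz (symbolM M₀ A x hx k b) (R a k • polePlus z) =
      (R a k * (M₀ + ratC A x z) k b) • polePlus z
        - ∑ j, ((z - star (x j))⁻¹ * (R a k * (A j)ᴴ k b)) • polePlus (star (x j))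
        + ∑ j, (if star (x j) = z then R a k * (A j)ᴴ k b else 0) • piPlus (poleSq z) := by
    intro k
    rw [toeplitz_smul, toeplitz_symbolM_polePlus M₀ A x hx k b hz, smul_add, smul_sub,
      Finset.smul_sum, Finset.smul_sum, smul_smul]
    congr 1
    · congr 1
      refine Finset.sum_congr rfl fun j _ => ?_
      rw [smul_smul]; congr 1; ring
    · refine Finset.sum_congr rfl fun j _ => ?_
      rw [smul_smul]; congr 1; rw [mul_ite, mul_zero]
  have hdbl : ∑ k, ∑ j, (if star (x j) = z then R a k * (A j)ᴴ k b else 0) •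
      piPlus (poleSq z) = 0 := by
    rw [Finset.sum_comm]
    refine Finset.sum_eq_zero fun j _ => ?_
    rw [← Finset.sum_smul]
    split_ifs with h
    · have : ∑ k, R a k * (A j)ᴴ k b = 0 := congrFun (congrFun (hR j h) a) b
      rw [this, zero_smul]
    · simp
  simp only [toeplitzMat, matPole, Matrix.of_apply, Matrix.map_apply, Matrix.sub_apply,
    Matrix.sum_apply, Matrix.smul_apply, e, Finset.sum_add_distrib, hdbl, add_zero,
    Finset.sum_sub_distrib]
  congr 1
  · rw [← Finset.sum_smul]; rfl
  · rw [Finset.sum_comm]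
    refine Finset.sum_congr rfl fun j _ => ?_
    rw [← Finset.sum_smul, ← Finset.mul_sum, smul_smul]
    rfl

theorem exists_hardyG_eq {f g : hardyPlus} (h : (f, g) ∈ hardyGGraph) :
    ∃ d : hardyG.domain, (d : hardyPlus) = f ∧ hardyG d = g := by
  rw [← hardyG_graph, LinearPMap.mem_graph_iff] at h
  exact h

theorem hardyG_mem_graph (d : hardyG.domain) : ((d : hardyPlus), hardyG d) ∈ hardyGGraph := by
  rw [← hardyG_graph]
  exact hardyG.mem_graph d

theorem gerardOp_eq (U : Matrix (Fin 2) (Fin 2) LInf) (t y : ℝ)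
    (f : Matrix (Fin 2) (Fin 2) hardyG.domain) :
    gerardOp U t y f = f.map (fun h => hardyG h)
      + (-(t : ℂ)) • toeplitzMat U (f.map fun h => (h : hardyPlus))
      + (-(y : ℂ)) • f.map fun h => (h : hardyPlus) := by
  rw [gerardOp, sub_eq_add_neg, sub_eq_add_neg, neg_smul, neg_smul]

theorem gerardOp_sub (U : Matrix (Fin 2) (Fin 2) LInf) (t y : ℝ)
    (f g : Matrix (Fin 2) (Fin 2) hardyG.domain) :
    gerardOp U t y (f - g) = gerardOp U t y f - gerardOp U t y g := by
  have h1 : (f - g).map (fun h => hardyG h) =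
      f.map (fun h => hardyG h) - g.map fun h => hardyG h := by
    ext1 a b
    simp only [Matrix.map_apply, Matrix.sub_apply, LinearPMap.map_sub]
  have h2 : (f - g).map (fun h => (h : hardyPlus)) =
      f.map (fun h => (h : hardyPlus)) - g.map fun h => (h : hardyPlus) := by
    ext1 a b
    simp only [Matrix.map_apply, Matrix.sub_apply, Submodule.coe_sub]
  have h3 := map_sub (toeplitzMatLin U) (f.map fun h => (h : hardyPlus))
    (g.map fun h => (h : hardyPlus))
  change toeplitzMat U _ = toeplitzMat U _ - toeplitzMat U _ at h3
  rw [gerardOp, h1, h2, h3, gerardOp, gerardOp, smul_sub, smul_sub]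
  abel

theorem exists_domain_matPole {ι : Type*} [Fintype ι] (z : ι → ℂ) (hz : ∀ i, (z i).im < 0)
    (R : ι → Mat2) :
    ∃ d : Matrix (Fin 2) (Fin 2) hardyG.domain,
      d.map (fun h => (h : hardyPlus)) = ∑ i, matPole (z i) (R i) ∧
      d.map (fun h => hardyG h) = ∑ i, matPole (z i) (z i • R i) := by
  have h : ∀ a b, ∃ d : hardyG.domain, (d : hardyPlus) = ∑ i, R i a b • polePlus (z i) ∧
      hardyG d = ∑ i, (z i * R i a b) • polePlus (z i) := fun a b => by
    apply exists_hardyG_eq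
    have := hardyGGraph.sum_mem (t := Finset.univ) fun i _ =>
      hardyGGraph.smul_mem (R i a b) (polePlus_mem_graph (hz i))
    convert! this using 1
    ext1
    · simp [Prod.fst_sum]
    · simp only [Prod.snd_sum, Prod.smul_snd, smul_smul]
      exact Finset.sum_congr rfl fun i _ => by rw [mul_comm]
  choose d h1 h2 using h
  refine ⟨Matrix.of d, ?_, ?_⟩ <;> ext1 a b
  · simp [h1, matPole, Matrix.sum_apply]
  · simp [h2, matPole, Matrix.sum_apply]

/-- The failure of `G - t T_U - y` to be symmetric is the boundary form of `G`, because `T_U` is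
symmetric for a Hermitian symbol. -/
theorem matInner_gerardOp {U : Matrix (Fin 2) (Fin 2) LInf}
    (hU : ∀ a b, ∀ᵐ y, U a b y = star (U b a y)) (t y : ℝ)
    {w f : Matrix (Fin 2) (Fin 2) hardyG.domain} {c d : Mat2}
    (hc : ∀ a b, HasTrace ((f a b : hardyPlus) : L2) (hardyG (f a b) : L2) (c a b))
    (hd : ∀ a b, HasTrace ((w a b : hardyPlus) : L2) (hardyG (w a b) : L2) (d a b)) :
    (2 * Real.pi * Complex.I) * (matInner (w.map fun h => (h : hardyPlus)) (gerardOp U t y f)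
      - matInner (gerardOp U t y w) (f.map fun h => (h : hardyPlus))) =
      ∑ a, ∑ b, star (d a b) * c a b := by
  rw [gerardOp_eq, gerardOp_eq, matInner_add_left, matInner_add_left, matInner_smul_left,
    matInner_smul_left, matInner_add_right, matInner_add_right, matInner_smul_right,
    matInner_smul_right, matInner_toeplitzMat hU]
  have e : ∑ a, ∑ b, star (d a b) * c a b = (2 * Real.pi * Complex.I) *
      (matInner (w.map fun h => (h : hardyPlus)) (f.map fun h => hardyG h) -
        matInner (w.map fun h => hardyG h) (f.map fun h => (h : hardyPlus))) := by
    simp only [matInner, ← Finset.sum_sub_distrib, Finset.mul_sum, Matrix.map_apply]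
    exact Finset.sum_congr rfl fun a _ => Finset.sum_congr rfl fun b _ =>
      ((hc a b).boundary_form (hd a b)).symm
  rw [e]
  simp

/-! ### Injectivity -/

theorem symbolM_hermitian {N : ℕ} {M₀ : Mat2} {A : Fin N → Mat2} {x : Fin N → ℂ}
    (hx : ∀ j, 0 < (x j).im) (hM : ∀ y : ℝ, (M₀ + ratV A x y)ᴴ = M₀ + ratV A x y) (a b : Fin 2) :
    ∀ᵐ y, symbolM M₀ A x hx a b y = star (symbolM M₀ A x hx b a y) := by
  filter_upwards [symbolM_ae M₀ A x hx a b, symbolM_ae M₀ A x hx b a] with y h1 h2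
  rw [h1, h2]
  conv_lhs => rw [← hM y]
  rw [Matrix.conjTranspose_apply]

/-- Injectivity of `G - t T_U - y`, once every residue occurring in the Hardy projection of the
symbol is known to be in the range. An element of the kernel has vanishing trace by the boundary
form, so it is orthogonal to the range; it is then orthogonal to the poles in the lower half-plane,
because `((z - y) - t U(z)) ((z - y) + t U(z)) = (z - y)² - t²`
does not vanish for a non-real `z`. -/
theorem gerardOp_injective {N : ℕ} {M₀ : Mat2} {A : Fin N → Mat2} {x : Fin N → ℂ}
    (hx : ∀ j, 0 < (x j).im) (hM : ∀ y : ℝ, (M₀ + ratV A x y)ᴴ = M₀ + ratV A x y)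
    (hsq : ∀ z : ℂ, (∀ j, z ≠ x j) → (∀ j, z ≠ star (x j)) →
      (M₀ + ratC A x z) * (M₀ + ratC A x z) = 1) (t y : ℝ)
    (hW : ∀ (R : Mat2) (j : Fin N), ∃ w : Matrix (Fin 2) (Fin 2) hardyG.domain,
      gerardOp (symbolM M₀ A x hx) t y w = matPole (star (x j)) (R * (A j)ᴴ)) :
    Function.Injective (gerardOp (symbolM M₀ A x hx) t y) := by
  set U := symbolM M₀ A x hx with hUdef
  have hU := symbolM_hermitian hx hM
  suffices h0 : ∀ f, gerardOp U t y f = 0 → f = 0 by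
    intro f g hfg
    refine sub_eq_zero.1 (h0 _ ?_)
    rw [gerardOp_sub, hfg, sub_self]
  intro f hf
  have htr : ∀ w : Matrix (Fin 2) (Fin 2) hardyG.domain, ∃ d : Mat2, ∀ a b,
      HasTrace ((w a b : hardyPlus) : L2) (hardyG (w a b) : L2) (d a b) := fun w => by
    have : ∀ a b, ∃ d, HasTrace ((w a b : hardyPlus) : L2) (hardyG (w a b) : L2) d := fun a b =>
      exists_hasTrace (hardyG_mem_graph (w a b))
    choose d hd using this
    exact ⟨d, hd⟩
  set F := f.map fun h => (h : hardyPlus) with hF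
  obtain ⟨c, hc⟩ := htr f
  have hzeroR : ∀ w, matInner w (0 : Matrix (Fin 2) (Fin 2) hardyPlus) = 0 := fun w => by
    simp [matInner]
  have hzeroL : ∀ w, matInner (0 : Matrix (Fin 2) (Fin 2) hardyPlus) w = 0 := fun w => by
    simp [matInner]
  -- The pairing of `f` with itself: the traces of an element of the kernel vanish.
  have hc0 : ∀ a b, c a b = 0 := by
    have h1 := matInner_gerardOp hU t y hc hc
    rw [hf, hzeroR, hzeroL, sub_self, mul_zero] at h1
    have h2 : ∀ z : ℂ, star z * z = ((‖z‖ ^ 2 : ℝ) : ℂ) := fun z => by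
      rw [Complex.star_def, Complex.conj_mul']; push_cast; ring
    simp only [h2] at h1
    have h3 : ∑ a, ∑ b, ‖c a b‖ ^ 2 = 0 := by
      have := h1.symm
      exact_mod_cast this
    intro a b
    have h4 := (Finset.sum_eq_zero_iff_of_nonneg fun a _ =>
      Finset.sum_nonneg fun b _ => sq_nonneg _).1 h3 a (Finset.mem_univ a)
    have h5 := (Finset.sum_eq_zero_iff_of_nonneg fun b _ => sq_nonneg _).1 h4 b (Finset.mem_univ b)
    simpa using h5
  have horth : ∀ w, matInner (gerardOp U t y w) F = 0 := by
    intro w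
    obtain ⟨d, hd⟩ := htr w
    have h1 := matInner_gerardOp hU t y hc hd
    simp only [hc0, mul_zero, Finset.sum_const_zero] at h1
    have h3 : (2 * Real.pi * Complex.I : ℂ) ≠ 0 := by simp
    have h4 := (mul_eq_zero.1 h1).resolve_left h3
    rw [hf, hzeroR, zero_sub, neg_eq_zero] at h4
    exact h4
  have horthW : ∀ (R : Mat2) (j : Fin N), matInner (matPole (star (x j)) (R * (A j)ᴴ)) F = 0 := by
    intro R j
    obtain ⟨w, hw⟩ := hW R j
    rw [← hw]; exact horth w
  have hgen : ∀ z : ℂ, z.im < 0 → (∀ j, z ≠ star (x j)) → ∀ R : Mat2,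
      matInner (matPole z R) F = 0 := by
    intro z hz hzx R
    obtain ⟨w, hw1, hw2⟩ := exists_domain_matPole (fun _ : Unit => z) (fun _ => hz)
      (fun _ => R * (((z - y) : ℂ) • (1 : Mat2) + (t : ℂ) • (M₀ + ratC A x z)))
    simp only [Finset.univ_unique, Finset.sum_singleton] at hw1 hw2
    have h1 := horth w
    have hsq' := hsq z (fun j h => by
      have := hx j
      rw [← h] at this
      exact absurd this (not_lt.2 hz.le)) hzx
    rw [gerardOp_eq, hw1, hw2, toeplitzMat_matPole M₀ A x hx hz
      (fun j hj => absurd hj.symm (hzx j)), smul_sub,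
      sub_eq_add_neg ((-(t : ℂ)) • matPole z _), matInner_add_left,
      matInner_add_left, matInner_add_left] at h1
    have h2 : matInner (-((-(t : ℂ)) • ∑ j, (z - star (x j))⁻¹ • matPole (star (x j))
        (R * (((z - y) : ℂ) • (1 : Mat2) + (t : ℂ) • (M₀ + ratC A x z)) * (A j)ᴴ))) F = 0 := by
      rw [← neg_smul, matInner_smul_left, matInner_sum_left, Finset.sum_eq_zero, mul_zero]
      intro j _
      rw [matInner_smul_left, horthW, mul_zero]
    rw [h2, add_zero, ← matInner_add_left, ← matInner_add_left, ← matPole_smul, ← matPole_smul,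
      ← matPole_add, ← matPole_add] at h1
    have h3 : z • (R * (((z - y) : ℂ) • (1 : Mat2) + (t : ℂ) • (M₀ + ratC A x z))) +
        (-(t : ℂ)) • (R * (((z - y) : ℂ) • (1 : Mat2) + (t : ℂ) • (M₀ + ratC A x z)) *
          (M₀ + ratC A x z)) +
        (-(y : ℂ)) • (R * (((z - y) : ℂ) • (1 : Mat2) + (t : ℂ) • (M₀ + ratC A x z))) =
        ((z - y) ^ 2 - (t : ℂ) ^ 2) • R := by
      have e : R * (((z - y) : ℂ) • (1 : Mat2) + (t : ℂ) • (M₀ + ratC A x z)) * (M₀ + ratC A x z) =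
          ((z - y) : ℂ) • (R * (M₀ + ratC A x z)) + (t : ℂ) • R := by
        rw [mul_assoc, add_mul, smul_mul_assoc, smul_mul_assoc, hsq', one_mul, mul_add,
          mul_smul_comm, mul_smul_comm, mul_one]
      rw [e, mul_add, mul_smul_comm, mul_smul_comm, mul_one]
      module
    rw [h3, matPole_smul, matInner_smul_left] at h1
    refine (mul_eq_zero.1 h1).resolve_left ?_
    rw [star_eq_zero, sq_sub_sq]
    have him : ∀ r : ℝ, z - r ≠ 0 := fun r h => by
      have := congrArg Complex.im h
      simp only [Complex.sub_im, Complex.ofReal_im, sub_zero, Complex.zero_im] at this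
      exact hz.ne this
    refine mul_ne_zero ?_ ?_
    · have := him (y - t); push_cast at this; convert this using 1; ring
    · have := him (y + t); push_cast at this; convert this using 1; ring
  -- Poles along a horizontal line below all the `conj x_j` suffice.
  obtain ⟨η, hη⟩ : ∃ η : ℝ, 0 < η ∧ ∀ j, (x j).im < η := by
    refine ⟨1 + ∑ j, (x j).im, ?_, fun j => ?_⟩
    · have := Finset.sum_nonneg fun j (_ : j ∈ Finset.univ) => (hx j).le
      linarith
    · have := Finset.single_le_sum (fun j _ => (hx j).le) (Finset.mem_univ j)
      linarith
  ext1 a b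
  apply Subtype.ext
  change (f a b : hardyPlus) = 0
  refine eq_zero_of_inner_pole hη.1 fun s => ?_
  have hz : ((s : ℂ) - η * Complex.I).im < 0 := by simp [hη.1]
  have h1 := hgen _ hz (fun j h => by
    have := congrArg Complex.im h
    simp at this
    exact absurd (hη.2 j) (by linarith)) (Matrix.single a b 1)
  rw [matInner, Finset.sum_eq_single a, Finset.sum_eq_single b] at h1
  · simpa [matPole, polePlus_coe hz, hF] using h1
  · intro b' _ hb'
    simp [matPole, hb'.symm]
  · simp
  · intro a' _ ha'
    refine Finset.sum_eq_zero fun b' _ => ?_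
    simp [matPole, ha'.symm]
  · simp

/-! ### The action on the span of the poles -/

/-- A factorization `A_j = u_j v_j` of the residues into columns and rows, together with the
eigenvalues `ℓ_j` of the regular part of the symbol at the poles. (This regular part is the value of
`M₀ + ratC A x` at the pole, since `ratC` drops the singular term.) -/
structure IsSpinFactorization {N : ℕ} (M₀ : Mat2) (A : Fin N → Mat2) (x : Fin N → ℂ)
    (u v : Fin N → Fin 2 → ℂ) (ℓ : Fin N → ℂ) : Prop where
  factor : ∀ j, A j = Matrix.vecMulVec (u j) (v j)
  isotropic : ∀ j, v j ⬝ᵥ u j = 0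
  eigen : ∀ j, (M₀ + ratC A x (x j)) *ᵥ u j = ℓ j • u j

/-- The Lax matrix, with diagonal `ℓ_j` and off-diagonal entries `(v_j · u_k) / (x_j - x_k)`.
(The second summand has no diagonal, because `0⁻¹ = 0`.) -/
noncomputable def laxMatrix {N : ℕ} (x : Fin N → ℂ) (u v : Fin N → Fin 2 → ℂ) (ℓ : Fin N → ℂ) :
    Matrix (Fin N) (Fin N) ℂ :=
  Matrix.diagonal ℓ + Matrix.of fun j k => (x j - x k)⁻¹ * (v j ⬝ᵥ u k)

/-- The matrix of `G - t T_U - y` on the span of the poles, up to complex conjugation. -/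
noncomputable def pencil {N : ℕ} (x : Fin N → ℂ) (u v : Fin N → Fin 2 → ℂ) (ℓ : Fin N → ℂ)
    (t y : ℂ) : Matrix (Fin N) (Fin N) ℂ :=
  Matrix.diagonal x - t • laxMatrix x u v ℓ - y • 1

theorem conjTranspose_ratC {N : ℕ} (A : Fin N → Mat2) (x : Fin N → ℂ) (z : ℂ) :
    (ratC A x z)ᴴ = ratC A x (star z) := by
  unfold ratC
  rw [Matrix.conjTranspose_add, Matrix.conjTranspose_sum, Matrix.conjTranspose_sum, add_comm]
  simp [Matrix.conjTranspose_smul]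

/-- `G - t T_U - y` acts on the functions `∑ j, κ_j u_j^* / (y - conj x_j)` through the
conjugate of the pencil. -/
theorem gerardOp_spin {N : ℕ} {M₀ : Mat2} {A : Fin N → Mat2} {x : Fin N → ℂ}
    (hx : ∀ j, 0 < (x j).im) (hinj : Function.Injective x) (hM₀ : M₀ᴴ = M₀)
    {u v : Fin N → Fin 2 → ℂ} {ℓ : Fin N → ℂ} (hs : IsSpinFactorization M₀ A x u v ℓ)
    (t y : ℝ) (κ : Matrix (Fin N) (Fin 2) ℂ) :
    ∃ d : Matrix (Fin 2) (Fin 2) hardyG.domain,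
      d.map (fun h => (h : hardyPlus)) =
        ∑ j, matPole (star (x j)) (Matrix.vecMulVec (κ j) (star (u j))) ∧
      gerardOp (symbolM M₀ A x hx) t y d = ∑ j, matPole (star (x j))
        (Matrix.vecMulVec (((pencil x u v ℓ t y).map star * κ) j) (star (u j))) := by
  have hx' : ∀ j, (star (x j)).im < 0 := fun j => by simpa using hx j
  obtain ⟨d, hd1, hd2⟩ := exists_domain_matPole (fun j => star (x j)) hx'
    fun j => Matrix.vecMulVec (κ j) (star (u j))
  refine ⟨d, hd1, ?_⟩
  have hRA : ∀ j k, Matrix.vecMulVec (κ j) (star (u j)) * (A k)ᴴ =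
      star (v k ⬝ᵥ u j) • Matrix.vecMulVec (κ j) (star (u k)) := fun j k => by
    rw [hs.factor k, Matrix.conjTranspose_vecMulVec, Matrix.vecMulVec_mul_vecMulVec,
      Matrix.star_dotProduct, dotProduct_comm, star_star,
      Matrix.vecMulVec_smul, dotProduct_comm (u j)]
  have hRB : ∀ j, Matrix.vecMulVec (κ j) (star (u j)) * (M₀ + ratC A x (star (x j))) =
      star (ℓ j) • Matrix.vecMulVec (κ j) (star (u j)) := fun j => by
    have h1 : M₀ + ratC A x (star (x j)) = (M₀ + ratC A x (x j))ᴴ := by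
      rw [Matrix.conjTranspose_add, hM₀, conjTranspose_ratC]
    rw [Matrix.vecMulVec_mul, h1, ← Matrix.star_mulVec, hs.eigen j, star_smul,
      Matrix.vecMulVec_smul]
  have hT : ∀ j, toeplitzMat (symbolM M₀ A x hx)
      (matPole (star (x j)) (Matrix.vecMulVec (κ j) (star (u j)))) =
      star (ℓ j) • matPole (star (x j)) (Matrix.vecMulVec (κ j) (star (u j))) -
        ∑ k, ((star (x j) - star (x k))⁻¹ * star (v k ⬝ᵥ u j)) •
          matPole (star (x k)) (Matrix.vecMulVec (κ j) (star (u k))) := fun j => by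
    rw [toeplitzMat_matPole M₀ A x hx (hx' j), hRB, matPole_smul]
    · congr 1
      refine Finset.sum_congr rfl fun k _ => ?_
      rw [hRA, matPole_smul, smul_smul]
    · intro k hk
      rw [hinj (star_injective hk), hRA, hs.isotropic, star_zero, zero_smul]
  have hTs : toeplitzMat (symbolM M₀ A x hx)
      (∑ j, matPole (star (x j)) (Matrix.vecMulVec (κ j) (star (u j)))) = _ :=
    (map_sum (toeplitzMatLin (symbolM M₀ A x hx)) _ Finset.univ).trans
      (Finset.sum_congr rfl fun j _ => hT j)
  rw [gerardOp_eq, hd1, hd2, hTs, Finset.sum_sub_distrib, Finset.sum_comm,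
    ← Finset.sum_sub_distrib, Finset.smul_sum, Finset.smul_sum, ← Finset.sum_add_distrib,
    ← Finset.sum_add_distrib]
  refine Finset.sum_congr rfl fun j _ => ?_
  simp only [← matPole_smul, ← matPole_sum]
  rw [sub_eq_add_neg, ← neg_one_smul ℂ (matPole _ (∑ _, _)), ← matPole_smul, ← matPole_add,
    ← matPole_smul, ← matPole_add, ← matPole_add]
  congr 1
  ext1 a b
  have e : ((pencil x u v ℓ t y).map star * κ) j a = star (x j) * κ j a
      - t * (star (ℓ j) * κ j a + ∑ k, star ((x j - x k)⁻¹ * (v j ⬝ᵥ u k)) * κ k a)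
      - y * κ j a := by
    have h1 : (pencil x u v ℓ t y).map star = Matrix.diagonal (fun j => star (x j))
        - (t : ℂ) • (Matrix.diagonal (fun j => star (ℓ j)) +
          Matrix.of fun j k => star ((x j - x k)⁻¹ * (v j ⬝ᵥ u k))) - (y : ℂ) • 1 := by
      ext j k
      by_cases h : j = k
      · subst h; simp [pencil, laxMatrix]
      · simp [pencil, laxMatrix, h]
    rw [h1, Matrix.sub_mul, Matrix.sub_mul, Matrix.smul_mul, Matrix.smul_mul, Matrix.add_mul,
      Matrix.one_mul]
    simp only [Matrix.sub_apply, Matrix.smul_apply, Matrix.add_apply, Matrix.diagonal_mul,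
      smul_eq_mul]
    rw [Matrix.mul_apply]
    rfl
  simp only [Matrix.vecMulVec_apply, e, Matrix.add_apply, Matrix.smul_apply, smul_eq_mul,
    Matrix.sum_apply]
  have e2 : ∑ k, (star (x k) - star (x j))⁻¹ * star (v j ⬝ᵥ u k) * (κ k a * star (u j) b) =
      -(∑ k, star ((x j - x k)⁻¹ * (v j ⬝ᵥ u k)) * κ k a) * star (u j) b := by
    rw [neg_mul, Finset.sum_mul, ← Finset.sum_neg_distrib]
    refine Finset.sum_congr rfl fun k _ => ?_
    rw [star_mul', star_inv₀, star_sub, ← neg_sub (star (x j)), inv_neg]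
    ring
  rw [e2]
  ring

/-- The resolvent of `G - t T_U` on the span of the poles. -/
theorem exists_gerardOp_eq {N : ℕ} {M₀ : Mat2} {A : Fin N → Mat2} {x : Fin N → ℂ}
    (hx : ∀ j, 0 < (x j).im) (hinj : Function.Injective x) (hM₀ : M₀ᴴ = M₀)
    {u v : Fin N → Fin 2 → ℂ} {ℓ : Fin N → ℂ} (hs : IsSpinFactorization M₀ A x u v ℓ)
    (t y : ℝ) (hdet : IsUnit (pencil x u v ℓ t y).det) (κ : Matrix (Fin N) (Fin 2) ℂ) :
    ∃ d : Matrix (Fin 2) (Fin 2) hardyG.domain,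
      d.map (fun h => (h : hardyPlus)) = ∑ j, matPole (star (x j))
        (Matrix.vecMulVec ((((pencil x u v ℓ t y)⁻¹).map star * κ) j) (star (u j))) ∧
      gerardOp (symbolM M₀ A x hx) t y d =
        ∑ j, matPole (star (x j)) (Matrix.vecMulVec (κ j) (star (u j))) := by
  obtain ⟨d, h1, h2⟩ := gerardOp_spin hx hinj hM₀ hs t y (((pencil x u v ℓ t y)⁻¹).map star * κ)
  refine ⟨d, h1, ?_⟩
  have h3 : (pencil x u v ℓ t y).map star * ((pencil x u v ℓ t y)⁻¹).map star = 1 := by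
    have := congrArg (fun Y : Matrix (Fin N) (Fin N) ℂ => Y.map (starRingEnd ℂ))
      (Matrix.mul_nonsing_inv (pencil x u v ℓ t y) hdet)
    simp only [Matrix.map_mul] at this
    rw [Matrix.map_one _ (map_zero _) (map_one _)] at this
    exact this
  rw [h2, ← Matrix.mul_assoc, h3, Matrix.one_mul]

theorem piPlusV_eq {N : ℕ} (A : Fin N → Mat2) (x : Fin N → ℂ) (hx : ∀ j, 0 < (x j).im) :
    piPlusV A x hx = ∑ j, matPole (star (x j)) ((A j)ᴴ) := by
  have hx' : ∀ j, (star (x j)).im < 0 := fun j => by simpa using hx j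
  ext1 a b
  have key : ((memLp_ratV A x hx a b).toLp : L2) =
      ∑ j, A j a b • pole (x j) + ∑ j, (A j)ᴴ a b • pole (star (x j)) := by
    apply Lp.ext
    filter_upwards [(memLp_ratV A x hx a b).coeFn_toLp,
      ae_add (ae_sum fun j => ae_smul (A j a b) (pole_ae (hx j).ne'))
        (ae_sum fun j => ae_smul ((A j)ᴴ a b) (pole_ae (hx' j).ne))] with y h1 h2
    rw [h1, h2]
    simp [ratV, Matrix.sum_apply, mul_comm]
  have h0 : ∀ j, piPlus (pole (x j)) = 0 := fun j => polePlus_of_im_pos (hx j)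
  simp only [piPlusV, Matrix.of_apply, key, map_add, map_sum, map_smul, h0, smul_zero,
    Finset.sum_const_zero, zero_add, Matrix.sum_apply]
  rfl

theorem piPlusV_ae {N : ℕ} (A : Fin N → Mat2) (x : Fin N → ℂ) (hx : ∀ j, 0 < (x j).im)
    (a b : Fin 2) : ∀ᵐ y : ℝ, (piPlusV A x hx a b : L2) y =
      (∑ j, ((y : ℂ) - star (x j))⁻¹ • (A j)ᴴ) a b := by
  have hx' : ∀ j, (star (x j)).im < 0 := fun j => by simpa using hx j
  have h : (piPlusV A x hx a b : L2) = ∑ j, (A j)ᴴ a b • pole (star (x j)) := by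
    simp only [piPlusV_eq, Matrix.sum_apply, matPole, Matrix.map_apply, Submodule.coe_sum,
      Submodule.coe_smul, polePlus_coe (hx' _)]
  rw [h]
  filter_upwards [ae_sum fun j => ae_smul ((A j)ᴴ a b) (pole_ae (hx' j).ne)] with y hy
  rw [hy]
  simp [Matrix.sum_apply, mul_comm]

/-! ### The operator `|∇|` on rational functions -/

theorem hat_sum {ι : Type*} (s : Finset ι) (f : ι → L2) :
    ∀ᵐ ξ, hat (∑ i ∈ s, f i) ξ = ∑ i ∈ s, hat (f i) ξ := by
  classical
  induction s using Finset.induction_on with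
  | empty => simpa using hat_zero
  | insert a s ha ih =>
    filter_upwards [ih, hat_add (f a) (∑ i ∈ s, f i)] with ξ h1 h2
    rw [Finset.sum_insert ha, Finset.sum_insert ha, h2, h1]

theorem hat_sum_smul {ι : Type*} [Fintype ι] (c : ι → ℂ) (f : ι → L2) :
    ∀ᵐ ξ, hat (∑ i, c i • f i) ξ = ∑ i, c i * hat (f i) ξ := by
  filter_upwards [hat_sum Finset.univ fun i => c i • f i,
    eventually_all.2 fun i => hat_smul (c i) (f i)] with ξ h1 h2
  rw [h1]
  exact Finset.sum_congr rfl fun i _ => h2 i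

/-- The value of `|∇|` on the rational function with residues `A_j`, `A_j^*`: the multiplier `|ξ|`
is `i d/dy` on the part with poles in the upper half-plane and `-i d/dy` on the other part. -/
noncomputable def nablaC {N : ℕ} (A : Fin N → Mat2) (x : Fin N → ℂ) (z : ℂ) : Mat2 :=
  ∑ j, ((z - x j)⁻¹ ^ 2) • (-Complex.I) • A j + ∑ j, ((z - star (x j))⁻¹ ^ 2) • Complex.I • (A j)ᴴ

theorem hat_nabla_of_im_pos {z : ℂ} (hz : 0 < z.im) :
    ∀ᵐ ξ : ℝ, -Complex.I * hat (poleSq z) ξ = (|ξ| : ℝ) * hat (pole z) ξ := by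
  filter_upwards [hat_pole_sq hz.ne' (poleSq_ae hz.ne'), hat_pole_eq_zero_of_pos hz] with ξ h1 h2
  rw [h1]
  rcases lt_or_ge 0 ξ with h | h
  · rw [h2 h]; ring
  · rw [abs_of_nonpos h]
    push_cast
    linear_combination (ξ * hat (pole z) ξ) * Complex.I_sq

theorem hat_nabla_of_im_neg {z : ℂ} (hz : z.im < 0) :
    ∀ᵐ ξ : ℝ, Complex.I * hat (poleSq z) ξ = (|ξ| : ℝ) * hat (pole z) ξ := by
  filter_upwards [hat_pole_sq hz.ne (poleSq_ae hz.ne), hat_pole_eq_zero_of_neg hz] with ξ h1 h2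
  rw [h1]
  rcases lt_or_ge ξ 0 with h | h
  · rw [h2 h]; ring
  · rw [abs_of_nonneg h]
    linear_combination -(ξ * hat (pole z) ξ) * Complex.I_sq

/-- The constant in `IsAbsNabla` is `M₀ a b`, because a nonzero constant is not in `L²`. -/
theorem IsAbsNabla.eq_nablaC {N : ℕ} {M₀ : Mat2} {A : Fin N → Mat2} {x : Fin N → ℂ}
    (hx : ∀ j, 0 < (x j).im) {a b : Fin 2} {D : ℝ → ℂ}
    (h : IsAbsNabla (fun y => (M₀ + ratV A x y) a b) D) (y : ℝ) : D y = nablaC A x y a b := by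
  obtain ⟨hD, c, u, w, hu, hw, huw⟩ := h
  have hx' : ∀ j, (star (x j)).im < 0 := fun j => by simpa using hx j
  have hc : M₀ a b - c = 0 := by
    have h1 : MemLp (fun _ : ℝ => M₀ a b - c) 2 volume := by
      refine ((Lp.memLp u).sub (memLp_ratV A x hx a b)).ae_eq ?_
      filter_upwards [hu] with y hy
      rw [Pi.sub_apply, hy]
      simp only [Matrix.add_apply]
      ring
    rw [memLp_const_iff (by norm_num) (by norm_num)] at h1
    simpa using h1
  have hu' : u = ∑ j, A j a b • pole (x j) + ∑ j, (A j)ᴴ a b • pole (star (x j)) := by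
    apply Lp.ext
    filter_upwards [hu, ae_add (ae_sum fun j => ae_smul (A j a b) (pole_ae (hx j).ne'))
        (ae_sum fun j => ae_smul ((A j)ᴴ a b) (pole_ae (hx' j).ne))] with y h1 h2
    rw [h1, h2, Matrix.add_apply, add_sub_right_comm, hc, zero_add]
    simp [ratV, Matrix.sum_apply, mul_comm]
  set w' : L2 := ∑ j, (-Complex.I * A j a b) • poleSq (x j) +
    ∑ j, (Complex.I * (A j)ᴴ a b) • poleSq (star (x j)) with hw'
  have hww : w = w' := by
    apply hat_injective
    filter_upwards [huw, hat_add (∑ j, A j a b • pole (x j)) (∑ j, (A j)ᴴ a b • pole (star (x j))),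
      hat_add (∑ j, (-Complex.I * A j a b) • poleSq (x j))
        (∑ j, (Complex.I * (A j)ᴴ a b) • poleSq (star (x j))),
      hat_sum_smul (fun j => A j a b) (fun j => pole (x j)),
      hat_sum_smul (fun j => (A j)ᴴ a b) (fun j => pole (star (x j))),
      hat_sum_smul (fun j => -Complex.I * A j a b) (fun j => poleSq (x j)),
      hat_sum_smul (fun j => Complex.I * (A j)ᴴ a b) (fun j => poleSq (star (x j))),
      eventually_all.2 fun j => hat_nabla_of_im_pos (hx j),
      eventually_all.2 fun j => hat_nabla_of_im_neg (hx' j)] with ξ k1 k2 k3 k4 k5 k6 k7 k8 k9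
    rw [k1, hu', hw', k2, k3, k4, k5, k6, k7, mul_add, Finset.mul_sum, Finset.mul_sum]
    congr 1
    · refine Finset.sum_congr rfl fun j _ => ?_
      linear_combination -A j a b * k8 j
    · refine Finset.sum_congr rfl fun j _ => ?_
      linear_combination -(A j)ᴴ a b * k9 j
  have hcont : Continuous fun y : ℝ => nablaC A x y a b := by
    simp only [nablaC, Matrix.add_apply, Matrix.sum_apply, Matrix.smul_apply, smul_eq_mul]
    refine Continuous.add ?_ ?_ <;> refine continuous_finsetSum _ fun j _ => ?_
    · exact ((continuous_pole (hx j).ne').pow 2).mul continuous_const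
    · exact ((continuous_pole (hx' j).ne).pow 2).mul continuous_const
  refine congrFun ((hD.ae_eq_iff_eq volume hcont).1 ?_) y
  filter_upwards [hw, ae_add (ae_sum fun j => ae_smul (-Complex.I * A j a b) (poleSq_ae (hx j).ne'))
    (ae_sum fun j => ae_smul (Complex.I * (A j)ᴴ a b) (poleSq_ae (hx' j).ne))] with y h1 h2
  rw [← h1, hww, hw', h2]
  simp only [nablaC, Matrix.add_apply, Matrix.sum_apply, Matrix.smul_apply, smul_eq_mul]
  congr 1 <;> exact Finset.sum_congr rfl fun j _ => by ring

/-! ### Laurent expansions of rational matrix-valued functions -/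

/-- A function holomorphic off finitely many non-real points and zero on the real line is zero. -/
theorem eq_zero_of_real_eq_zero {S : Set ℂ} (hS : S.Finite) {f : ℂ → ℂ} (hr : ∀ y : ℝ, (y : ℂ) ∉ S)
    (hf : DifferentiableOn ℂ f Sᶜ) (h0 : ∀ y : ℝ, f y = 0) : ∀ z ∉ S, f z = 0 := by
  have ha := hf.analyticOnNhd hS.isClosed.isOpen_compl
  have hc : IsPreconnected Sᶜ :=
    (hS.countable.isConnected_compl_of_one_lt_rank (by
      rw [Complex.rank_real_complex]; norm_num)).isPreconnected
  refine ha.eqOn_of_preconnected_of_frequently_eq (g := fun _ => 0) analyticOnNhd_const hc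
    (z₀ := ((0 : ℝ) : ℂ)) (hr 0) ?_
  have ht : Tendsto (fun y : ℝ => (y : ℂ)) (𝓝[≠] 0) (𝓝[≠] ((0 : ℝ) : ℂ)) := by
    refine tendsto_nhdsWithin_iff.2 ⟨?_, ?_⟩
    · exact (Complex.continuous_ofReal.tendsto 0).mono_left nhdsWithin_le_nhds
    · filter_upwards [self_mem_nhdsWithin] with y hy
      simpa using hy
  exact ht.frequently (Frequently.of_forall h0)

/-- `∑ i, (z - p_i)⁻ⁿ a_i`. For `n ≠ 0` the term of a pole is dropped at this pole. -/
noncomputable def polSum {ι : Type*} [Fintype ι] (p : ι → ℂ) (a : ι → Mat2) (n : ℕ)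
    (z : ℂ) : Mat2 :=
  ∑ i, ((z - p i)⁻¹ ^ n) • a i

theorem differentiableOn_polSum {ι : Type*} [Fintype ι] (p : ι → ℂ) (a : ι → Mat2) (n : ℕ)
    (k l : Fin 2) : DifferentiableOn ℂ (fun z => polSum p a n z k l) (range p)ᶜ := by
  simp only [polSum, Matrix.sum_apply, Matrix.smul_apply, smul_eq_mul]
  refine DifferentiableOn.fun_sum fun i _ =>
    DifferentiableOn.mul_const (DifferentiableOn.pow ?_ n) _
  refine DifferentiableOn.inv (by fun_prop) fun z hz h => hz ⟨i, (sub_eq_zero.1 h).symm⟩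

theorem eq_zero_of_eventually {E : Type*} [Zero E] [TopologicalSpace E] [T2Space E] {f : ℂ → E}
    (hf : ContinuousAt f 0) (h : ∀ᶠ z in 𝓝[≠] (0 : ℂ), f z = 0) : f 0 = 0 :=
  tendsto_nhds_unique (hf.tendsto.mono_left nhdsWithin_le_nhds)
    ((tendsto_congr' h).2 tendsto_const_nhds)

/-- The lowest coefficient of a vanishing expansion vanishes and can be removed. -/
theorem peel {E : Type*} [AddCommGroup E] [Module ℂ E] [TopologicalSpace E] [T2Space E]
    [ContinuousSMul ℂ E] [ContinuousAdd E] {c : E} {f : ℂ → E} (hf : ContinuousAt f 0)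
    (h : ∀ᶠ z in 𝓝[≠] (0 : ℂ), c + z • f z = 0) : c = 0 ∧ ∀ᶠ z in 𝓝[≠] (0 : ℂ), f z = 0 := by
  have hc : c = 0 := by
    have := eq_zero_of_eventually (f := fun z => c + z • f z)
      (continuousAt_const.add (continuousAt_id.smul hf)) h
    simpa using this
  refine ⟨hc, ?_⟩
  filter_upwards [h, self_mem_nhdsWithin] with z hz hz0
  rw [hc, zero_add] at hz
  exact (smul_eq_zero.1 hz).resolve_left hz0

theorem eventually_add_sub_ne_zero {ι : Type*} [Fintype ι] {p : ι → ℂ}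
    (hp : Function.Injective p) (i : ι) :
    ∀ᶠ h in 𝓝[≠] (0 : ℂ), h ≠ 0 ∧ ∀ k, p i - p k + h ≠ 0 := by
  refine Filter.Eventually.and self_mem_nhdsWithin (eventually_all.2 fun k => ?_)
  by_cases hk : k = i
  · subst hk
    filter_upwards [self_mem_nhdsWithin] with h hh
    simpa using hh
  · refine Eventually.filter_mono nhdsWithin_le_nhds ?_
    refine ContinuousAt.eventually_ne (by fun_prop) ?_
    simpa [sub_eq_zero] using fun h => hk (hp h).symm

/-- The remainder of the expansion of `polSum p a 1` at the pole `p_i`, after the quadratic term. -/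
noncomputable def remOne {ι : Type*} [Fintype ι] (p : ι → ℂ) (a : ι → Mat2) (i : ι)
    (h : ℂ) : Mat2 :=
  ∑ k, ((p i - p k)⁻¹ ^ 3 * (p i - p k + h)⁻¹) • a k

/-- The remainder of the expansion of `polSum p a 2` at the pole `p_i`, after the linear term. -/
noncomputable def remTwo {ι : Type*} [Fintype ι] (p : ι → ℂ) (a : ι → Mat2) (i : ι)
    (h : ℂ) : Mat2 :=
  ∑ k, ((p i - p k)⁻¹ ^ 3 * ((3 * (p i - p k) + 2 * h) * (p i - p k + h)⁻¹ ^ 2)) • a k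

theorem continuousAt_remOne {ι : Type*} [Fintype ι] {p : ι → ℂ} (hp : Function.Injective p)
    (a : ι → Mat2) (i : ι) : ContinuousAt (remOne p a i) 0 := by
  unfold remOne
  refine tendsto_finsetSum _ fun k _ => ?_
  by_cases hk : k = i
  · subst hk; simp
  · have : p i - p k + 0 ≠ 0 := by simpa [sub_eq_zero] using fun h => hk (hp h).symm
    exact (continuousAt_const.mul
      (ContinuousAt.inv₀ (by fun_prop) this)).smul continuousAt_const

theorem continuousAt_remTwo {ι : Type*} [Fintype ι] {p : ι → ℂ} (hp : Function.Injective p)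
    (a : ι → Mat2) (i : ι) : ContinuousAt (remTwo p a i) 0 := by
  unfold remTwo
  refine tendsto_finsetSum _ fun k _ => ?_
  by_cases hk : k = i
  · subst hk; simp
  · have : p i - p k + 0 ≠ 0 := by simpa [sub_eq_zero] using fun h => hk (hp h).symm
    exact (continuousAt_const.mul ((by fun_prop : ContinuousAt _ _).mul
      ((ContinuousAt.inv₀ (by fun_prop) this).pow 2))).smul continuousAt_const

theorem polSum_one_expand {ι : Type*} [Fintype ι] {p : ι → ℂ} (hp : Function.Injective p)
    (a : ι → Mat2) (i : ι) : ∀ᶠ h in 𝓝[≠] (0 : ℂ), polSum p a 1 (p i + h) =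
      h⁻¹ • a i + polSum p a 1 (p i) - h • polSum p a 2 (p i) + h ^ 2 • polSum p a 3 (p i)
        - h ^ 3 • remOne p a i h := by
  classical
  filter_upwards [eventually_add_sub_ne_zero hp i] with h ⟨h0, hk⟩
  have e : h⁻¹ • a i = ∑ k, (if k = i then h⁻¹ else 0) • a k := by simp
  simp only [polSum, remOne, e, Finset.smul_sum, ← Finset.sum_add_distrib, ← Finset.sum_sub_distrib,
    smul_smul, ← add_smul, ← sub_smul]
  refine Finset.sum_congr rfl fun k _ => ?_
  congr 1
  by_cases hki : k = i
  · subst hki; simp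
  · have h1 : p i - p k ≠ 0 := sub_ne_zero.2 fun h => hki (hp h).symm
    have h2 := hk k
    rw [if_neg hki, show p i + h - p k = p i - p k + h by ring]
    field_simp
    ring

theorem polSum_two_expand {ι : Type*} [Fintype ι] {p : ι → ℂ} (hp : Function.Injective p)
    (a : ι → Mat2) (i : ι) : ∀ᶠ h in 𝓝[≠] (0 : ℂ), polSum p a 2 (p i + h) =
      h⁻¹ ^ 2 • a i + polSum p a 2 (p i) - (2 * h) • polSum p a 3 (p i)
        + h ^ 2 • remTwo p a i h := by
  classical
  filter_upwards [eventually_add_sub_ne_zero hp i] with h ⟨h0, hk⟩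
  have e : h⁻¹ ^ 2 • a i = ∑ k, (if k = i then h⁻¹ ^ 2 else 0) • a k := by simp
  simp only [polSum, remTwo, e, Finset.smul_sum, ← Finset.sum_add_distrib, ← Finset.sum_sub_distrib,
    smul_smul, ← add_smul, ← sub_smul]
  refine Finset.sum_congr rfl fun k _ => ?_
  congr 1
  by_cases hki : k = i
  · subst hki; simp
  · have h1 : p i - p k ≠ 0 := sub_ne_zero.2 fun h => hki (hp h).symm
    have h2 := hk k
    rw [if_neg hki, show p i + h - p k = p i - p k + h by ring]
    field_simp
    ring

theorem eventually_add_notMem_range {ι : Type*} [Fintype ι] {p : ι → ℂ}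
    (hp : Function.Injective p) (i : ι) : ∀ᶠ h in 𝓝[≠] (0 : ℂ), p i + h ∉ range p := by
  filter_upwards [eventually_add_sub_ne_zero hp i] with h ⟨_, hk⟩ ⟨k, hk'⟩
  exact hk k (by rw [hk']; ring)

/-- The Laurent coefficients of `(M₀ + ∑ a_i / (z - p_i))² = 1` at a pole, up to the linear one. -/
theorem laurent_sq {ι : Type*} [Fintype ι] {p : ι → ℂ} (hp : Function.Injective p)
    {M₀ : Mat2} {a : ι → Mat2}
    (hsq : ∀ z ∉ range p, (M₀ + polSum p a 1 z) * (M₀ + polSum p a 1 z) = 1) (i : ι) :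
    a i * a i = 0 ∧
    a i * (M₀ + polSum p a 1 (p i)) + (M₀ + polSum p a 1 (p i)) * a i = 0 ∧
    a i * polSum p a 3 (p i) + polSum p a 3 (p i) * a i =
      (M₀ + polSum p a 1 (p i)) * polSum p a 2 (p i) +
        polSum p a 2 (p i) * (M₀ + polSum p a 1 (p i)) := by
  set α := a i
  set B := M₀ + polSum p a 1 (p i) with hB
  set C := polSum p a 2 (p i)
  set E := polSum p a 3 (p i)
  set m₂ : ℂ → Mat2 := fun h => E - h • remOne p a i h with hm₂
  set m₁ : ℂ → Mat2 := fun h => -C + h • m₂ h with hm₁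
  set m : ℂ → Mat2 := fun h => B + h • m₁ h with hm
  have c₂ : ContinuousAt m₂ 0 :=
    continuousAt_const.sub (continuousAt_id.smul (continuousAt_remOne hp a i))
  have c₁ : ContinuousAt m₁ 0 := continuousAt_const.add (continuousAt_id.smul c₂)
  have c₀ : ContinuousAt m 0 := continuousAt_const.add (continuousAt_id.smul c₁)
  have key : ∀ᶠ h in 𝓝[≠] (0 : ℂ), α * α + h • (α * m h + m h * α + h • (m h * m h - 1)) = 0 := by
    filter_upwards [polSum_one_expand hp a i, eventually_add_notMem_range hp i, self_mem_nhdsWithin]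
      with h h1 h2 h0
    have h0' : h ≠ 0 := h0
    have h3 : M₀ + polSum p a 1 (p i + h) = h⁻¹ • α + m h := by
      rw [h1, hm, hm₁, hm₂, hB]; module
    have h4 := hsq _ h2
    rw [h3] at h4
    have h5 : h • (h⁻¹ • α + m h) = α + h • m h := by
      rw [smul_add, smul_inv_smul₀ h0']
    have h6 : (α + h • m h) * (α + h • m h) = (h * h) • (1 : Mat2) := by
      rw [← h5, smul_mul_smul_comm, h4]
    simp only [add_mul, mul_add, smul_mul_assoc, mul_smul_comm] at h6
    linear_combination (norm := module) h6
  obtain ⟨r1, k1⟩ := peel (f := fun h => α * m h + m h * α + h • (m h * m h - 1))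
    (((continuousAt_const.mul c₀).add (c₀.mul continuousAt_const)).add
    (continuousAt_id.smul ((c₀.mul c₀).sub continuousAt_const))) key
  have key2 : ∀ᶠ h in 𝓝[≠] (0 : ℂ), (α * B + B * α) +
      h • ((α * m₁ h + m₁ h * α) + (m h * m h - 1)) = 0 := by
    filter_upwards [k1] with h hh
    rw [← hh]
    conv_rhs => rw [show α * m h + m h * α = α * (B + h • m₁ h) + (B + h • m₁ h) * α from rfl]
    simp only [add_mul, mul_add, smul_mul_assoc, mul_smul_comm]
    module
  obtain ⟨r2, k2⟩ := peel (f := fun h => (α * m₁ h + m₁ h * α) + (m h * m h - 1))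
    (((continuousAt_const.mul c₁).add (c₁.mul continuousAt_const)).add
    ((c₀.mul c₀).sub continuousAt_const)) key2
  have key3 : ∀ᶠ h in 𝓝[≠] (0 : ℂ), (α * (-C) + (-C) * α + (B * B - 1)) +
      h • ((α * m₂ h + m₂ h * α) + (B * m₁ h + m₁ h * m h)) = 0 := by
    filter_upwards [k2] with h hh
    rw [← hh]
    conv_rhs => rw [show α * m₁ h + m₁ h * α = α * (-C + h • m₂ h) + (-C + h • m₂ h) * α from rfl,
      show m h * m h = (B + h • m₁ h) * m h from rfl, add_mul B (h • m₁ h) (m h),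
      show B * m h = B * (B + h • m₁ h) from rfl]
    simp only [add_mul, mul_add, smul_mul_assoc, mul_smul_comm]
    module
  obtain ⟨-, k3⟩ := peel
    (f := fun h => (α * m₂ h + m₂ h * α) + (B * m₁ h + m₁ h * m h))
    (((continuousAt_const.mul c₂).add (c₂.mul continuousAt_const)).add
    ((continuousAt_const.mul c₁).add (c₁.mul c₀))) key3
  have r3 := eq_zero_of_eventually
    (f := fun h => (α * m₂ h + m₂ h * α) + (B * m₁ h + m₁ h * m h))
    (((continuousAt_const.mul c₂).add (c₂.mul continuousAt_const)).add
      ((continuousAt_const.mul c₁).add (c₁.mul c₀))) k3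
  refine ⟨r1, r2, ?_⟩
  simp only [hm, hm₁, hm₂, zero_smul, sub_zero, add_zero, mul_neg, neg_mul] at r3
  linear_combination (norm := module) r3

/-- Multiplication of the identity of `commutator_coefficients` by `h²`. -/
theorem clear_denominators {α m' n g B P : Mat2} {h ξ β κ : ℂ} (h0 : h ≠ 0)
    (k4 : (h⁻¹ ^ 2) • ξ • α + h⁻¹ • P + g =
      κ • ((h⁻¹ • α + (B + h • m')) * ((h⁻¹ ^ 2) • β • α + n) -
        ((h⁻¹ ^ 2) • β • α + n) * (h⁻¹ • α + (B + h • m')))) :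
    (ξ • α - (κ * β) • (B * α - α * B)) +
      h • ((P - (κ * β) • (m' * α - α * m') - κ • (α * n - n * α)) +
        h • (g - κ • ((B + h • m') * n - n * (B + h • m')))) = 0 := by
  have k5 := congrArg (fun Y : Mat2 => h ^ 2 • Y) k4
  simp only [add_mul, mul_add, smul_mul_assoc, mul_smul_comm, smul_add, smul_sub, smul_smul] at k5
  have i2 : h ^ 2 * h⁻¹ = h := by field_simp
  have j1 : h ^ 2 * (h⁻¹ ^ 2 * ξ) = ξ := by field_simp
  have j2 : h ^ 2 * (κ * (h⁻¹ ^ 2 * β)) = κ * β := by field_simp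
  have j3 : h ^ 2 * (κ * h⁻¹) = κ * h := by field_simp
  have j4 : h ^ 2 * (κ * (h⁻¹ ^ 2 * β * h)) = κ * β * h := by field_simp
  have j5 : h ^ 2 * (κ * (h * (h⁻¹ ^ 2 * β))) = κ * β * h := by field_simp
  simp only [i2, j1, j2, j3, j4, j5] at k5
  simp only [add_mul, mul_add, smul_mul_assoc, mul_smul_comm]
  linear_combination (norm := module) k5

/-- The first three coefficients, in `h`, of the identity of `clear_denominators`. -/
theorem peel_twice {α C S P n₀ : Mat2} {κ μ : ℂ} {m₁ m₂ n₁ R : ℂ → Mat2}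
    (hm : ∀ h, m₁ h = -C + h • m₂ h) (c₁ : ContinuousAt m₁ 0) (c₂ : ContinuousAt m₂ 0)
    (d₁ : ContinuousAt n₁ 0) (hR : ContinuousAt R 0)
    (h : ∀ᶠ h in 𝓝[≠] (0 : ℂ), S + h • ((P - μ • (m₁ h * α - α * m₁ h) -
      κ • (α * (n₀ + h • n₁ h) - (n₀ + h • n₁ h) * α)) + h • R h) = 0) :
    S = 0 ∧ P = -μ • (C * α - α * C) + κ • (α * n₀ - n₀ * α) ∧
      R 0 = μ • (m₂ 0 * α - α * m₂ 0) + κ • (α * n₁ 0 - n₁ 0 * α) := by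
  have hα : ContinuousAt (fun _ : ℂ => α) 0 := continuousAt_const
  have d₀ : ContinuousAt (fun h => n₀ + h • n₁ h) 0 :=
    continuousAt_const.add (continuousAt_id.smul d₁)
  have hlin : ContinuousAt (fun h => (P - μ • (m₁ h * α - α * m₁ h) -
      κ • (α * (n₀ + h • n₁ h) - (n₀ + h • n₁ h) * α)) + h • R h) 0 :=
    ((continuousAt_const.sub (((c₁.mul hα).sub (hα.mul c₁)).const_smul μ)).sub
      (((hα.mul d₀).sub (d₀.mul hα)).const_smul κ)).add (continuousAt_id.smul hR)
  obtain ⟨r1, q1⟩ := peel hlin h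
  have hconst : ContinuousAt (fun h => (-μ • (m₂ h * α - α * m₂ h) -
      κ • (α * n₁ h - n₁ h * α)) + R h) 0 :=
    ((((c₂.mul hα).sub (hα.mul c₂)).const_smul (-μ)).sub
      (((hα.mul d₁).sub (d₁.mul hα)).const_smul κ)).add hR
  have key2 : ∀ᶠ h in 𝓝[≠] (0 : ℂ),
      (P - μ • ((-C) * α - α * (-C)) - κ • (α * n₀ - n₀ * α)) +
      h • ((-μ • (m₂ h * α - α * m₂ h) - κ • (α * n₁ h - n₁ h * α)) + R h) = 0 := by
    filter_upwards [q1] with h hh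
    rw [hm h] at hh
    rw [← hh]
    simp only [add_mul, mul_add, smul_mul_assoc, mul_smul_comm]
    module
  obtain ⟨r2, q2⟩ := peel hconst key2
  have r3 := eq_zero_of_eventually hconst q2
  refine ⟨r1, ?_, ?_⟩
  · simp only [neg_mul, mul_neg] at r2
    linear_combination (norm := module) r2
  · linear_combination (norm := module) r3

/-- Comparison of the coefficients of `h⁻²`, `h⁻¹` and `1` in the expansion of an identity
`ξ α / h² + P / h + g(h) = κ [α / h + m(h), β α / h² + n(h)]`; the coefficient of `h⁻³` on the right
is a multiple of `[α, α]`. -/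
theorem commutator_coefficients {α B C P n₀ g₀ : Mat2} {ξ β κ : ℂ} {m₁ m₂ n₁ g₁ : ℂ → Mat2}
    (hm : ∀ h, m₁ h = -C + h • m₂ h) (c₁ : ContinuousAt m₁ 0) (c₂ : ContinuousAt m₂ 0)
    (d₁ : ContinuousAt n₁ 0) (e₁ : ContinuousAt g₁ 0)
    (heq : ∀ᶠ h in 𝓝[≠] (0 : ℂ), (h⁻¹ ^ 2) • ξ • α + h⁻¹ • P + (g₀ + h • g₁ h) =
      κ • ((h⁻¹ • α + (B + h • m₁ h)) * ((h⁻¹ ^ 2) • β • α + (n₀ + h • n₁ h)) -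
        ((h⁻¹ ^ 2) • β • α + (n₀ + h • n₁ h)) * (h⁻¹ • α + (B + h • m₁ h)))) :
    ξ • α = (κ * β) • (B * α - α * B) ∧
    P = -(κ * β) • (C * α - α * C) + κ • (α * n₀ - n₀ * α) ∧
    g₀ = (κ * β) • (m₂ 0 * α - α * m₂ 0) + κ • (α * n₁ 0 - n₁ 0 * α) + κ • (B * n₀ - n₀ * B) := by
  have c₀ : ContinuousAt (fun h => B + h • m₁ h) 0 :=
    continuousAt_const.add (continuousAt_id.smul c₁)
  have d₀ : ContinuousAt (fun h => n₀ + h • n₁ h) 0 :=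
    continuousAt_const.add (continuousAt_id.smul d₁)
  have e₀ : ContinuousAt (fun h => g₀ + h • g₁ h) 0 :=
    continuousAt_const.add (continuousAt_id.smul e₁)
  set R : ℂ → Mat2 := fun h => (g₀ + h • g₁ h) -
      κ • ((B + h • m₁ h) * (n₀ + h • n₁ h) - (n₀ + h • n₁ h) * (B + h • m₁ h)) with hR
  have hrest : ContinuousAt R 0 := e₀.sub (((c₀.mul d₀).sub (d₀.mul c₀)).const_smul κ)
  have hR0 : R 0 = g₀ - κ • (B * n₀ - n₀ * B) := by simp [hR]
  have key : ∀ᶠ h in 𝓝[≠] (0 : ℂ), (ξ • α - (κ * β) • (B * α - α * B)) +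
      h • ((P - (κ * β) • (m₁ h * α - α * m₁ h) -
        κ • (α * (n₀ + h • n₁ h) - (n₀ + h • n₁ h) * α)) + h • R h) = 0 := by
    filter_upwards [heq, self_mem_nhdsWithin] with h k4 h0
    exact clear_denominators h0 k4
  clear_value R
  obtain ⟨r1, r2, r3⟩ := peel_twice hm c₁ c₂ d₁ hrest key
  refine ⟨sub_eq_zero.1 r1, r2, ?_⟩
  rw [hR0] at r3
  linear_combination (norm := module) r3

/-- The Laurent coefficients of the identity
`∑ P_k / (z - p_k) + ∑ ξ_k a_k / (z - p_k)² = κ [M, D]` with `M = M₀ + ∑ a_k / (z - p_k)` and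
`D = ∑ β_k a_k / (z - p_k)²`, at a pole, up to the constant one. -/
theorem laurent_commutator {ι : Type*} [Fintype ι] {p : ι → ℂ} (hp : Function.Injective p)
    {M₀ : Mat2} {a b s P : ι → Mat2} {ξ β : ι → ℂ} {κ : ℂ} (hb : ∀ k, b k = β k • a k)
    (hs : ∀ k, s k = ξ k • a k)
    (heq : ∀ z ∉ range p, polSum p P 1 z + polSum p s 2 z =
      κ • ((M₀ + polSum p a 1 z) * polSum p b 2 z - polSum p b 2 z * (M₀ + polSum p a 1 z)))
    (i : ι) :
    ξ i • a i = (κ * β i) • ((M₀ + polSum p a 1 (p i)) * a i - a i * (M₀ + polSum p a 1 (p i))) ∧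
    P i = -(κ * β i) • (polSum p a 2 (p i) * a i - a i * polSum p a 2 (p i)) +
      κ • (a i * polSum p b 2 (p i) - polSum p b 2 (p i) * a i) ∧
    polSum p P 1 (p i) + polSum p s 2 (p i) =
      (κ * β i) • (polSum p a 3 (p i) * a i - a i * polSum p a 3 (p i)) -
      (2 * κ) • (a i * polSum p b 3 (p i) - polSum p b 3 (p i) * a i) +
      κ • ((M₀ + polSum p a 1 (p i)) * polSum p b 2 (p i) -
        polSum p b 2 (p i) * (M₀ + polSum p a 1 (p i))) := by
  have c₂ : ContinuousAt (fun h => polSum p a 3 (p i) - h • remOne p a i h) 0 :=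
    continuousAt_const.sub (continuousAt_id.smul (continuousAt_remOne hp a i))
  obtain ⟨r1, r2, r3⟩ := commutator_coefficients (α := a i) (B := M₀ + polSum p a 1 (p i))
    (C := polSum p a 2 (p i)) (P := P i) (n₀ := polSum p b 2 (p i))
    (g₀ := polSum p P 1 (p i) + polSum p s 2 (p i)) (ξ := ξ i) (β := β i) (κ := κ)
    (m₁ := fun h => -polSum p a 2 (p i) + h • (polSum p a 3 (p i) - h • remOne p a i h))
    (m₂ := fun h => polSum p a 3 (p i) - h • remOne p a i h)
    (n₁ := fun h => (-2 : ℂ) • polSum p b 3 (p i) + h • remTwo p b i h)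
    (g₁ := fun h => (-polSum p P 2 (p i) + h • (polSum p P 3 (p i) - h • remOne p P i h)) +
      ((-2 : ℂ) • polSum p s 3 (p i) + h • remTwo p s i h))
    (fun _ => rfl) (continuousAt_const.add (continuousAt_id.smul c₂)) c₂
    (continuousAt_const.add (continuousAt_id.smul (continuousAt_remTwo hp b i)))
    ((continuousAt_const.add (continuousAt_id.smul
      (continuousAt_const.sub (continuousAt_id.smul (continuousAt_remOne hp P i))))).add
      (continuousAt_const.add (continuousAt_id.smul (continuousAt_remTwo hp s i)))) (by
    filter_upwards [polSum_one_expand hp a i, polSum_two_expand hp b i, polSum_one_expand hp P i,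
      polSum_two_expand hp s i, eventually_add_notMem_range hp i] with h h1 h2 h3 h4 h5
    have k1 : M₀ + polSum p a 1 (p i + h) = h⁻¹ • a i + (M₀ + polSum p a 1 (p i) +
        h • (-polSum p a 2 (p i) + h • (polSum p a 3 (p i) - h • remOne p a i h))) := by
      rw [h1]; module
    have k2 : polSum p b 2 (p i + h) = (h⁻¹ ^ 2) • β i • a i +
        (polSum p b 2 (p i) + h • ((-2 : ℂ) • polSum p b 3 (p i) + h • remTwo p b i h)) := by
      rw [h2, hb]; module
    rw [← k1, ← k2, ← heq _ h5, h3, h4, hs]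
    module)
  refine ⟨r1, r2, ?_⟩
  rw [r3]
  simp only [zero_smul, sub_zero, add_zero, mul_smul_comm, smul_mul_assoc]
  module

/-! ### Differentiation of matrix-valued functions of time -/

/-- Entrywise differentiability of a matrix-valued function within a set of times. -/
def MatDeriv {m n : Type*} (f : ℝ → Matrix m n ℂ) (f' : Matrix m n ℂ) (I : Set ℝ) (s : ℝ) : Prop :=
  ∀ i j, HasDerivWithinAt (fun t => f t i j) (f' i j) I s

namespace MatDeriv

variable {l m n : Type*} {I : Set ℝ} {s : ℝ}

theorem const (C : Matrix m n ℂ) : MatDeriv (fun _ => C) 0 I s := fun _ _ =>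
  hasDerivWithinAt_const _ _ _

theorem add {f g : ℝ → Matrix m n ℂ} {f' g' : Matrix m n ℂ} (hf : MatDeriv f f' I s)
    (hg : MatDeriv g g' I s) : MatDeriv (fun t => f t + g t) (f' + g') I s := fun i j =>
  (hf i j).add (hg i j)

theorem sub {f g : ℝ → Matrix m n ℂ} {f' g' : Matrix m n ℂ} (hf : MatDeriv f f' I s)
    (hg : MatDeriv g g' I s) : MatDeriv (fun t => f t - g t) (f' - g') I s := fun i j =>
  (hf i j).sub (hg i j)

theorem smul {c : ℝ → ℂ} {c' : ℂ} {f : ℝ → Matrix m n ℂ} {f' : Matrix m n ℂ}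
    (hc : HasDerivWithinAt c c' I s) (hf : MatDeriv f f' I s) :
    MatDeriv (fun t => c t • f t) (c' • f s + c s • f') I s := fun i j => by
  simp only [Matrix.smul_apply, Matrix.add_apply, smul_eq_mul]
  exact hc.mul (hf i j)

theorem mul [Fintype m] {f : ℝ → Matrix l m ℂ} {g : ℝ → Matrix m n ℂ} {f' : Matrix l m ℂ}
    {g' : Matrix m n ℂ} (hf : MatDeriv f f' I s) (hg : MatDeriv g g' I s) :
    MatDeriv (fun t => f t * g t) (f' * g s + f s * g') I s := fun i j => by
  simp only [Matrix.mul_apply, Matrix.add_apply, ← Finset.sum_add_distrib]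
  exact HasDerivWithinAt.fun_sum fun k _ => (hf i k).mul (hg k j)

theorem sum {ι : Type*} [Fintype ι] {f : ι → ℝ → Matrix m n ℂ} {f' : ι → Matrix m n ℂ}
    (hf : ∀ i, MatDeriv (f i) (f' i) I s) : MatDeriv (fun t => ∑ i, f i t) (∑ i, f' i) I s :=
  fun a b => by
    simp only [Matrix.sum_apply]
    exact HasDerivWithinAt.fun_sum fun i _ => hf i a b

theorem conjTranspose {f : ℝ → Matrix m n ℂ} {f' : Matrix m n ℂ} (hf : MatDeriv f f' I s) :
    MatDeriv (fun t => (f t)ᴴ) f'ᴴ I s := fun i j => (hf j i).star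

theorem unique {f : ℝ → Matrix m n ℂ} {f' g' : Matrix m n ℂ} (hI : UniqueDiffWithinAt ℝ I s)
    (hf : MatDeriv f f' I s) (hg : MatDeriv f g' I s) : f' = g' := by
  ext i j
  exact hI.eq_deriv _ (hf i j) (hg i j)

end MatDeriv

theorem hasDerivWithinAt_inv_sub {q p : ℝ → ℂ} {q' p' : ℂ} {I : Set ℝ} {s : ℝ}
    (hq : HasDerivWithinAt q q' I s) (hp : HasDerivWithinAt p p' I s) (h : q s ≠ p s) :
    HasDerivWithinAt (fun t => (q t - p t)⁻¹) (-(q' - p') * (q s - p s)⁻¹ ^ 2) I s := by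
  have h1 : q s - p s ≠ 0 := sub_ne_zero.2 h
  convert! (hq.sub hp).inv h1 using 1
  rw [Pi.sub_apply, inv_pow, div_eq_mul_inv]

/-! ### The equations of motion of poles and residues -/

/-- All poles of the rational function: the `x_j` and their conjugates. -/
def allPoles {N : ℕ} (x : Fin N → ℂ) : Fin N ⊕ Fin N → ℂ := Sum.elim x fun j => star (x j)

/-- The residues at all poles. -/
def allResidues {N : ℕ} (A : Fin N → Mat2) : Fin N ⊕ Fin N → Mat2 := Sum.elim A fun j => (A j)ᴴ

theorem allPoles_injective {N : ℕ} {x : Fin N → ℂ} (hx : ∀ j, 0 < (x j).im)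
    (hinj : Function.Injective x) : Function.Injective (allPoles x) := by
  refine Function.Injective.sumElim hinj (star_injective.comp hinj) fun j k h => ?_
  have h1 := congrArg Complex.im h
  have h2 := hx j
  have h3 := hx k
  simp at h1
  linarith

theorem ofReal_notMem_allPoles {N : ℕ} {x : Fin N → ℂ} (hx : ∀ j, 0 < (x j).im) (y : ℝ) :
    (y : ℂ) ∉ range (allPoles x) := by
  rintro ⟨j | j, h⟩
  · have h1 := congrArg Complex.im h
    simp [allPoles] at h1
    exact (hx j).ne' h1
  · have h1 := congrArg Complex.im h
    simp [allPoles] at h1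
    exact (hx j).ne' h1

theorem ratC_eq_polSum {N : ℕ} (A : Fin N → Mat2) (x : Fin N → ℂ) (z : ℂ) :
    ratC A x z = polSum (allPoles x) (allResidues A) 1 z := by
  simp [ratC, polSum, allPoles, allResidues, Fintype.sum_sum_type]

theorem pauli_conjTranspose (m : EuclideanSpace ℝ (Fin 3)) : (pauli m)ᴴ = pauli m := by
  ext i j
  fin_cases i <;> fin_cases j <;> simp [pauli]
  ring

theorem pauli_mul_self {m : EuclideanSpace ℝ (Fin 3)} (hm : ‖m‖ = 1) : pauli m * pauli m = 1 := by
  have h : (m 0 : ℂ) ^ 2 + (m 1 : ℂ) ^ 2 + (m 2 : ℂ) ^ 2 = 1 := by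
    have h1 := EuclideanSpace.norm_sq_eq m
    rw [hm, Fin.sum_univ_three] at h1
    simp only [Real.norm_eq_abs, sq_abs, one_pow] at h1
    exact_mod_cast h1.symm
  ext i j
  fin_cases i <;> fin_cases j <;> simp [pauli, Matrix.mul_apply, Fin.sum_univ_two]
  · linear_combination h - (m 1 : ℂ) ^ 2 * Complex.I_sq
  · ring
  · ring
  · linear_combination h - (m 1 : ℂ) ^ 2 * Complex.I_sq

namespace IsRationalSolution

variable {N : ℕ} {I : Set ℝ} {M₀ : Mat2} {A : ℝ → Fin N → Mat2} {x : ℝ → Fin N → ℂ}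

theorem hermitian (h : IsRationalSolution I M₀ A x) {t : ℝ} (ht : t ∈ I) (y : ℝ) :
    (M₀ + ratV (A t) (x t) y)ᴴ = M₀ + ratV (A t) (x t) y := by
  obtain ⟨m, -, hm⟩ := h.sphere t ht y
  rw [hm, pauli_conjTranspose]

theorem hermitian_const (h : IsRationalSolution I M₀ A x) {t : ℝ} (ht : t ∈ I) : M₀ᴴ = M₀ := by
  have h1 := h.hermitian ht 0
  rw [ratV_eq_ratC, Matrix.conjTranspose_add, conjTranspose_ratC] at h1
  have h2 : star (((0 : ℝ) : ℂ)) = ((0 : ℝ) : ℂ) := by simp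
  rw [h2] at h1
  exact add_right_cancel h1

theorem sq_eq_one (h : IsRationalSolution I M₀ A x) {t : ℝ} (ht : t ∈ I) :
    ∀ z ∉ range (allPoles (x t)),
      (M₀ + polSum (allPoles (x t)) (allResidues (A t)) 1 z) *
        (M₀ + polSum (allPoles (x t)) (allResidues (A t)) 1 z) = 1 := by
  intro z hz
  ext i j
  have hd : ∀ k l, DifferentiableOn ℂ
      (fun z => (M₀ + polSum (allPoles (x t)) (allResidues (A t)) 1 z) k l)
      (range (allPoles (x t)))ᶜ := fun k l =>
    (differentiableOn_const _).add (differentiableOn_polSum _ _ _ k l)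
  refine sub_eq_zero.1 (eq_zero_of_real_eq_zero (finite_range (allPoles (x t)))
    (f := fun z => ((M₀ + polSum (allPoles (x t)) (allResidues (A t)) 1 z) *
        (M₀ + polSum (allPoles (x t)) (allResidues (A t)) 1 z)) i j - (1 : Mat2) i j)
    (ofReal_notMem_allPoles (h.im_pos t ht)) ?_ (fun y => ?_) z hz)
  · simp only [Matrix.mul_apply]
    exact (DifferentiableOn.fun_sum fun k _ => (hd i k).mul (hd k j)).sub (differentiableOn_const _)
  · obtain ⟨m, hm1, hm⟩ := h.sphere t ht y
    rw [ratV_eq_ratC, ratC_eq_polSum] at hm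
    simp only [hm, pauli_mul_self hm1, sub_self]

theorem residue_sq (h : IsRationalSolution I M₀ A x) {t : ℝ} (ht : t ∈ I) (j : Fin N) :
    A t j * A t j = 0 :=
  (laurent_sq (allPoles_injective (h.im_pos t ht) (h.pole_injective t ht)) (h.sq_eq_one ht)
    (Sum.inl j)).1

theorem residue_anticomm (h : IsRationalSolution I M₀ A x) {t : ℝ} (ht : t ∈ I) (j : Fin N) :
    A t j * (M₀ + ratC (A t) (x t) (x t j)) + (M₀ + ratC (A t) (x t) (x t j)) * A t j = 0 := by
  rw [ratC_eq_polSum]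
  exact (laurent_sq (allPoles_injective (h.im_pos t ht) (h.pole_injective t ht)) (h.sq_eq_one ht)
    (Sum.inl j)).2.1

end IsRationalSolution

/-- The velocities of all poles, for the velocities `ξ_j` of the `x_j`. -/
def allVelocities {N : ℕ} (ξ : Fin N → ℂ) : Fin N ⊕ Fin N → ℂ := Sum.elim ξ fun j => star (ξ j)

/-- The factors `∓ i` with which `|∇|` takes `(y - p)⁻¹` to a multiple of `(y - p)⁻²`. -/
def nablaWeight (N : ℕ) : Fin N ⊕ Fin N → ℂ := Sum.elim (fun _ => -Complex.I) fun _ => Complex.I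

theorem polSum_nablaWeight {N : ℕ} (A : Fin N → Mat2) (x : Fin N → ℂ) (n : ℕ) (z : ℂ) :
    polSum (allPoles x) (fun k => nablaWeight N k • allResidues A k) n z =
      Complex.I • (polSum (allPoles x) (allResidues A) n z - (2 : ℂ) • polSum x A n z) := by
  simp only [polSum, allPoles, allResidues, nablaWeight, Fintype.sum_sum_type, Sum.elim_inl,
    Sum.elim_inr, Finset.smul_sum, smul_add, smul_sub]
  rw [add_sub_right_comm, ← Finset.sum_sub_distrib]
  congr 1 <;> refine Finset.sum_congr rfl fun j _ => ?_ <;> module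

theorem nablaC_eq_polSum {N : ℕ} (A : Fin N → Mat2) (x : Fin N → ℂ) (z : ℂ) :
    nablaC A x z = polSum (allPoles x) (fun k => nablaWeight N k • allResidues A k) 2 z := by
  simp [nablaC, polSum, allPoles, allResidues, nablaWeight, Fintype.sum_sum_type]

namespace IsRationalSolution

variable {N : ℕ} {I : Set ℝ} {M₀ : Mat2} {A : ℝ → Fin N → Mat2} {x : ℝ → Fin N → ℂ}

/-- The derivatives of the residues within the set of times `I`. -/
noncomputable def residueDeriv (I : Set ℝ) (A : ℝ → Fin N → Mat2) (t : ℝ) (j : Fin N) : Mat2 :=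
  Matrix.of fun a b => derivWithin (fun t => A t j a b) I t

/-- The derivatives of the poles within the set of times `I`. -/
noncomputable def poleDeriv (I : Set ℝ) (x : ℝ → Fin N → ℂ) (t : ℝ) (j : Fin N) : ℂ :=
  derivWithin (fun t => x t j) I t

theorem matDeriv_residue (h : IsRationalSolution I M₀ A x) {t : ℝ} (ht : t ∈ I) (j : Fin N) :
    MatDeriv (fun t => A t j) (residueDeriv I A t j) I t := fun a b =>
  (h.differentiableOn_residue j a b t ht).hasDerivWithinAt

theorem hasDerivWithinAt_pole (h : IsRationalSolution I M₀ A x) {t : ℝ} (ht : t ∈ I) (j : Fin N) :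
    HasDerivWithinAt (fun t => x t j) (poleDeriv I x t j) I t :=
  (h.differentiableOn_pole j t ht).hasDerivWithinAt

theorem matDeriv_allResidues (h : IsRationalSolution I M₀ A x) {t : ℝ} (ht : t ∈ I)
    (k : Fin N ⊕ Fin N) :
    MatDeriv (fun t => allResidues (A t) k) (allResidues (residueDeriv I A t) k) I t := by
  rcases k with j | j
  · exact h.matDeriv_residue ht j
  · exact (h.matDeriv_residue ht j).conjTranspose

theorem hasDerivWithinAt_allPoles (h : IsRationalSolution I M₀ A x) {t : ℝ} (ht : t ∈ I)
    (k : Fin N ⊕ Fin N) :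
    HasDerivWithinAt (fun t => allPoles (x t) k) (allVelocities (poleDeriv I x t) k) I t := by
  rcases k with j | j
  · exact h.hasDerivWithinAt_pole ht j
  · exact (h.hasDerivWithinAt_pole ht j).star

/-- The half-wave maps equation as an identity between rational functions of a complex variable. -/
theorem equation_complex (h : IsRationalSolution I M₀ A x) {t : ℝ} (ht : t ∈ I)
    (hI : UniqueDiffWithinAt ℝ I t) :
    ∀ z ∉ range (allPoles (x t)),
      polSum (allPoles (x t)) (allResidues (residueDeriv I A t)) 1 z +
        polSum (allPoles (x t))
          (fun k => allVelocities (poleDeriv I x t) k • allResidues (A t) k) 2 z =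
      (-(Complex.I / 2)) •
        ((M₀ + polSum (allPoles (x t)) (allResidues (A t)) 1 z) *
            polSum (allPoles (x t)) (fun k => nablaWeight N k • allResidues (A t) k) 2 z -
          polSum (allPoles (x t)) (fun k => nablaWeight N k • allResidues (A t) k) 2 z *
            (M₀ + polSum (allPoles (x t)) (allResidues (A t)) 1 z)) := by
  obtain ⟨D, hD, heq⟩ := h.equation
  have hx := h.im_pos t ht
  have hDt : ∀ y : ℝ, D t y =
      polSum (allPoles (x t)) (fun k => nablaWeight N k • allResidues (A t) k) 2 y := fun y => by
    rw [← nablaC_eq_polSum]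
    ext a b
    exact (hD t ht a b).eq_nablaC hx y
  set p := allPoles (x t)
  set a := allResidues (A t)
  set b := fun k => nablaWeight N k • allResidues (A t) k
  have hreal : ∀ y : ℝ, polSum p (allResidues (residueDeriv I A t)) 1 y +
      polSum p (fun k => allVelocities (poleDeriv I x t) k • a k) 2 y =
      (-(Complex.I / 2)) • ((M₀ + polSum p a 1 y) * polSum p b 2 y -
        polSum p b 2 y * (M₀ + polSum p a 1 y)) := by
    intro y
    have h1 : MatDeriv (fun s => M₀ + ratV (A s) (x s) y)
        ((-(Complex.I / 2)) • ((M₀ + polSum p a 1 y) * polSum p b 2 y -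
        polSum p b 2 y * (M₀ + polSum p a 1 y))) I t := fun i j => by
      have h4 : HasDerivWithinAt (fun s => (M₀ + ratV (A s) (x s) y) i j)
          (((-(Complex.I / 2)) • ((M₀ + ratV (A t) (x t) y) * D t y -
            D t y * (M₀ + ratV (A t) (x t) y))) i j) I t := heq t ht y i j
      have h5 : ratV (A t) (x t) y = polSum p a 1 y := by rw [ratV_eq_ratC, ratC_eq_polSum]
      rwa [hDt, h5] at h4
    have hne : ∀ k, (y : ℂ) ≠ p k := fun k hk =>
      ofReal_notMem_allPoles hx y ⟨k, hk.symm⟩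
    have h2 := (MatDeriv.const M₀ (I := I) (s := t)).add (MatDeriv.sum fun k =>
      MatDeriv.smul (hasDerivWithinAt_inv_sub (hasDerivWithinAt_const t I (y : ℂ))
        (h.hasDerivWithinAt_allPoles ht k) (hne k)) (h.matDeriv_allResidues ht k))
    have h3 := h1.unique hI (by
      convert! h2 using 1
      funext s
      rw [ratV_eq_ratC, ratC_eq_polSum, polSum]
      simp)
    rw [h3, zero_add]
    simp only [polSum, ← Finset.sum_add_distrib]
    refine Finset.sum_congr rfl fun k _ => ?_
    change _ = _ • a k + (y - p k)⁻¹ • _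
    module
  intro z hz
  ext i j
  have hd : ∀ c n k l, DifferentiableOn ℂ (fun z => polSum p c n z k l) (range p)ᶜ :=
    fun c n k l => differentiableOn_polSum p c n k l
  have hd1 : ∀ k l, DifferentiableOn ℂ (fun z => (M₀ + polSum p a 1 z) k l) (range p)ᶜ :=
    fun k l => (differentiableOn_const _).add (hd _ _ k l)
  refine sub_eq_zero.1 (eq_zero_of_real_eq_zero (finite_range p) (f := fun z =>
      (polSum p (allResidues (residueDeriv I A t)) 1 z +
        polSum p (fun k => allVelocities (poleDeriv I x t) k • a k) 2 z) i j -
      ((-(Complex.I / 2)) • ((M₀ + polSum p a 1 z) * polSum p b 2 z -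
        polSum p b 2 z * (M₀ + polSum p a 1 z))) i j)
    (ofReal_notMem_allPoles hx) ?_ (fun y => ?_) z hz)
  · simp only [Matrix.smul_apply, Matrix.sub_apply, smul_eq_mul]
    refine ((hd _ _ i j).add (hd _ _ i j)).sub (DifferentiableOn.const_mul ?_ _)
    refine DifferentiableOn.sub ?_ ?_
    · simp only [Matrix.mul_apply]
      exact DifferentiableOn.fun_sum fun k _ => (hd1 i k).mul (hd _ _ k j)
    · simp only [Matrix.mul_apply]
      exact DifferentiableOn.fun_sum fun k _ => (hd _ _ i k).mul (hd1 k j)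
  · simp only [hreal y, sub_self]

end IsRationalSolution

/-! ### The Lax equation -/

/-- A determinant is stationary along a Lax equation: conjugation by `1 + h B` has the same
first-order effect. -/
theorem hasDerivWithinAt_det_of_lax {n : Type*} [Fintype n] [DecidableEq n]
    {Y : ℝ → Matrix n n ℂ} {B : Matrix n n ℂ} {I : Set ℝ} {s : ℝ}
    (hY : MatDeriv Y (B * Y s - Y s * B) I s) :
    HasDerivWithinAt (fun t => (Y t).det) 0 I s := by
  let φ : (n → n → ℂ) → ℂ := fun Z => (Matrix.of Z).det
  have hφ : Differentiable ℝ φ := by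
    simp only [φ, Matrix.det_apply, Matrix.of_apply]
    fun_prop
  have h1 : ∀ {Z : ℝ → Matrix n n ℂ} {Z' : Matrix n n ℂ} {J : Set ℝ} {r : ℝ},
      MatDeriv Z Z' J r →
      HasDerivWithinAt (fun t => (Z t).det) (fderiv ℝ φ (Z r) Z') J r := fun {Z Z' J r} hZ => by
    have h2 : HasDerivWithinAt (fun t => (Z t : n → n → ℂ)) Z' J r :=
      hasDerivWithinAt_pi.2 fun i => hasDerivWithinAt_pi.2 fun j => hZ i j
    exact ((hφ (Z r)).hasFDerivAt).comp_hasDerivWithinAt r h2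
  have h3 := h1 hY
  have hid : HasDerivWithinAt (fun h : ℝ => (h : ℂ)) 1 univ 0 :=
    (Complex.ofRealCLM.hasDerivAt (x := (0 : ℝ))).hasDerivWithinAt
  have h4 : MatDeriv (fun h : ℝ => (1 + (h : ℂ) • B) * Y s * (1 - (h : ℂ) • B))
      (B * Y s - Y s * B) univ 0 := by
    have hB : MatDeriv (fun h : ℝ => (h : ℂ) • B) B univ 0 := by
      simpa using MatDeriv.smul hid (MatDeriv.const B)
    have h5 := (((MatDeriv.const (1 : Matrix n n ℂ)).add hB).mul (MatDeriv.const (Y s))).mul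
      ((MatDeriv.const (1 : Matrix n n ℂ)).sub hB)
    simpa [sub_eq_add_neg] using h5
  have h6 := h1 h4
  have h7 : HasDerivWithinAt (fun h : ℝ => (h : ℂ) ^ 2) 0 univ 0 := by
    simpa using hid.fun_pow 2
  have h8 : MatDeriv (fun h : ℝ => ((1 : Matrix n n ℂ) - ((h : ℂ) ^ 2) • (B * B)) * Y s)
      0 univ 0 := by
    simpa using ((MatDeriv.const (1 : Matrix n n ℂ)).sub
      (MatDeriv.smul h7 (MatDeriv.const (B * B)))).mul (MatDeriv.const (Y s))
  have h9 := h1 h8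
  have h10 : (fun h : ℝ => ((1 + (h : ℂ) • B) * Y s * (1 - (h : ℂ) • B)).det) =
      fun h : ℝ => (((1 : Matrix n n ℂ) - ((h : ℂ) ^ 2) • (B * B)) * Y s).det := by
    funext h
    have h11 : (1 : Matrix n n ℂ) - ((h : ℂ) ^ 2) • (B * B) =
        (1 + (h : ℂ) • B) * (1 - (h : ℂ) • B) := by
      simp only [add_mul, mul_sub, one_mul, mul_one, Matrix.smul_mul, Matrix.mul_smul, smul_smul,
        pow_two]
      abel
    rw [h11]
    simp only [Matrix.det_mul]
    ring
  have h12 : fderiv ℝ φ (Y s) (B * Y s - Y s * B) = 0 := by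
    have h13 := (uniqueDiffWithinAt_univ (𝕜 := ℝ) (x := (0 : ℝ))).eq_deriv _ h6 (h10 ▸ h9)
    have h14 := h13.trans (map_zero _)
    simpa using h14
  rwa [h12] at h3

/-- The data of a solution of the spin Calogero–Moser system at one instant `s`: the derivatives of
the poles `x`, of the spins `u`, `v` and of the momenta `ℓ` within the set of times `I`.
The spins evolve by the matrix `B`, whose diagonal is left free by the normalization of the
spins. -/
structure IsSpinFlow {N : ℕ} (I : Set ℝ) (x : ℝ → Fin N → ℂ) (u v : ℝ → Fin N → Fin 2 → ℂ)
    (ℓ : ℝ → Fin N → ℂ) (B : Matrix (Fin N) (Fin N) ℂ) (s : ℝ) : Prop where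
  injective : Function.Injective (x s)
  isotropic : ∀ j, v s j ⬝ᵥ u s j = 0
  offDiag : ∀ j k, j ≠ k → B j k = -((x s j - x s k)⁻¹ ^ 2 * (v s j ⬝ᵥ u s k))
  pole : ∀ j, HasDerivWithinAt (fun t => x t j) (-ℓ s j) I s
  left : MatDeriv (fun t => Matrix.of (v t)) (B * Matrix.of (v s)) I s
  right : MatDeriv (fun t => (Matrix.of (u t))ᵀ) (-((Matrix.of (u s))ᵀ * B)) I s
  momentum : ∀ j, HasDerivWithinAt (fun t => ℓ t j)
    (2 * ∑ k, (x s j - x s k)⁻¹ ^ 3 * ((v s j ⬝ᵥ u s k) * (v s k ⬝ᵥ u s j))) I s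

namespace IsSpinFlow

variable {N : ℕ} {I : Set ℝ} {x : ℝ → Fin N → ℂ} {u v : ℝ → Fin N → Fin 2 → ℂ}
  {ℓ : ℝ → Fin N → ℂ} {B : Matrix (Fin N) (Fin N) ℂ} {s : ℝ}

theorem sub_ne_zero (h : IsSpinFlow I x u v ℓ B s) {j k : Fin N} (hjk : j ≠ k) :
    x s j - x s k ≠ 0 := _root_.sub_ne_zero.2 (h.injective.ne hjk)

theorem matDeriv_gram (h : IsSpinFlow I x u v ℓ B s) :
    MatDeriv (fun t => Matrix.of (v t) * (Matrix.of (u t))ᵀ)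
      (B * (Matrix.of (v s) * (Matrix.of (u s))ᵀ) - Matrix.of (v s) * (Matrix.of (u s))ᵀ * B)
      I s := by
  convert! h.left.mul h.right using 1
  simp only [Matrix.mul_neg, Matrix.mul_assoc, sub_eq_add_neg]

theorem commutator_pole (h : IsSpinFlow I x u v ℓ B s) :
    B * Matrix.diagonal (x s) - Matrix.diagonal (x s) * B =
      laxMatrix (x s) (u s) (v s) (ℓ s) - Matrix.diagonal (ℓ s) := by
  ext j k
  simp only [Matrix.sub_apply, Matrix.mul_diagonal, Matrix.diagonal_mul, laxMatrix,
    Matrix.add_apply, Matrix.of_apply, add_sub_cancel_left]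
  by_cases hjk : j = k
  · subst hjk
    simp [mul_comm]
  · rw [h.offDiag j k hjk]
    have := h.sub_ne_zero hjk
    field_simp
    ring

theorem commutator_lax (h : IsSpinFlow I x u v ℓ B s) :
    Matrix.diagonal (x s) * laxMatrix (x s) (u s) (v s) (ℓ s) -
      laxMatrix (x s) (u s) (v s) (ℓ s) * Matrix.diagonal (x s) =
      Matrix.of (v s) * (Matrix.of (u s))ᵀ := by
  ext j k
  have hg : (Matrix.of (v s) * (Matrix.of (u s))ᵀ) j k = v s j ⬝ᵥ u s k := rfl
  rw [hg]
  simp only [Matrix.sub_apply, Matrix.mul_diagonal, Matrix.diagonal_mul, laxMatrix,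
    Matrix.add_apply, Matrix.of_apply]
  by_cases hjk : j = k
  · subst hjk
    rw [h.isotropic]
    ring
  · have := h.sub_ne_zero hjk
    rw [Matrix.diagonal_apply_ne _ hjk]
    field_simp
    ring

theorem matDeriv_lax (h : IsSpinFlow I x u v ℓ B s) :
    MatDeriv (fun t => laxMatrix (x t) (u t) (v t) (ℓ t))
      (B * laxMatrix (x s) (u s) (v s) (ℓ s) - laxMatrix (x s) (u s) (v s) (ℓ s) * B) I s := by
  have hcomm : ∀ {X B L D Q : Matrix (Fin N) (Fin N) ℂ}, B * X - X * B = L - D →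
      X * L - L * X = Q → X * (B * L - L * B) - (B * L - L * B) * X =
        B * Q - Q * B + (D * L - L * D) := by
    intro X B L D Q h1 h2
    subst h2
    have h3 : D = L - (B * X - X * B) := by rw [h1]; abel
    subst h3
    noncomm_ring
  intro j k
  by_cases hjk : j = k
  · subst hjk
    convert! h.momentum j using 1
    · funext t
      simp [laxMatrix]
    · simp only [Matrix.sub_apply, Matrix.mul_apply, ← Finset.sum_sub_distrib, Finset.mul_sum]
      refine Finset.sum_congr rfl fun k _ => ?_
      by_cases hjk : j = k
      · subst hjk
        simp [mul_comm]
      · rw [h.offDiag j k hjk, h.offDiag k j (Ne.symm hjk)]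
        simp only [laxMatrix, Matrix.add_apply, Matrix.of_apply, Matrix.diagonal_apply_ne _ hjk,
          Matrix.diagonal_apply_ne _ (Ne.symm hjk)]
        have h1 := h.sub_ne_zero hjk
        have h2 : (x s k - x s j)⁻¹ = -(x s j - x s k)⁻¹ := by rw [← neg_sub, inv_neg]
        rw [h2]
        ring
  · have h1 := h.sub_ne_zero hjk
    have h2 := (hasDerivWithinAt_inv_sub (h.pole j) (h.pole k) (h.injective.ne hjk)).mul
      (h.matDeriv_gram j k)
    have h3 := congrFun (congrFun (hcomm h.commutator_pole h.commutator_lax) j) k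
    convert! h2 using 1
    · funext t
      simp only [laxMatrix, Matrix.add_apply, Matrix.of_apply, Matrix.diagonal_apply_ne _ hjk,
        zero_add]
      rfl
    · rw [Matrix.sub_apply, Matrix.diagonal_mul, Matrix.mul_diagonal, Matrix.add_apply,
        Matrix.sub_apply (Matrix.diagonal _ * _), Matrix.diagonal_mul, Matrix.mul_diagonal] at h3
      have h4 : laxMatrix (x s) (u s) (v s) (ℓ s) j k =
          (x s j - x s k)⁻¹ * (Matrix.of (v s) * (Matrix.of (u s))ᵀ) j k := by
        simp only [laxMatrix, Matrix.add_apply, Matrix.of_apply, Matrix.diagonal_apply_ne _ hjk,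
          zero_add]
        rfl
      have h5 : (x s j - x s k) * (x s j - x s k)⁻¹ = 1 := mul_inv_cancel₀ h1
      rw [h4] at h3
      refine mul_left_cancel₀ h1 ?_
      linear_combination h3 + (-ℓ s j + ℓ s k) * (x s j - x s k)⁻¹ *
        (Matrix.of (v s) * (Matrix.of (u s))ᵀ) j k * h5 -
        (B * (Matrix.of (v s) * (Matrix.of (u s))ᵀ) -
          Matrix.of (v s) * (Matrix.of (u s))ᵀ * B) j k * h5

/-- The pencil, propagated backwards from the time `τ`, and perturbed by a coupling of the spins,
obeys the Lax equation. -/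
theorem matDeriv_pencil (h : IsSpinFlow I x u v ℓ B s) (τ : ℝ) (y : ℂ) (E : Mat2) :
    MatDeriv (fun t => pencil (x t) (u t) (v t) (ℓ t) ((τ : ℂ) - (t : ℂ)) y +
        Matrix.of (v t) * E * (Matrix.of (u t))ᵀ)
      (B * (pencil (x s) (u s) (v s) (ℓ s) ((τ : ℂ) - (s : ℂ)) y +
        Matrix.of (v s) * E * (Matrix.of (u s))ᵀ) -
        (pencil (x s) (u s) (v s) (ℓ s) ((τ : ℂ) - (s : ℂ)) y +
        Matrix.of (v s) * E * (Matrix.of (u s))ᵀ) * B) I s := by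
  have hX : MatDeriv (fun t => Matrix.diagonal (x t)) (Matrix.diagonal fun j => -ℓ s j) I s := by
    intro j k
    by_cases hjk : j = k
    · subst hjk
      simpa using h.pole j
    · simpa [Matrix.diagonal_apply_ne _ hjk] using hasDerivWithinAt_const s I (0 : ℂ)
  have hτ : HasDerivWithinAt (fun t : ℝ => (τ : ℂ) - (t : ℂ)) (-1) I s := by
    simpa using (Complex.ofRealCLM.hasDerivAt (x := s)).hasDerivWithinAt.const_sub (τ : ℂ)
  have h1 := ((hX.sub (MatDeriv.smul hτ h.matDeriv_lax)).sub
    (MatDeriv.const (y • (1 : Matrix (Fin N) (Fin N) ℂ)))).add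
      ((h.left.mul (MatDeriv.const E)).mul h.right)
  convert! h1 using 1
  have h2 := h.commutator_pole
  have h3 : (Matrix.diagonal fun j => -ℓ s j) = -Matrix.diagonal (ℓ s) := by
    rw [Matrix.diagonal_neg]
  rw [h3, ← sub_eq_zero]
  simp only [pencil, mul_add, add_mul, mul_sub, sub_mul, Matrix.smul_mul, Matrix.mul_smul,
    mul_one, one_mul, Matrix.mul_zero, add_zero, Matrix.mul_neg, Matrix.mul_assoc, smul_sub]
  have h4 : B * Matrix.diagonal (x s) = Matrix.diagonal (x s) * B +
      (laxMatrix (x s) (u s) (v s) (ℓ s) - Matrix.diagonal (ℓ s)) := by rw [← h2]; abel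
  rw [h4]
  module

end IsSpinFlow

/-! ### The spin Calogero–Moser system -/

/-- The algebra behind the second-order equation for the poles: the derivative of `A B`, where
`A B = ξ A`, computed from the derivatives of `A` and `B`. -/
theorem derivative_residue_mul_regular {A B C E K E' : Mat2} {ξ : ℂ} (h0 : A * A = 0)
    (h1 : A * B = ξ • A) (h3 : A * E + E * A = B * C + C * B) :
    (K * A - A * K) * B + A * ((-(1 / 2 : ℂ)) • (E * A - A * E) -
        (A * (E - (2 : ℂ) • E') - (E - (2 : ℂ) • E') * A) +
        (1 / 2 : ℂ) • (B * (C - (2 : ℂ) • K) - (C - (2 : ℂ) • K) * B) - ξ • C) =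
      ξ • (K * A - A * K) - (2 : ℂ) • (A * E' * A) := by
  have h4 : A * E * A = ξ • (A * C) + A * C * B := by
    have h5 := congrArg (A * ·) h3
    simp only [mul_add, ← mul_assoc, h0, zero_mul, h1, Matrix.smul_mul, zero_add] at h5
    exact h5
  simp only [mul_add, mul_sub, sub_mul, Matrix.mul_smul, Matrix.smul_mul, ← mul_assoc, h0, zero_mul,
    h1]
  rw [mul_assoc K A B, h1, Matrix.mul_smul, h4]
  module

namespace IsRationalSolution

variable {N : ℕ} {I : Set ℝ} {M₀ : Mat2} {A : ℝ → Fin N → Mat2} {x : ℝ → Fin N → ℂ}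

/-- The equations of motion: the Laurent coefficients of the half-wave maps equation at `x_j`.
In the second one only the poles in the upper half-plane act on the residue. -/
theorem laurent_coefficients (h : IsRationalSolution I M₀ A x) {t : ℝ} (ht : t ∈ I)
    (hI : UniqueDiffWithinAt ℝ I t) (j : Fin N) :
    poleDeriv I x t j • A t j = (-(1 / 2) : ℂ) • ((M₀ + ratC (A t) (x t) (x t j)) * A t j -
      A t j * (M₀ + ratC (A t) (x t) (x t j))) ∧
    residueDeriv I A t j = polSum (x t) (A t) 2 (x t j) * A t j -
      A t j * polSum (x t) (A t) 2 (x t j) ∧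
    polSum (allPoles (x t)) (allResidues (residueDeriv I A t)) 1 (x t j) +
      polSum (allPoles (x t)) (fun k => allVelocities (poleDeriv I x t) k • allResidues (A t) k) 2
        (x t j) =
      (-(1 / 2) : ℂ) • (polSum (allPoles (x t)) (allResidues (A t)) 3 (x t j) * A t j -
          A t j * polSum (allPoles (x t)) (allResidues (A t)) 3 (x t j)) -
        (A t j * (polSum (allPoles (x t)) (allResidues (A t)) 3 (x t j) -
            (2 : ℂ) • polSum (x t) (A t) 3 (x t j)) -
          (polSum (allPoles (x t)) (allResidues (A t)) 3 (x t j) -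
            (2 : ℂ) • polSum (x t) (A t) 3 (x t j)) * A t j) +
        (1 / 2 : ℂ) • ((M₀ + ratC (A t) (x t) (x t j)) *
            (polSum (allPoles (x t)) (allResidues (A t)) 2 (x t j) -
              (2 : ℂ) • polSum (x t) (A t) 2 (x t j)) -
          (polSum (allPoles (x t)) (allResidues (A t)) 2 (x t j) -
            (2 : ℂ) • polSum (x t) (A t) 2 (x t j)) * (M₀ + ratC (A t) (x t) (x t j))) := by
  obtain ⟨h1, h2, h3⟩ := laurent_commutator
    (allPoles_injective (h.im_pos t ht) (h.pole_injective t ht))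
    (fun _ => rfl) (fun _ => rfl) (h.equation_complex ht hI) (Sum.inl j)
  have hp : allPoles (x t) (Sum.inl j) = x t j := rfl
  have ha : allResidues (A t) (Sum.inl j) = A t j := rfl
  have hP : allResidues (residueDeriv I A t) (Sum.inl j) = residueDeriv I A t j := rfl
  have hξ : allVelocities (poleDeriv I x t) (Sum.inl j) = poleDeriv I x t j := rfl
  have hβ : -(Complex.I / 2) * nablaWeight N (Sum.inl j) = -(1 / 2) := by
    change -(Complex.I / 2) * -Complex.I = -(1 / 2)
    linear_combination (1 / 2 : ℂ) * Complex.I_sq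
  have hκ : 2 * -(Complex.I / 2) * Complex.I = 1 := by linear_combination -Complex.I_sq
  have hκ' : -(Complex.I / 2) * Complex.I = 1 / 2 := by
    linear_combination (-1 / 2 : ℂ) * Complex.I_sq
  rw [hp, ha, hξ, hβ, ← ratC_eq_polSum] at h1
  rw [hp, ha, hP, hβ, polSum_nablaWeight] at h2
  rw [hp, ha, hβ, polSum_nablaWeight, polSum_nablaWeight] at h3
  refine ⟨h1, ?_, ?_⟩
  · rw [h2]
    simp only [Matrix.mul_smul, Matrix.smul_mul, ← smul_sub, smul_smul, hκ', mul_sub, sub_mul]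
    module
  · rw [h3, ratC_eq_polSum]
    simp only [Matrix.mul_smul, Matrix.smul_mul, ← smul_sub, smul_smul, hκ', hκ, one_smul]

theorem residue_mul_regular (h : IsRationalSolution I M₀ A x) {t : ℝ} (ht : t ∈ I)
    (hI : UniqueDiffWithinAt ℝ I t) (j : Fin N) :
    A t j * (M₀ + ratC (A t) (x t) (x t j)) = poleDeriv I x t j • A t j := by
  have h1 := (h.laurent_coefficients ht hI j).1
  have h2 := h.residue_anticomm ht j
  rw [h1]
  linear_combination (norm := module) (1 / 2 : ℂ) • h2

/-- The derivative of the regular part of the symbol along the moving pole `x_j`. -/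
theorem matDeriv_regular (h : IsRationalSolution I M₀ A x) {t : ℝ} (ht : t ∈ I) (j : Fin N) :
    MatDeriv (fun t => M₀ + ratC (A t) (x t) (x t j))
      (polSum (allPoles (x t)) (allResidues (residueDeriv I A t)) 1 (x t j) +
        polSum (allPoles (x t)) (fun k => allVelocities (poleDeriv I x t) k • allResidues (A t) k) 2
          (x t j) -
        poleDeriv I x t j • polSum (allPoles (x t)) (allResidues (A t)) 2 (x t j)) I t := by
  have hp := allPoles_injective (h.im_pos t ht) (h.pole_injective t ht)
  have h1 : ∀ k, MatDeriv (fun t => (x t j - allPoles (x t) k)⁻¹ ^ 1 • allResidues (A t) k)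
      ((x t j - allPoles (x t) k)⁻¹ ^ 1 • allResidues (residueDeriv I A t) k +
        (x t j - allPoles (x t) k)⁻¹ ^ 2 • allVelocities (poleDeriv I x t) k • allResidues (A t) k -
        poleDeriv I x t j • (x t j - allPoles (x t) k)⁻¹ ^ 2 • allResidues (A t) k) I t := by
    intro k
    by_cases hk : k = Sum.inl j
    · -- The own term of the pole is identically zero, because `0⁻¹ = 0`.
      subst hk
      simpa [allPoles] using MatDeriv.const (0 : Mat2)
    · have hne : x t j ≠ allPoles (x t) k := fun e => hk (hp (a₂ := Sum.inl j) e.symm)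
      convert! MatDeriv.smul (hasDerivWithinAt_inv_sub (h.hasDerivWithinAt_pole ht j)
        (h.hasDerivWithinAt_allPoles ht k) hne) (h.matDeriv_allResidues ht k) using 1
      · simp only [pow_one]
      · module
  have h2 := (MatDeriv.const M₀ (I := I) (s := t)).add (MatDeriv.sum h1)
  convert! h2 using 1
  · simp only [ratC_eq_polSum, polSum]
  · simp only [polSum, Finset.sum_sub_distrib, Finset.sum_add_distrib, Finset.smul_sum, zero_add]

theorem matDeriv_residue_mul_regular (h : IsRationalSolution I M₀ A x) {t : ℝ} (ht : t ∈ I)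
    (hI : UniqueDiffWithinAt ℝ I t) (j : Fin N) :
    MatDeriv (fun t => A t j * (M₀ + ratC (A t) (x t) (x t j)))
      (poleDeriv I x t j • residueDeriv I A t j -
        (2 : ℂ) • (A t j * polSum (x t) (A t) 3 (x t j) * A t j)) I t := by
  obtain ⟨-, h2, h3⟩ := h.laurent_coefficients ht hI j
  have h4 := (h.matDeriv_residue ht j).mul (h.matDeriv_regular ht j)
  have h5 := h.residue_mul_regular ht hI j
  have h7 := (laurent_sq (allPoles_injective (h.im_pos t ht) (h.pole_injective t ht))
    (h.sq_eq_one ht) (Sum.inl j)).2.2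
  rw [← ratC_eq_polSum] at h7
  change A t j * polSum (allPoles (x t)) (allResidues (A t)) 3 (x t j) +
    polSum (allPoles (x t)) (allResidues (A t)) 3 (x t j) * A t j =
    (M₀ + ratC (A t) (x t) (x t j)) * polSum (allPoles (x t)) (allResidues (A t)) 2 (x t j) +
      polSum (allPoles (x t)) (allResidues (A t)) 2 (x t j) *
        (M₀ + ratC (A t) (x t) (x t j)) at h7
  rw [h2]
  rw [h3, h2, derivative_residue_mul_regular (h.residue_sq ht j) h5 h7] at h4
  exact h4

end IsRationalSolution

/-! ### Factorization of the residues -/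

/-- The column factor `u_j` of a residue of rank one with nonzero entry `(α_j, β_j)`. -/
def pivotCol {N : ℕ} (A : Fin N → Mat2) (β : Fin N → Fin 2) (j : Fin N) (k : Fin 2) : ℂ :=
  A j k (β j)

/-- The row factor `v_j` of a residue of rank one with nonzero entry `(α_j, β_j)`. -/
noncomputable def pivotRow {N : ℕ} (A : Fin N → Mat2) (α β : Fin N → Fin 2) (j : Fin N)
    (l : Fin 2) : ℂ :=
  (A j (α j) (β j))⁻¹ * A j (α j) l

/-- The eigenvalue of the regular part of the symbol at `x_j` on the column `u_j`, computed from the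
entry `(α_j, β_j)` of its product with the residue. -/
noncomputable def pivotMomentum {N : ℕ} (M₀ : Mat2) (A : Fin N → Mat2) (x : Fin N → ℂ)
    (α β : Fin N → Fin 2) (j : Fin N) : ℂ :=
  -((A j (α j) (β j))⁻¹ * (A j * (M₀ + ratC A x (x j))) (α j) (β j))

/-- A nilpotent `2 × 2` matrix has vanishing minors. -/
theorem mul_apply_comm_of_sq_eq_zero {A : Mat2} (h : A * A = 0) (k l a b : Fin 2) :
    A k l * A a b = A k b * A a l := by
  have h1 : A.det = 0 := by
    have h2 := congrArg Matrix.det h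
    rw [Matrix.det_mul, Matrix.det_zero] at h2
    exact mul_self_eq_zero.1 h2
  rw [Matrix.det_fin_two] at h1
  fin_cases k <;> fin_cases l <;> fin_cases a <;> fin_cases b <;> simp <;>
    first | ring1 | linear_combination h1 | linear_combination -h1

theorem isSpinFactorization_pivot {N : ℕ} {M₀ : Mat2} {A : Fin N → Mat2} {x : Fin N → ℂ}
    {α β : Fin N → Fin 2} (hsq : ∀ j, A j * A j = 0)
    (hanti : ∀ j, A j * (M₀ + ratC A x (x j)) + (M₀ + ratC A x (x j)) * A j = 0)
    (hpiv : ∀ j, A j (α j) (β j) ≠ 0) :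
    IsSpinFactorization M₀ A x (pivotCol A β) (pivotRow A α β) (pivotMomentum M₀ A x α β) where
  factor j := by
    ext k l
    rw [Matrix.vecMulVec_apply, pivotCol, pivotRow]
    have h1 := mul_apply_comm_of_sq_eq_zero (hsq j) k l (α j) (β j)
    have h2 := hpiv j
    field_simp
    exact h1
  isotropic j := by
    have h1 := congrFun (congrFun (hsq j) (α j)) (β j)
    simp only [dotProduct, pivotCol, pivotRow, mul_assoc, ← Finset.mul_sum]
    rw [← Matrix.mul_apply, h1]
    simp
  eigen j := by
    ext k
    have h1 : (M₀ + ratC A x (x j)) * A j = -(A j * (M₀ + ratC A x (x j))) :=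
      eq_neg_of_add_eq_zero_right (hanti j)
    have h2 : ((M₀ + ratC A x (x j)) *ᵥ pivotCol A β j) k =
        ((M₀ + ratC A x (x j)) * A j) k (β j) := rfl
    rw [h2, h1]
    simp only [Pi.smul_apply, smul_eq_mul, pivotCol, pivotMomentum, Matrix.neg_apply,
      Matrix.mul_apply]
    have h3 := hpiv j
    rw [neg_mul, neg_inj, mul_assoc, eq_inv_mul_iff_mul_eq₀ h3, Finset.mul_sum, Finset.sum_mul]
    refine Finset.sum_congr rfl fun m _ => ?_
    have h4 := mul_apply_comm_of_sq_eq_zero (hsq j) k m (α j) (β j)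
    linear_combination (M₀ + ratC A x (x j)) m (β j) * h4

theorem exists_isSpinFactorization {N : ℕ} {M₀ : Mat2} {A : Fin N → Mat2} {x : Fin N → ℂ}
    (hsq : ∀ j, A j * A j = 0)
    (hanti : ∀ j, A j * (M₀ + ratC A x (x j)) + (M₀ + ratC A x (x j)) * A j = 0)
    (hA : ∀ j, A j ≠ 0) : ∃ u v ℓ, IsSpinFactorization M₀ A x u v ℓ := by
  have h1 : ∀ j, ∃ α β, A j α β ≠ 0 := fun j => by
    by_contra! hc
    exact hA j (Matrix.ext hc)
  choose α β h2 using h1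
  exact ⟨_, _, _, isSpinFactorization_pivot hsq hanti h2⟩

namespace IsSpinFactorization

variable {N : ℕ} {M₀ : Mat2} {A : Fin N → Mat2} {x : Fin N → ℂ} {u v u' v' : Fin N → Fin 2 → ℂ}
  {ℓ ℓ' : Fin N → ℂ}

/-- Two factorizations differ by a rescaling of the factors. -/
theorem exists_gauge (h : IsSpinFactorization M₀ A x u v ℓ)
    (h' : IsSpinFactorization M₀ A x u' v' ℓ') (hA : ∀ j, A j ≠ 0) (j : Fin N) :
    ∃ c : ℂ, c ≠ 0 ∧ u' j = c • u j ∧ v j = c • v' j ∧ ℓ' j = ℓ j := by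
  obtain ⟨a, b, hab⟩ : ∃ a b, A j a b ≠ 0 := by
    by_contra! hc
    exact hA j (Matrix.ext hc)
  have e : ∀ k l, A j k l = u j k * v j l := fun k l => by
    rw [h.factor j, Matrix.vecMulVec_apply]
  have e' : ∀ k l, A j k l = u' j k * v' j l := fun k l => by
    rw [h'.factor j, Matrix.vecMulVec_apply]
  have h1 := hab
  have h2 := hab
  rw [e] at h1
  rw [e'] at h2
  obtain ⟨hua, hvb⟩ := mul_ne_zero_iff.1 h1
  obtain ⟨hua', hvb'⟩ := mul_ne_zero_iff.1 h2
  have e3 : ∀ k l, u j k * v j l = u' j k * v' j l := fun k l => by rw [← e, ← e']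
  have hu : u' j = (v j b / v' j b) • u j := by
    ext k
    simp only [Pi.smul_apply, smul_eq_mul]
    field_simp
    linear_combination -e3 k b
  have hv : v j = (v j b / v' j b) • v' j := by
    ext l
    simp only [Pi.smul_apply, smul_eq_mul]
    field_simp
    refine mul_left_cancel₀ hua ?_
    linear_combination v' j b * e3 a l - v' j l * e3 a b
  have hc : v j b / v' j b ≠ 0 := div_ne_zero hvb hvb'
  refine ⟨_, hc, hu, hv, ?_⟩
  have h3 := h'.eigen j
  rw [hu, Matrix.mulVec_smul, h.eigen j] at h3
  have h4 := congrFun h3 a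
  simp only [Pi.smul_apply, smul_eq_mul] at h4
  exact (mul_right_cancel₀ (mul_ne_zero hc hua) (by linear_combination h4)).symm

theorem det_pencil_eq (h : IsSpinFactorization M₀ A x u v ℓ)
    (h' : IsSpinFactorization M₀ A x u' v' ℓ') (hA : ∀ j, A j ≠ 0) (t y : ℂ) (E : Mat2) :
    (pencil x u v ℓ t y + Matrix.of v * E * (Matrix.of u)ᵀ).det =
      (pencil x u' v' ℓ' t y + Matrix.of v' * E * (Matrix.of u')ᵀ).det := by
  choose c hc hu hv hℓ using h.exists_gauge h' hA
  have hℓ' : ℓ' = ℓ := funext hℓ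
  subst hℓ'
  have hD : (Matrix.diagonal c).det ≠ 0 := by
    rw [Matrix.det_diagonal]
    exact Finset.prod_ne_zero_iff.2 fun j _ => hc j
  have hV : Matrix.of v = Matrix.diagonal c * Matrix.of v' := by
    ext j k
    rw [Matrix.diagonal_mul, Matrix.of_apply, hv]
    rfl
  have hU : (Matrix.of u')ᵀ = (Matrix.of u)ᵀ * Matrix.diagonal c := by
    ext j k
    rw [Matrix.mul_diagonal, Matrix.transpose_apply, Matrix.of_apply, hu, mul_comm]
    rfl
  have hP : pencil x u v ℓ' t y * Matrix.diagonal c =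
      Matrix.diagonal c * pencil x u' v' ℓ' t y := by
    ext j k
    simp only [Matrix.diagonal_mul, Matrix.mul_diagonal, pencil, laxMatrix, Matrix.sub_apply,
      Matrix.smul_apply, Matrix.add_apply, Matrix.of_apply, hu k, hv j, smul_dotProduct,
      dotProduct_smul, smul_eq_mul]
    by_cases hjk : j = k
    · subst hjk
      simp only [Matrix.diagonal_apply_eq, Matrix.one_apply_eq]
      ring
    · simp only [Matrix.diagonal_apply_ne _ hjk, Matrix.one_apply_ne hjk]
      ring
  refine mul_right_cancel₀ hD ?_
  rw [← Matrix.det_mul, mul_comm, ← Matrix.det_mul, add_mul, mul_add, hP, hV, hU]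
  simp only [Matrix.mul_assoc]

end IsSpinFactorization

/-! ### Conservation of the determinant -/

theorem polSum_mulVec {N : ℕ} (x : Fin N → ℂ) (u v : Fin N → Fin 2 → ℂ) (n : ℕ) (z : ℂ)
    (w : Fin 2 → ℂ) :
    polSum x (fun k => Matrix.vecMulVec (u k) (v k)) n z *ᵥ w =
      ∑ k, ((z - x k)⁻¹ ^ n * (v k ⬝ᵥ w)) • u k := by
  rw [polSum, Matrix.sum_mulVec]
  refine Finset.sum_congr rfl fun k _ => ?_
  rw [Matrix.smul_mulVec, Matrix.vecMulVec_mulVec, op_smul_eq_smul, smul_smul]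

theorem vecMul_polSum {N : ℕ} (x : Fin N → ℂ) (u v : Fin N → Fin 2 → ℂ) (n : ℕ) (z : ℂ)
    (w : Fin 2 → ℂ) :
    w ᵥ* polSum x (fun k => Matrix.vecMulVec (u k) (v k)) n z =
      ∑ k, ((z - x k)⁻¹ ^ n * (w ⬝ᵥ u k)) • v k := by
  rw [polSum, Matrix.vecMul_sum]
  refine Finset.sum_congr rfl fun k _ => ?_
  rw [Matrix.vecMul_smul, Matrix.vecMul_vecMulVec, smul_smul]

/-- The generator of the Lax equation in the gauge in which the entry `β_j` of the row `v_j` is `1`;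
this normalization determines the diagonal. -/
noncomputable def laxGenerator {N : ℕ} (x : Fin N → ℂ) (u v : Fin N → Fin 2 → ℂ)
    (β : Fin N → Fin 2) : Matrix (Fin N) (Fin N) ℂ :=
  Matrix.diagonal (fun j => ∑ k, (x j - x k)⁻¹ ^ 2 * (v j ⬝ᵥ u k) * v k (β j)) -
    Matrix.of fun j k => (x j - x k)⁻¹ ^ 2 * (v j ⬝ᵥ u k)

theorem laxGenerator_mul_apply {N : ℕ} (x : Fin N → ℂ) (u v : Fin N → Fin 2 → ℂ)
    (β : Fin N → Fin 2) (W : Matrix (Fin N) (Fin 2) ℂ) (j : Fin N) (l : Fin 2) :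
    (laxGenerator x u v β * W) j l =
      (∑ k, (x j - x k)⁻¹ ^ 2 * (v j ⬝ᵥ u k) * v k (β j)) * W j l -
        ∑ k, (x j - x k)⁻¹ ^ 2 * (v j ⬝ᵥ u k) * W k l := by
  rw [laxGenerator, Matrix.sub_mul, Matrix.sub_apply, Matrix.diagonal_mul, Matrix.mul_apply]
  rfl

theorem mul_laxGenerator_apply {N : ℕ} (x : Fin N → ℂ) (u v : Fin N → Fin 2 → ℂ)
    (β : Fin N → Fin 2) (W : Matrix (Fin 2) (Fin N) ℂ) (l : Fin 2) (j : Fin N) :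
    (W * laxGenerator x u v β) l j =
      W l j * (∑ k, (x j - x k)⁻¹ ^ 2 * (v j ⬝ᵥ u k) * v k (β j)) -
        ∑ k, (x j - x k)⁻¹ ^ 2 * (v k ⬝ᵥ u j) * W l k := by
  rw [laxGenerator, Matrix.mul_sub, Matrix.sub_apply, Matrix.mul_diagonal, Matrix.mul_apply]
  congr 1
  refine Finset.sum_congr rfl fun k _ => ?_
  rw [Matrix.of_apply, ← neg_sub (x j), inv_neg, neg_sq]
  ring

namespace IsRationalSolution

variable {N : ℕ} {I : Set ℝ} {M₀ : Mat2} {A : ℝ → Fin N → Mat2} {x : ℝ → Fin N → ℂ}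

/-- With fixed pivots, a rational solution is a solution of the spin Calogero–Moser system. -/
theorem isSpinFlow_pivot (h : IsRationalSolution I M₀ A x) {t : ℝ} (ht : t ∈ I)
    (hI : UniqueDiffWithinAt ℝ I t) {α β : Fin N → Fin 2} (hpiv : ∀ j, A t j (α j) (β j) ≠ 0) :
    IsSpinFlow I x (fun s => pivotCol (A s) β) (fun s => pivotRow (A s) α β)
      (fun s => pivotMomentum M₀ (A s) (x s) α β)
      (laxGenerator (x t) (pivotCol (A t) β) (pivotRow (A t) α β) β) t := by
  have hs := isSpinFactorization_pivot (h.residue_sq ht) (h.residue_anticomm ht) hpiv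
  have hA : A t = fun j => Matrix.vecMulVec (pivotCol (A t) β j) (pivotRow (A t) α β j) :=
    funext hs.factor
  have hone : ∀ j, pivotRow (A t) α β j (β j) = 1 := fun j => inv_mul_cancel₀ (hpiv j)
  have hcol : ∀ j, pivotCol (A t) β j (α j) = A t j (α j) (β j) := fun j => rfl
  have hent : ∀ j k l, A t j k l = pivotCol (A t) β j k * pivotRow (A t) α β j l := fun j k l => by
    conv_lhs => rw [hA]
    rfl
  -- The momenta are minus the velocities.
  have hmom : ∀ j, pivotMomentum M₀ (A t) (x t) α β j = -poleDeriv I x t j := fun j => by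
    rw [pivotMomentum, h.residue_mul_regular ht hI]
    simp only [Matrix.smul_apply, smul_eq_mul]
    have := hpiv j
    field_simp
  have hres : ∀ j k l, residueDeriv I A t j k l =
      (∑ i, ((x t j - x t i)⁻¹ ^ 2 * (pivotRow (A t) α β i ⬝ᵥ pivotCol (A t) β j)) *
        pivotCol (A t) β i k) * pivotRow (A t) α β j l -
      pivotCol (A t) β j k * (∑ i, ((x t j - x t i)⁻¹ ^ 2 *
        (pivotRow (A t) α β j ⬝ᵥ pivotCol (A t) β i)) * pivotRow (A t) α β i l) := fun j k l => by
    have h1 := polSum_mulVec (x t) (pivotCol (A t) β) (pivotRow (A t) α β) 2 (x t j)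
      (pivotCol (A t) β j)
    have h2 := vecMul_polSum (x t) (pivotCol (A t) β) (pivotRow (A t) α β) 2 (x t j)
      (pivotRow (A t) α β j)
    rw [← hA] at h1 h2
    rw [(h.laurent_coefficients ht hI j).2.1]
    have h3 : polSum (x t) (A t) 2 (x t j) * A t j - A t j * polSum (x t) (A t) 2 (x t j) =
        Matrix.vecMulVec (polSum (x t) (A t) 2 (x t j) *ᵥ pivotCol (A t) β j)
          (pivotRow (A t) α β j) - Matrix.vecMulVec (pivotCol (A t) β j)
          (pivotRow (A t) α β j ᵥ* polSum (x t) (A t) 2 (x t j)) := by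
      rw [← Matrix.mul_vecMulVec, ← Matrix.vecMulVec_mul, ← hs.factor j]
    rw [h3, h1, h2]
    simp [Matrix.vecMulVec_apply, Finset.sum_apply]
  have hd := h.matDeriv_residue ht
  refine ⟨h.pole_injective t ht, hs.isotropic, ?_, ?_, ?_, ?_, ?_⟩
  · intro j k hjk
    simp only [laxGenerator, Matrix.sub_apply, Matrix.diagonal_apply_ne _ hjk, Matrix.of_apply,
      zero_sub]
  · intro j
    rw [hmom, neg_neg]
    exact h.hasDerivWithinAt_pole ht j
  · intro j l
    have h1 : HasDerivWithinAt (fun s => (A s j (α j) (β j))⁻¹ * A s j (α j) l)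
        (-residueDeriv I A t j (α j) (β j) / A t j (α j) (β j) ^ 2 * A t j (α j) l +
          (A t j (α j) (β j))⁻¹ * residueDeriv I A t j (α j) l) I t :=
      ((hd j (α j) (β j)).fun_inv (hpiv j)).mul (hd j (α j) l)
    convert! h1 using 1
    rw [hres, hres, hone, hent j (α j) l, hcol, laxGenerator_mul_apply]
    simp only [Matrix.of_apply]
    generalize (∑ i, (x t j - x t i)⁻¹ ^ 2 *
      (pivotRow (A t) α β j ⬝ᵥ pivotCol (A t) β i) * pivotRow (A t) α β i (β j)) = S
    generalize (∑ i, (x t j - x t i)⁻¹ ^ 2 *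
      (pivotRow (A t) α β j ⬝ᵥ pivotCol (A t) β i) * pivotRow (A t) α β i l) = S'
    generalize (∑ i, (x t j - x t i)⁻¹ ^ 2 * (pivotRow (A t) α β i ⬝ᵥ pivotCol (A t) β j) *
        pivotCol (A t) β i (α j)) = S''
    have := hpiv j
    field_simp
    ring
  · intro k j
    convert! hd j k (β j) using 1
    rw [hres, hone, Matrix.neg_apply, mul_laxGenerator_apply]
    simp only [Matrix.of_apply, Matrix.transpose_apply]
    ring
  · intro j
    have h1 : HasDerivWithinAt (fun s => -((A s j (α j) (β j))⁻¹ *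
        (A s j * (M₀ + ratC (A s) (x s) (x s j))) (α j) (β j)))
        (-(-residueDeriv I A t j (α j) (β j) / A t j (α j) (β j) ^ 2 *
            (A t j * (M₀ + ratC (A t) (x t) (x t j))) (α j) (β j) +
          (A t j (α j) (β j))⁻¹ * (poleDeriv I x t j • residueDeriv I A t j -
            (2 : ℂ) • (A t j * polSum (x t) (A t) 3 (x t j) * A t j)) (α j) (β j))) I t :=
      (((hd j (α j) (β j)).fun_inv (hpiv j)).mul
        (h.matDeriv_residue_mul_regular ht hI j (α j) (β j))).neg
    convert! h1 using 1
    have h2 := polSum_mulVec (x t) (pivotCol (A t) β) (pivotRow (A t) α β) 3 (x t j)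
      (pivotCol (A t) β j)
    rw [← hA] at h2
    have h3 : A t j * polSum (x t) (A t) 3 (x t j) * A t j =
        (∑ k, (x t j - x t k)⁻¹ ^ 3 * ((pivotRow (A t) α β j ⬝ᵥ pivotCol (A t) β k) *
          (pivotRow (A t) α β k ⬝ᵥ pivotCol (A t) β j))) • A t j := by
      rw [hs.factor j, Matrix.mul_assoc, Matrix.mul_vecMulVec, h2, Matrix.vecMulVec_mul_vecMulVec,
        dotProduct_sum, Matrix.vecMulVec_smul]
      congr 1
      refine Finset.sum_congr rfl fun k _ => ?_
      rw [dotProduct_smul, smul_eq_mul]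
      ring
    rw [h3, h.residue_mul_regular ht hI]
    simp only [Matrix.sub_apply, Matrix.smul_apply, smul_eq_mul]
    have := hpiv j
    field_simp
    ring

/-- The determinant of the pencil at time `0` with parameter `t` is the one at time `t` with
parameter `0`, also after coupling with the spins. -/
theorem det_pencil_eq (h : IsRationalSolution I M₀ A x) (hI : I.OrdConnected) (h0 : (0 : ℝ) ∈ I)
    {t : ℝ} (ht : t ∈ I) {u v u' v' : Fin N → Fin 2 → ℂ} {ℓ ℓ' : Fin N → ℂ}
    (hs : IsSpinFactorization M₀ (A 0) (x 0) u v ℓ)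
    (hs' : IsSpinFactorization M₀ (A t) (x t) u' v' ℓ') (y : ℂ) (E : Mat2) :
    (pencil (x 0) u v ℓ t y + Matrix.of v * E * (Matrix.of u)ᵀ).det =
      (pencil (x t) u' v' ℓ' 0 y + Matrix.of v' * E * (Matrix.of u')ᵀ).det := by
  -- For `t = 0` the interval may be a single point, where derivatives carry no information.
  rcases eq_or_ne t 0 with rfl | hne
  · simpa using hs.det_pencil_eq hs' (h.residue_ne_zero 0 h0) 0 y E
  -- `Δ` uses an arbitrary factorization at each time; near a given time it may be replaced by the
  -- differentiable one with fixed pivots.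
  have hex : ∀ s, ∃ u v ℓ, s ∈ I → IsSpinFactorization M₀ (A s) (x s) u v ℓ := fun s => by
    by_cases hsI : s ∈ I
    · obtain ⟨u, v, ℓ, h1⟩ := exists_isSpinFactorization (h.residue_sq hsI)
        (h.residue_anticomm hsI) (h.residue_ne_zero s hsI)
      exact ⟨u, v, ℓ, fun _ => h1⟩
    · exact ⟨0, 0, 0, fun h1 => absurd h1 hsI⟩
  choose U V L hUVL using hex
  have hconv : Convex ℝ I := hI.convex
  have hint : (interior I).Nonempty := by
    have h1 : Set.uIcc 0 t ⊆ I := hI.uIcc_subset h0 ht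
    refine Set.Nonempty.mono (interior_mono h1) ?_
    rw [Set.uIcc, interior_Icc, Set.nonempty_Ioo]
    exact min_lt_max.2 hne.symm
  have hud : UniqueDiffOn ℝ I := uniqueDiffOn_convex hconv hint
  let Δ : ℝ → ℂ := fun s => (pencil (x s) (U s) (V s) (L s) ((t : ℂ) - (s : ℂ)) y +
    Matrix.of (V s) * E * (Matrix.of (U s))ᵀ).det
  have hΔ : ∀ s ∈ I, HasDerivWithinAt Δ 0 I s := by
    intro s hsI
    have h1 : ∀ j, ∃ α β, A s j α β ≠ 0 := fun j => by
      by_contra! hc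
      exact h.residue_ne_zero s hsI j (Matrix.ext hc)
    choose α β hpiv using h1
    have h2 := hasDerivWithinAt_det_of_lax
      ((h.isSpinFlow_pivot hsI (hud s hsI) hpiv).matDeriv_pencil t y E)
    have hev : ∀ᶠ r in 𝓝[I] s, ∀ j, A r j (α j) (β j) ≠ 0 := eventually_all.2 fun j =>
      (h.matDeriv_residue hsI j (α j) (β j)).continuousWithinAt.eventually_ne (hpiv j)
    have heq : Δ =ᶠ[𝓝[I] s] fun r => (pencil (x r) (pivotCol (A r) β) (pivotRow (A r) α β)
        (pivotMomentum M₀ (A r) (x r) α β) ((t : ℂ) - (r : ℂ)) y +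
        Matrix.of (pivotRow (A r) α β) * E * (Matrix.of (pivotCol (A r) β))ᵀ).det := by
      filter_upwards [hev, self_mem_nhdsWithin] with r hr hrI
      exact (hUVL r hrI).det_pencil_eq
        (isSpinFactorization_pivot (h.residue_sq hrI) (h.residue_anticomm hrI) hr)
        (h.residue_ne_zero r hrI) _ y E
    exact h2.congr_of_eventuallyEq heq (heq.eq_of_nhdsWithin hsI)
  have hconst : Δ 0 = Δ t := by
    have h1 := hconv.norm_image_sub_le_of_norm_hasDerivWithin_le (C := 0) (f := Δ)
      (f' := fun _ => 0) hΔ (fun _ _ => by simp) ht h0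
    rw [zero_mul, norm_le_zero_iff, sub_eq_zero] at h1
    exact h1
  have e0 := hs.det_pencil_eq (hUVL 0 h0) (h.residue_ne_zero 0 h0) t y E
  have et := hs'.det_pencil_eq (hUVL t ht) (h.residue_ne_zero t ht) 0 y E
  rw [e0, et]
  simpa [Δ] using hconst

/-- The resolvent formula for the rational function `∑ A_j(t) / (x_j(t) - y)` in terms of the data
at time `0`. -/
theorem exists_resolvent (h : IsRationalSolution I M₀ A x) (hI : I.OrdConnected)
    (h0 : (0 : ℝ) ∈ I) {t : ℝ} (ht : t ∈ I) (y : ℝ) :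
    ∃ u v ℓ, IsSpinFactorization M₀ (A 0) (x 0) u v ℓ ∧ IsUnit (pencil (x 0) u v ℓ t y).det ∧
      (Matrix.of u)ᵀ * (pencil (x 0) u v ℓ t y)⁻¹ * Matrix.of v =
        ∑ j, (x t j - (y : ℂ))⁻¹ • A t j := by
  obtain ⟨u, v, ℓ, hs⟩ := exists_isSpinFactorization (h.residue_sq h0) (h.residue_anticomm h0)
    (h.residue_ne_zero 0 h0)
  obtain ⟨u', v', ℓ', hs'⟩ := exists_isSpinFactorization (h.residue_sq ht) (h.residue_anticomm ht)
    (h.residue_ne_zero t ht)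
  have hne : ∀ j, x t j - (y : ℂ) ≠ 0 := fun j e => by
    have h1 := congrArg Complex.im e
    simp at h1
    exact (h.im_pos t ht j).ne' h1
  have hdiag : pencil (x t) u' v' ℓ' 0 y = Matrix.diagonal fun j => x t j - (y : ℂ) := by
    ext j k
    by_cases hjk : j = k
    · subst hjk
      simp [pencil]
    · simp [pencil, hjk]
  have hinv : (Matrix.diagonal fun j => x t j - (y : ℂ))⁻¹ =
      Matrix.diagonal fun j => (x t j - (y : ℂ))⁻¹ := by
    refine Matrix.inv_eq_right_inv ?_
    rw [Matrix.diagonal_mul_diagonal, ← Matrix.diagonal_one]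
    congr 1
    funext j
    exact mul_inv_cancel₀ (hne j)
  have hdet' : IsUnit (Matrix.diagonal fun j => x t j - (y : ℂ)).det := by
    rw [Matrix.det_diagonal, isUnit_iff_ne_zero]
    exact Finset.prod_ne_zero_iff.2 fun j _ => hne j
  have key := fun E => h.det_pencil_eq hI h0 ht hs hs' y E
  rw [hdiag] at key
  have hdet : (pencil (x 0) u v ℓ t y).det = (Matrix.diagonal fun j => x t j - (y : ℂ)).det := by
    simpa using key 0
  have hunit : IsUnit (pencil (x 0) u v ℓ t y).det := hdet ▸ hdet'
  refine ⟨u, v, ℓ, hs, hunit, ?_⟩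
  -- The entries of `u P⁻¹ v` are read off from determinants of rank-one perturbations of `P`.
  have hrank : ∀ (P : Matrix (Fin N) (Fin N) ℂ) (u v : Fin N → Fin 2 → ℂ) (a b : Fin 2),
      IsUnit P.det → (P + Matrix.of v * Matrix.single b a (1 : ℂ) * (Matrix.of u)ᵀ).det =
        P.det * (1 + ((Matrix.of u)ᵀ * P⁻¹ * Matrix.of v) a b) := by
    intro P u v a b hP
    have h1 : Matrix.of v * Matrix.single b a (1 : ℂ) * (Matrix.of u)ᵀ =
        Matrix.replicateCol Unit (fun j => v j b) * Matrix.replicateRow Unit fun j => u j a := by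
      ext j k
      fin_cases a <;> fin_cases b <;> simp [Matrix.mul_apply, Matrix.single_apply]
    rw [h1, Matrix.det_add_replicateCol_mul_replicateRow hP]
    congr 1
    rw [Matrix.det_unique]
    simp [Matrix.mul_apply]
  have h3 : (Matrix.of u)ᵀ * (pencil (x 0) u v ℓ t y)⁻¹ * Matrix.of v =
      (Matrix.of u')ᵀ * (Matrix.diagonal fun j => x t j - (y : ℂ))⁻¹ * Matrix.of v' := by
    ext a b
    have h4 := key (Matrix.single b a (1 : ℂ))
    rw [hrank _ _ _ _ _ hunit, hrank _ _ _ _ _ hdet', hdet] at h4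
    exact add_left_cancel (mul_left_cancel₀ hdet'.ne_zero h4)
  rw [h3, hinv]
  ext a b
  rw [Matrix.mul_apply, Matrix.sum_apply]
  refine Finset.sum_congr rfl fun j _ => ?_
  rw [Matrix.mul_diagonal, Matrix.smul_apply, hs'.factor j, Matrix.vecMulVec_apply]
  simp only [Matrix.transpose_apply, Matrix.of_apply, smul_eq_mul]
  ring

end IsRationalSolution

/-! ### The explicit formula -/

theorem continuous_pole_sum {N : ℕ} (A : Fin N → Mat2) {x : Fin N → ℂ} (hx : ∀ j, 0 < (x j).im) :
    Continuous fun y : ℝ => ∑ j, ((y : ℂ) - star (x j))⁻¹ • (A j)ᴴ :=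
  continuous_finsetSum _ fun j _ =>
    (continuous_pole (by simpa using (hx j).ne')).smul continuous_const

theorem hasIPlus_sum_matPole {N : ℕ} {x : Fin N → ℂ} (hx : ∀ j, 0 < (x j).im) (R : Fin N → Mat2)
    (a b : Fin 2) :
    HasIPlus ((∑ j, matPole (star (x j)) (R j)) a b)
      (((-(2 * Real.pi * Complex.I) : ℂ) • ∑ j, R j) a b) := by
  have h1 := HasIPlus.sum Finset.univ fun j _ =>
    (hasIPlus_polePlus (z := star (x j)) (by simpa using hx j)).smul (R j a b)
  convert! h1 using 1
  · rw [Matrix.sum_apply]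
    rfl
  · rw [Matrix.smul_apply, Matrix.sum_apply, smul_eq_mul, Finset.mul_sum]
    exact Finset.sum_congr rfl fun j _ => mul_comm _ _

theorem mainTheorem1 {N : ℕ} (I : Set ℝ) (hI : I.OrdConnected) (h0 : (0 : ℝ) ∈ I)
    (M₀ : Mat2) (A : ℝ → Fin N → Mat2) (x : ℝ → Fin N → ℂ)
    (h : IsRationalSolution I M₀ A x) (t : ℝ) (ht : t ∈ I) :
    ∃ F : ℝ → Mat2, Continuous F ∧
      (∀ a b, ∀ᵐ y, (piPlusV (A t) (x t) (h.im_pos t ht) a b : L2) y = F y a b) ∧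
      ∀ y : ℝ,
        Function.Injective (gerardOp (symbolM M₀ (A 0) (x 0) (h.im_pos 0 h0)) t y) ∧
        ∃ (f : Matrix (Fin 2) (Fin 2) hardyG.domain) (c : Mat2),
          gerardOp (symbolM M₀ (A 0) (x 0) (h.im_pos 0 h0)) t y f =
            piPlusV (A 0) (x 0) (h.im_pos 0 h0) ∧
          (∀ a b, HasIPlus (f a b) (c a b)) ∧
          F y = (1 / (2 * Complex.I * (Real.pi : ℂ))) • c := by
  refine ⟨_, continuous_pole_sum (A t) (h.im_pos t ht),
    piPlusV_ae (A t) (x t) (h.im_pos t ht), fun y => ?_⟩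
  obtain ⟨u, v, ℓ, hs, hdet, hres⟩ := h.exists_resolvent hI h0 ht y
  have hx := h.im_pos 0 h0
  have hsolve := exists_gerardOp_eq hx (h.pole_injective 0 h0) (h.hermitian_const h0) hs t y hdet
  have hstar : ∀ j, (A 0 j)ᴴ = Matrix.vecMulVec (star (v j)) (star (u j)) := fun j => by
    rw [hs.factor j, Matrix.conjTranspose_vecMulVec]
  refine ⟨?_, ?_⟩
  · -- The coefficient `κ_k = δ_{jk} R v_j^*` produces the residue `R A_j^*` at `conj x_j`.
    refine gerardOp_injective hx (h.hermitian h0) (fun z hz hz' => ?_) t y fun R j => ?_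
    · rw [ratC_eq_polSum]
      refine h.sq_eq_one h0 z ?_
      rintro ⟨j | j, hj⟩
      · exact hz j hj.symm
      · exact hz' j hj.symm
    · obtain ⟨w, -, hw⟩ := hsolve fun k => if k = j then R *ᵥ star (v j) else 0
      refine ⟨w, hw.trans ?_⟩
      rw [Finset.sum_eq_single j]
      · rw [if_pos rfl, hstar, Matrix.mul_vecMulVec]
      · intro k _ hk
        rw [if_neg hk, Matrix.zero_vecMulVec, matPole_zero]
      · exact fun hj => absurd (Finset.mem_univ j) hj
  · -- `Π₊ V₀` has the coefficients `κ_j = v_j^*`.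
    obtain ⟨d, hd, hw⟩ := hsolve ((Matrix.of v).map star)
    refine ⟨d, (-(2 * Real.pi * Complex.I) : ℂ) • ∑ j, Matrix.vecMulVec
      ((((pencil (x 0) u v ℓ t y)⁻¹).map star * (Matrix.of v).map star) j) (star (u j)),
      hw.trans ?_, fun a b => ?_, ?_⟩
    · rw [piPlusV_eq]
      exact Finset.sum_congr rfl fun j _ => by
        rw [hstar]
        rfl
    · have h1 := congrFun (congrFun hd a) b
      rw [Matrix.map_apply] at h1
      rw [h1]
      exact hasIPlus_sum_matPole hx _ a b
    · have h1 : ∑ j, Matrix.vecMulVec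
          ((((pencil (x 0) u v ℓ t y)⁻¹).map star * (Matrix.of v).map star) j)
          (star (u j)) = ((Matrix.of u)ᵀ * (pencil (x 0) u v ℓ t y)⁻¹ * Matrix.of v)ᴴ := by
        rw [Matrix.mul_assoc, Matrix.conjTranspose_mul]
        ext a b
        rw [Matrix.mul_apply, Matrix.sum_apply]
        refine Finset.sum_congr rfl fun j _ => ?_
        rw [Matrix.vecMulVec_apply, Matrix.conjTranspose_apply, Matrix.mul_apply, Matrix.mul_apply,
          star_sum]
        congr 1
        refine Finset.sum_congr rfl fun k _ => ?_
        rw [Matrix.map_apply, star_mul']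
        rfl
      have h2 : (1 / (2 * Complex.I * (Real.pi : ℂ))) * -(2 * Real.pi * Complex.I) = -1 := by
        have h3 : (Real.pi : ℂ) ≠ 0 := Complex.ofReal_ne_zero.2 Real.pi_ne_zero
        have h4 := Complex.I_ne_zero
        field_simp
      rw [h1, hres, smul_smul, h2, Matrix.conjTranspose_sum, neg_one_smul, ← Finset.sum_neg_distrib]
      refine Finset.sum_congr rfl fun j _ => ?_
      have h5 : star (y : ℂ) = y := Complex.conj_ofReal y
      rw [Matrix.conjTranspose_smul, star_inv₀, star_sub, h5, ← neg_smul, ← inv_neg, neg_sub]
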